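/- **Setting.** Let $\Gamma\subset\mathrm{SL}(2,\mathbb R)$ be a discrete subgroup commensurable with $\mathrm{SL}(2,\mathbb Z)$, let $\chi:\Gamma\to\mathbb C^\times$ be a character of finite order, and let $\mathbb H$ be the upper half plane. Let $\phi$ be a quasimodular form of weight $2$ and depth $1$ on $\Gamma$: $\phi$ is holomorphic on $\mathbb H$ and at the cusps, and for some $\alpha\in\mathbb C\setminus\{0\}$ $$(cz+d)^{-2}\phi(\gamma z)=\phi(z)+\frac{\alpha c}{cz+d}\qquad\text{for all }\gamma=\begin{pmatrix}a&b\\c&d\end{pmatrix}\in\Gamma .$$ Let $f=f_0+f_1\phi+f_2\phi^2$ be a quasimodular form of weight $k$, depth $2$ and character $\chi$ on $\Gamma$, i.e. $f_j$ is a holomorphic modular form of weight $k-2j$ with character $\chi$ on $\Gamma$, and $f_2\not\equiv0$. Put $$h_1=z^2f+\alpha z(f_1+2f_2\phi)+\alpha^2f_2,\qquad h_2=2zf+\alpha(f_1+2f_2\phi),\qquad h_3=f,$$ $$W_f=\det\bigl(h_i,\,h_i',\,h_i''\bigr)_{i=1,2,3},\qquad g_j=h_j/\sqrt[3]{W_f},$$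 $$Q_2=\frac{g_1'''g_2-g_1g_2'''}{g_1g_2'-g_1'g_2},\qquad Q_3=\frac{g_1'g_2'''-g_2'g_1'''}{g_1g_2'-g_1'g_2}.$$ (The quotients do not depend on the branch of the cube root and are meromorphic on $\mathbb H$.) Consider the equation $$y'''+Q_2(z)y'+Q_3(z)y=0,\qquad z\in\mathbb H. \tag{$*$}$$ **Terminology.** A singular point of $(*)$ in $\mathbb H$ is a pole of $Q_2$ or $Q_3$. If at $z_0\in\mathbb H$ the coefficients $Q_j$ ($j=2,3$) have poles of order at most $j$, with $A_j$ the coefficient of $(z-z_0)^{-j}$, the local exponents $\kappa_{z_0}^{(1)},\kappa_{z_0}^{(2)},\kappa_{z_0}^{(3)}$ are the roots of $\kappa(\kappa-1)(\kappa-2)+A_2\kappa+A_3$; the point $z_0$ is apparent if no solution has a logarithmic singularity there. For a cusp $s=\sigma\infty$ of $\Gamma$ with $\sigma=\begin{pmatrix}a&b\\c&d\end{pmatrix}\in\mathrm{SL}(2,\mathbb Z)$, let $N>0$ be its width (the least $N>0$ with $\pm\begin{pmatrix}1&N\\0&1\end{pmatrix}\in\sigma^{-1}\Gamma\sigma$),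 $q_N=e^{2\pi iz/N}$, and let $Q_2^\sigma(z)=(cz+d)^{-4}Q_2(\sigma z)$, $Q_3^\sigma(z)=(cz+d)^{-6}Q_3(\sigma z)-2c(cz+d)^{-5}Q_2(\sigma z)$ be the coefficients of the equation satisfied by the functions $(cz+d)^2y(\sigma z)$, with $y$ a solution of $(*)$. The equation $(*)$ is Fuchsian at $s$ if $Q_2^\sigma$, $Q_3^\sigma$ are holomorphic functions of $q_N$ near $q_N=0$; the local exponents $\kappa_s^{(j)}$ are then the roots of $\kappa^3+\left(\frac N{2\pi i}\right)^2Q_2^\sigma(i\infty)\,\kappa+\left(\frac N{2\pi i}\right)^3Q_3^\sigma(i\infty)$. The cusp $s$ is maximally unipotent (completely not apparent) if some solution of the transformed equation near $i\infty$ contains a non-zero $(\log q_N)^2$-term, i.e. has the form $q_N^{\kappa}\bigl(z^2a(q_N)+zb(q_N)+c(q_N)\bigr)$ with $a,b,c$ holomorphic at $0$ and $a\not\equiv0$. **Theorem.** $W_f\not\equiv0$, every branch of $g_1,g_2,g_3$ on an open subset of $\mathbb H$ where $W_f\ne0$ solves $(*)$, and: 1. $(*)$ is a modular ordinary differential equation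 on $\Gamma$: $Q_2$ and $Q_3-\frac12Q_2'$ are meromorphic modular forms on $\Gamma$ (meromorphic on $\mathbb H$ and at the cusps, trivial character) of weight $4$ and $6$, respectively. 2. The following three conditions hold. * (H1) $(*)$ is Fuchsian on $\mathbb H\cup\{\text{cusps}\}$; on $\mathbb H$ this means that every pole of $Q_j$ has order at most $j$ ($j=2,3$). * (H2) At every singular point $z_0\in\mathbb H$ the exponents can be ordered as $\kappa_{z_0}^{(1)}<\kappa_{z_0}^{(2)}<\kappa_{z_0}^{(3)}$ with $\kappa_{z_0}^{(1)}\in\frac13\mathbb Z_{\le0}$ and $\kappa_{z_0}^{(j)}-\kappa_{z_0}^{(1)}\in\mathbb Z$, and $z_0$ is apparent. * (H3) At every cusp $s$ the exponents can be ordered as $\kappa_s^{(1)}\le\kappa_s^{(2)}\le\kappa_s^{(3)}$ with $\kappa_s^{(1)}\in\frac13\mathbb Z_{\le0}$ and $\kappa_s^{(j)}-\kappa_s^{(1)}\in\mathbb Z$. Moreover, every singular point of $(*)$ in $\mathbb H$ is a zero of $W_f$, and every cusp of $\Gamma$ is maximally unipotent for $(*)$. If $\Gamma=\mathrm{SL}(2,\mathbb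 Z)$, then furthermore: 3. At $i$, the numbers $3\kappa_i^{(j)}$ are integers and $\{3\kappa_i^{(1)},3\kappa_i^{(2)},3\kappa_i^{(3)}\}\equiv\{0,0,1\}\pmod 2$ as multisets. 4. At $\rho=\frac{-1+\sqrt3\,i}2$, all $\kappa_\rho^{(j)}$ are integers and $\{\kappa_\rho^{(1)},\kappa_\rho^{(2)},\kappa_\rho^{(3)}\}\equiv\{0,1,2\}\pmod 3$ as multisets. -/

import Mathlib

open UpperHalfPlane Filter Topology OnePoint Matrix.SpecialLinearGroup
open scoped MatrixGroups ModularForm Manifold Pointwise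

noncomputable section

/-! ### Modular forms with character and the quasimodular form of weight two -/

/-- `f` is a holomorphic modular form of weight `k` with character `χ` on `Γ`.  Since `χ` will
have finite order, `f` slashed to a cusp is periodic, so holomorphy at the cusp is boundedness. -/
structure IsModularFormWithCharacter (Γ : Subgroup (GL (Fin 2) ℝ)) (k : ℤ) (χ : Γ →* ℂˣ)
    (f : ℍ → ℂ) : Prop where
  holo : MDiff f
  slash : ∀ γ : Γ, f ∣[k] (γ : GL (Fin 2) ℝ) = (χ γ : ℂ) • f
  bdd_at_cusps : ∀ c : OnePoint ℝ, IsCusp c Γ → c.IsBoundedAt f k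

/-- `φ` is a quasimodular form of weight `2` and depth `1` on `Γ` (trivial character), with
`(cz+d)⁻² φ(γz) = φ(z) + α c / (cz+d)`. -/
structure IsQuasimodularWeightTwo (Γ : Subgroup (GL (Fin 2) ℝ)) (α : ℂ) (φ : ℍ → ℂ) : Prop where
  holo : MDiff φ
  slash : ∀ (γ : Γ) (z : ℍ), (φ ∣[(2 : ℤ)] (γ : GL (Fin 2) ℝ)) z =
    φ z + α * (((γ : GL (Fin 2) ℝ) 1 0 : ℝ) : ℂ) / denom (γ : GL (Fin 2) ℝ) z
  bdd_at_cusps : ∀ c : OnePoint ℝ, IsCusp c Γ → c.IsBoundedAt φ 2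

/-! ### The functions attached to `f = f₀ + f₁ φ + f₂ φ²` -/

/-- The triple `(h₁, h₂, h₃)` attached to `f = f₀ + f₁ φ + f₂ φ²` (indexed by `0, 1, 2`), as
functions on `ℂ` of which only the values on the open upper half plane matter. -/
def hTriple (α : ℂ) (φ f₀ f₁ f₂ : ℍ → ℂ) : Fin 3 → ℂ → ℂ :=
  let f : ℂ → ℂ := fun z => (f₀ + f₁ * φ + f₂ * φ ^ 2) (ofComplex z)
  let f' : ℂ → ℂ := fun z => (f₁ + 2 * f₂ * φ) (ofComplex z)
  ![fun z => z ^ 2 * f z + α * z * f' z + α ^ 2 * f₂ (ofComplex z),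
    fun z => 2 * z * f z + α * f' z,
    f]

/-- The Wronskian `det (hᵢ, hᵢ', hᵢ'')`. -/
def wronskian₃ (h : Fin 3 → ℂ → ℂ) (z : ℂ) : ℂ :=
  Matrix.det (Matrix.of fun i j : Fin 3 => iteratedDeriv (j : ℕ) (h i) z)

/-- A branch of the cube root of `W` that is holomorphic near `z₀` (if `W` is holomorphic near
`z₀` and `W z₀ ≠ 0`). -/
def cubeRootNear (W : ℂ → ℂ) (z₀ z : ℂ) : ℂ :=
  (W z₀) ^ (1 / 3 : ℂ) * (W z / W z₀) ^ (1 / 3 : ℂ)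

/-- `gⱼ = hⱼ / W^{1/3}`, with the branch of the cube root holomorphic near `z₀`. -/
def gNear (h : Fin 3 → ℂ → ℂ) (z₀ : ℂ) (j : Fin 3) (z : ℂ) : ℂ :=
  h j z / cubeRootNear (wronskian₃ h) z₀ z

/-- `Q₂ = (g₁''' g₂ - g₁ g₂''') / (g₁ g₂' - g₁' g₂)`.  The quotient does not depend on the branch
of the cube root, so at each point we use a branch holomorphic there.
The formula gives a meromorphic function; its values on the discrete set where `W` or the
denominator vanishes are immaterial, and every notion below ignores them. -/
def Q₂ (h : Fin 3 → ℂ → ℂ) (z : ℂ) : ℂ :=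
  let g := gNear h z
  (iteratedDeriv 3 (g 0) z * g 1 z - g 0 z * iteratedDeriv 3 (g 1) z) /
    (g 0 z * deriv (g 1) z - deriv (g 0) z * g 1 z)

/-- `Q₃ = (g₁' g₂''' - g₂' g₁''') / (g₁ g₂' - g₁' g₂)`, with the same conventions as `Q₂`. -/
def Q₃ (h : Fin 3 → ℂ → ℂ) (z : ℂ) : ℂ :=
  let g := gNear h z
  (deriv (g 0) z * iteratedDeriv 3 (g 1) z - deriv (g 1) z * iteratedDeriv 3 (g 0) z) /
    (g 0 z * deriv (g 1) z - deriv (g 0) z * g 1 z)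

/-! ### Meromorphic modular forms

Below `F`, `P`, `Q` are meromorphic functions on the upper half plane (given as functions on `ℂ`).
Identities between meromorphic functions are required off a discrete set. -/

/-- The weight `k` slash operator `(cz+d)^{-k} F(gz)` for `g` of determinant one. -/
def slashC (k : ℤ) (g : GL (Fin 2) ℝ) (F : ℂ → ℂ) (z : ℂ) : ℂ :=
  denom g z ^ (-k) * F (num g z / denom g z)

/-- The width of the cusp `σ∞` of `Γ`: the least `N > 0` with `±(1 N; 0 1) ∈ σ⁻¹ Γ σ`. -/
def cuspWidth (Γ : Subgroup (GL (Fin 2) ℝ)) (σ : SL(2, ℤ)) : ℝ :=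
  Subgroup.widthInfty (ConjAct.toConjAct (mapGL ℝ σ)⁻¹ • Γ)

/-- Near `i∞` we have `F(z) = Φ(q_N)` with `q_N = exp (2πiz/N)`. -/
def HasQExpansion (N : ℝ) (F Φ : ℂ → ℂ) : Prop :=
  ∃ B > 0, ∀ᶠ z in codiscreteWithin {z : ℂ | B < z.im}, F z = Φ (Function.Periodic.qParam N z)

/-- `F` is holomorphic at `i∞` as a function of `q_N`, with value `a` there. -/
def IsHolomorphicAtInfty (N : ℝ) (F : ℂ → ℂ) (a : ℂ) : Prop :=
  ∃ Φ : ℂ → ℂ, AnalyticAt ℂ Φ 0 ∧ Φ 0 = a ∧ HasQExpansion N F Φ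

/-- The property `P σ` holds for all `σ ∈ SL(2, ℤ)` that send `∞` to a cusp of `Γ`.
(Every cusp of a group commensurable with `SL(2, ℤ)` is of the form `σ∞`.) -/
def AtEveryCusp (Γ : Subgroup (GL (Fin 2) ℝ)) (P : SL(2, ℤ) → Prop) : Prop :=
  ∀ s : OnePoint ℝ, IsCusp s Γ → ∀ σ : SL(2, ℤ), mapGL ℝ σ • ∞ = s → P σ

/-- Meromorphic modular forms of weight `k` on `Γ` (trivial character): meromorphic on the upper
half plane and at the cusps, and invariant under the slash operators. -/
structure IsMeromorphicModularForm (Γ : Subgroup (GL (Fin 2) ℝ)) (k : ℤ) (F : ℂ → ℂ) : Prop where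
  meromorphic : MeromorphicOn F {z : ℂ | 0 < z.im}
  slash : ∀ γ ∈ Γ, slashC k γ F =ᶠ[codiscreteWithin {z : ℂ | 0 < z.im}] F
  meromorphic_at_cusps : AtEveryCusp Γ fun σ =>
    ∃ Φ : ℂ → ℂ, MeromorphicAt Φ 0 ∧ HasQExpansion (cuspWidth Γ σ) (slashC k (mapGL ℝ σ) F) Φ

/-! ### The equation `y''' + P y' + Q y = 0` -/

/-- The equation `y''' + P y' + Q y = 0` is a modular ordinary differential equation on `Γ`. -/
def IsMODE (Γ : Subgroup (GL (Fin 2) ℝ)) (P Q : ℂ → ℂ) : Prop :=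
  IsMeromorphicModularForm Γ 4 P ∧ IsMeromorphicModularForm Γ 6 (fun z => Q z - 1 / 2 * deriv P z)

/-- `y` is a holomorphic solution of `y''' + P y' + Q y = 0` on the open set `U`. -/
def IsSolutionOn (P Q : ℂ → ℂ) (U : Set ℂ) (y : ℂ → ℂ) : Prop :=
  DifferentiableOn ℂ y U ∧
    ∀ᶠ z in codiscreteWithin U, iteratedDeriv 3 y z + P z * deriv y z + Q z * y z = 0

/-- `z₀` is a singular point: a pole of one of the coefficients. -/
def IsSingularPoint (P Q : ℂ → ℂ) (z₀ : ℂ) : Prop :=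
  meromorphicOrderAt P z₀ < 0 ∨ meromorphicOrderAt Q z₀ < 0

/-- The local exponents at `z₀`, with multiplicity, are `κ 0, κ 1, κ 2`: they are the roots of
`t(t-1)(t-2) + A₂ t + A₃`, where `Aⱼ` is the coefficient of `(z-z₀)^{-j}` in `P` resp. `Q`. -/
def HasLocalExponents (P Q : ℂ → ℂ) (z₀ : ℂ) (κ : Fin 3 → ℂ) : Prop :=
  ∃ A₂ A₃ : ℂ, Tendsto (fun z => (z - z₀) ^ 2 * P z) (𝓝[≠] z₀) (𝓝 A₂) ∧
    Tendsto (fun z => (z - z₀) ^ 3 * Q z) (𝓝[≠] z₀) (𝓝 A₃) ∧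
    ∀ t : ℂ, t * (t - 1) * (t - 2) + A₂ * t + A₃ = ∏ j, (t - κ j)

/-- The disc of radius `r` around `z₀`, slit along a radius. -/
def slitDisc (z₀ : ℂ) (r : ℝ) : Set ℂ :=
  {z | z - z₀ ∈ Complex.slitPlane ∧ ‖z - z₀‖ < r}

/-- No solution has a logarithmic singularity at `z₀`: in small slit discs around `z₀` every
solution is of the form `∑ (z-z₀)^{κⱼ} uⱼ(z)` with `κⱼ` the local exponents and `uⱼ` holomorphic
at `z₀`. -/
def IsApparentAt (P Q : ℂ → ℂ) (z₀ : ℂ) : Prop :=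
  ∃ κ : Fin 3 → ℂ, HasLocalExponents P Q z₀ κ ∧
    ∀ᶠ r in 𝓝[>] (0 : ℝ), ∀ y : ℂ → ℂ, IsSolutionOn P Q (slitDisc z₀ r) y →
      ∃ u : Fin 3 → ℂ → ℂ, (∀ j, DifferentiableOn ℂ (u j) (Metric.ball z₀ r)) ∧
        ∀ z ∈ slitDisc z₀ r, y z = ∑ j, (z - z₀) ^ (κ j) * u j z

/-! If `y` solves `y''' + P y' + Q y = 0`, then `(cz+d)² y(σz)` solves the equation with the
coefficients `transP σ P` and `transQ σ P Q`.  For `σ ∈ SL(2, ℤ)` this is the equation whose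
behaviour at `i∞` describes the original one at the cusp `σ∞`. -/

/-- `(cz+d)^{-4} P(σz)`. -/
def transP (σ : SL(2, ℤ)) (P : ℂ → ℂ) : ℂ → ℂ := slashC 4 (mapGL ℝ σ) P

/-- `(cz+d)^{-6} Q(σz) - 2c (cz+d)^{-5} P(σz)`. -/
def transQ (σ : SL(2, ℤ)) (P Q : ℂ → ℂ) (z : ℂ) : ℂ :=
  slashC 6 (mapGL ℝ σ) Q z - 2 * ((σ 1 0 : ℤ) : ℂ) * slashC 5 (mapGL ℝ σ) P z

/-- The equation is Fuchsian at the cusp `σ∞`. -/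
def IsFuchsianAtCusp (Γ : Subgroup (GL (Fin 2) ℝ)) (P Q : ℂ → ℂ) (σ : SL(2, ℤ)) : Prop :=
  ∃ a₂ a₃ : ℂ, IsHolomorphicAtInfty (cuspWidth Γ σ) (transP σ P) a₂ ∧
    IsHolomorphicAtInfty (cuspWidth Γ σ) (transQ σ P Q) a₃

/-- The local exponents at the cusp `σ∞` of width `N`, with multiplicity, are `κ 0, κ 1, κ 2`: they
are the roots of `t³ + (N/2πi)² a₂ t + (N/2πi)³ a₃`, where `a₂`, `a₃` are the values of the
coefficients at the cusp. -/
def HasCuspExponents (Γ : Subgroup (GL (Fin 2) ℝ)) (P Q : ℂ → ℂ) (σ : SL(2, ℤ))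
    (κ : Fin 3 → ℂ) : Prop :=
  ∃ a₂ a₃ : ℂ, IsHolomorphicAtInfty (cuspWidth Γ σ) (transP σ P) a₂ ∧
    IsHolomorphicAtInfty (cuspWidth Γ σ) (transQ σ P Q) a₃ ∧
    ∀ t : ℂ, t ^ 3 + ((cuspWidth Γ σ : ℂ) / (2 * Real.pi * Complex.I)) ^ 2 * a₂ * t +
      ((cuspWidth Γ σ : ℂ) / (2 * Real.pi * Complex.I)) ^ 3 * a₃ = ∏ j, (t - κ j)

/-- The cusp `σ∞` of width `N` is completely not apparent (maximally unipotent): some solution of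
the transformed equation near `i∞` has an expansion `q_N^κ (z² a(q_N) + z b(q_N) + c(q_N))` with a
non-zero `z²`-term; recall that `z = (N/2πi) log q_N`. -/
def IsMaximallyUnipotentAtCusp (Γ : Subgroup (GL (Fin 2) ℝ)) (P Q : ℂ → ℂ) (σ : SL(2, ℤ)) : Prop :=
  ∃ B > 0, ∃ y : ℂ → ℂ, IsSolutionOn (transP σ P) (transQ σ P Q) {z : ℂ | B < z.im} y ∧
    ∃ (κ : ℂ) (a b c : ℂ → ℂ), AnalyticAt ℂ a 0 ∧ AnalyticAt ℂ b 0 ∧ AnalyticAt ℂ c 0 ∧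
      ¬ (a =ᶠ[𝓝 0] 0) ∧
      ∀ z : ℂ, B < z.im →
        let q := Function.Periodic.qParam (cuspWidth Γ σ) z
        y z = Complex.exp (2 * Real.pi * Complex.I * κ * z / cuspWidth Γ σ) *
          (z ^ 2 * a q + z * b q + c q)

/-- (H1): the equation is Fuchsian on the upper half plane and at the cusps. -/
def ConditionH1 (Γ : Subgroup (GL (Fin 2) ℝ)) (P Q : ℂ → ℂ) : Prop :=
  (∀ z₀ : ℂ, 0 < z₀.im → MeromorphicAt P z₀ ∧ MeromorphicAt Q z₀ ∧
    ((-2 : ℤ) : WithTop ℤ) ≤ meromorphicOrderAt P z₀ ∧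
    ((-3 : ℤ) : WithTop ℤ) ≤ meromorphicOrderAt Q z₀) ∧
  AtEveryCusp Γ (IsFuchsianAtCusp Γ P Q)

/-- (H2): at every singular point in the upper half plane the exponents satisfy
`κ₁ < κ₂ < κ₃`, `κ₁ ∈ ⅓ ℤ_{≤ 0}`, `κⱼ - κ₁ ∈ ℤ`, and the singular point is apparent. -/
def ConditionH2 (P Q : ℂ → ℂ) : Prop :=
  ∀ z₀ : ℂ, 0 < z₀.im → IsSingularPoint P Q z₀ →
    (∃ κ : Fin 3 → ℝ, HasLocalExponents P Q z₀ (fun j => (κ j : ℂ)) ∧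
      κ 0 < κ 1 ∧ κ 1 < κ 2 ∧ (∃ m : ℤ, m ≤ 0 ∧ κ 0 = m / 3) ∧
      ∀ j, ∃ n : ℤ, κ j - κ 0 = n) ∧
    IsApparentAt P Q z₀

/-- (H3): at every cusp the exponents satisfy `κ₁ ≤ κ₂ ≤ κ₃`, `κ₁ ∈ ⅓ ℤ_{≤ 0}` and
`κⱼ - κ₁ ∈ ℤ`. -/
def ConditionH3 (Γ : Subgroup (GL (Fin 2) ℝ)) (P Q : ℂ → ℂ) : Prop :=
  AtEveryCusp Γ fun σ =>
    ∃ κ : Fin 3 → ℝ, HasCuspExponents Γ P Q σ (fun j => (κ j : ℂ)) ∧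
      κ 0 ≤ κ 1 ∧ κ 1 ≤ κ 2 ∧ (∃ m : ℤ, m ≤ 0 ∧ κ 0 = m / 3) ∧
      ∀ j, ∃ n : ℤ, κ j - κ 0 = n

end

/-!
Dividing three functions `hᵢ` by the cube root of their Wronskian `W` gives a basis of solutions of
an equation `y''' + Q₂ y' + Q₃ y = 0`, whose coefficients are rational in the `hᵢ` and their
derivatives (`coeffTwo`, `coeffThree`, `twisted_equation`).  The cube root is avoided throughout by
working with logarithmic derivatives: `y'/y - W'/(3W)` satisfies the Riccati form of the equation
for every `y ≠ 0` in the span of the `hᵢ` (`isRiccati_twistedLogDeriv`).  The Riccati form is linear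
in `Q₂` and `Q₃`, so the logarithmic derivatives of two solutions determine both.  This principle is
used three times.

* At a point `z₀` the logarithmic derivatives have simple poles.  Hence `Q₂` and `Q₃` have poles of
  order at most two and three, and the exponents are `n - ord W / 3`, with `n` running through the
  three orders of vanishing of functions in the span of the `hᵢ` (`exists_analytic_coefficients`,
  `exists_strictMono_orders`, `hasLocalExponents`).  There are no logarithms, since all solutions
  are combinations of the `hᵢ / W^{1/3}` (`IsSolutionOn.exists_eq_sum`, `isApparentAt`).
* If two triples are related by a Möbius transformation `g`, an automorphy factor and a constant
  invertible matrix, then so are the Riccati equations, and `Q₂`, `Q₃` follow the transformation law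
  of the equation of `(cz+d)² y(gz)` (`IsMoebiusRelated.coefficients_eq`); the combination
  `Q₃ - Q₂'/2` is the one with a pure weight six law (`IsMoebiusRelated.weightSix_eq`).
* At a cusp the logarithmic derivatives of `h₃ / W^{1/3}` and of `(h₂ / h₃)'` are holomorphic in
  `q`, and `Q₂`, `Q₃` are differential polynomials in them (`coefficients_eq_of_logDeriv`,
  `HasCuspExpansion.exists_coefficients`).

For the triple of a quasimodular form of depth two, quasimodularity says that `h₁, h₂, h₃` transform
by the symmetric square of the standard representation (`hTriple_moebius`).  Elements of `Γ` relate
the triple to itself, so `Q₂` and `Q₃ - Q₂'/2` are modular.  An element `σ` of `SL(2, ℤ)` relates it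
to the triple of the same shape built from the slashed data, where `φ` is slashed with a correction
by the cocycle `αc/(cz+d)` (`quasiSlash`); at `i∞` this triple is
`q^p (z² A + z B + C), q^p (2z A + B), q^p A` with `A, B, C` holomorphic in `q`.  The powers of `z`
cancel in `W`, so `h₁ / W^{1/3}` is the solution with a `z²`-term.  The exponents are
`e, e + m, -(2e + m)` with `3e` and `m` integers; their sum is zero, so the lowest is not positive.

The Wronskian is not identically zero: a linear relation between the `hᵢ` is a polynomial in `z`
whose coefficients are quasi-periodic, hence vanish; if `f` itself vanished, applying an element of
`Γ` with `c ≠ 0` would produce such a relation with coefficients that force `f₂ = 0`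
(`linearIndependent_hTriple`, `exists_wronskian₃_ne_zero`).

At an elliptic point the quadratic polynomials with zeros at the two fixed points of the stabiliser
are eigenvectors of the symmetric square (`quadraticVec_symSq`), and the eigenvalue of a function
determines its order of vanishing modulo the order of the element acting
(`IsMoebiusRelated.denom_pow_eq`).
-/

/-! ### The third-order equation attached to three functions -/

/-- The determinant of the matrix with columns `a`, `b`, `c`. -/
def det3 (a b c : Fin 3 → ℂ) : ℂ :=
  a 0 * (b 1 * c 2 - b 2 * c 1) - b 0 * (a 1 * c 2 - a 2 * c 1) + c 0 * (a 1 * b 2 - a 2 * b 1)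

/-- The vector of `n`-th derivatives of the three functions. -/
noncomputable def jet (h : Fin 3 → ℂ → ℂ) (n : ℕ) (z : ℂ) : Fin 3 → ℂ :=
  fun i => iteratedDeriv n (h i) z

theorem wronskian₃_eq_det3 (h : Fin 3 → ℂ → ℂ) (z : ℂ) :
    wronskian₃ h z = det3 (jet h 0 z) (jet h 1 z) (jet h 2 z) := by
  simp only [wronskian₃, Matrix.det_fin_three, Matrix.of_apply, det3, jet]
  simp
  ring

/-- Cramer's rule. -/
theorem det3_cramer (a b c d : Fin 3 → ℂ) (i : Fin 3) :
    det3 a b c * d i = det3 d b c * a i + det3 a d c * b i + det3 a b d * c i := by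
  fin_cases i <;> simp [det3] <;> ring

theorem analyticAt_iteratedDeriv {f : ℂ → ℂ} {z : ℂ} (hf : AnalyticAt ℂ f z) (n : ℕ) :
    AnalyticAt ℂ (iteratedDeriv n f) z := by
  rw [iteratedDeriv_eq_iterate]
  exact hf.iterated_deriv n

theorem hasDerivAt_iteratedDeriv {f : ℂ → ℂ} {z : ℂ} (hf : AnalyticAt ℂ f z) (n : ℕ) :
    HasDerivAt (iteratedDeriv n f) (iteratedDeriv (n + 1) f z) z := by
  rw [iteratedDeriv_succ]
  exact (analyticAt_iteratedDeriv hf n).differentiableAt.hasDerivAt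

theorem analyticAt_det3_jet {h : Fin 3 → ℂ → ℂ} {z : ℂ} (ha : ∀ i, AnalyticAt ℂ (h i) z)
    (l m n : ℕ) : AnalyticAt ℂ (fun ζ => det3 (jet h l ζ) (jet h m ζ) (jet h n ζ)) z := by
  have := fun i n => analyticAt_iteratedDeriv (ha i) n
  simp only [det3, jet]
  fun_prop

theorem analyticAt_wronskian₃ {h : Fin 3 → ℂ → ℂ} {z : ℂ} (ha : ∀ i, AnalyticAt ℂ (h i) z) :
    AnalyticAt ℂ (wronskian₃ h) z := by
  rw [show wronskian₃ h = _ from funext (wronskian₃_eq_det3 h)]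
  exact analyticAt_det3_jet ha 0 1 2

theorem deriv_wronskian₃ {h : Fin 3 → ℂ → ℂ} {z : ℂ} (ha : ∀ i, AnalyticAt ℂ (h i) z) :
    deriv (wronskian₃ h) z = det3 (jet h 0 z) (jet h 1 z) (jet h 3 z) := by
  rw [show wronskian₃ h = _ from funext (wronskian₃_eq_det3 h)]
  have d := fun i n => hasDerivAt_iteratedDeriv (ha i) n
  simp only [det3, jet]
  refine HasDerivAt.deriv (HasDerivAt.congr_deriv
    ((((d 0 0).mul (((d 1 1).mul (d 2 2)).sub ((d 2 1).mul (d 1 2)))).sub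
    ((d 0 1).mul (((d 1 0).mul (d 2 2)).sub ((d 2 0).mul (d 1 2))))).add
    ((d 0 2).mul (((d 1 0).mul (d 2 1)).sub ((d 2 0).mul (d 1 1))))) ?_)
  simp only [Pi.mul_apply, Pi.sub_apply]
  ring

/-- One third of the logarithmic derivative of the Wronskian, that is `w'/w` for `w³ = W`. -/
noncomputable def thirdLogDeriv (h : Fin 3 → ℂ → ℂ) (z : ℂ) : ℂ :=
  deriv (wronskian₃ h) z / (3 * wronskian₃ h z)

/-- The coefficient of `y'` in the equation satisfied by the functions `hᵢ / W^{1/3}`, expressed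
rationally in the `hᵢ` and their derivatives (so that no cube root has to be chosen). -/
noncomputable def coeffTwo (h : Fin 3 → ℂ → ℂ) (z : ℂ) : ℂ :=
  3 * deriv (thirdLogDeriv h) z - 3 * thirdLogDeriv h z ^ 2 -
    det3 (jet h 0 z) (jet h 3 z) (jet h 2 z) / wronskian₃ h z

/-- The coefficient of `y` in the equation satisfied by the functions `hᵢ / W^{1/3}`. -/
noncomputable def coeffThree (h : Fin 3 → ℂ → ℂ) (z : ℂ) : ℂ :=
  deriv (deriv (thirdLogDeriv h)) z - 2 * thirdLogDeriv h z ^ 3 -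
    det3 (jet h 0 z) (jet h 3 z) (jet h 2 z) / wronskian₃ h z * thirdLogDeriv h z -
    det3 (jet h 3 z) (jet h 1 z) (jet h 2 z) / wronskian₃ h z

theorem analyticAt_thirdLogDeriv {h : Fin 3 → ℂ → ℂ} {z : ℂ} (ha : ∀ i, AnalyticAt ℂ (h i) z)
    (hW : wronskian₃ h z ≠ 0) : AnalyticAt ℂ (thirdLogDeriv h) z :=
  (analyticAt_wronskian₃ ha).deriv.div (analyticAt_const.mul (analyticAt_wronskian₃ ha))
    (mul_ne_zero three_ne_zero hW)

theorem analyticAt_coeffTwo {h : Fin 3 → ℂ → ℂ} {z : ℂ} (ha : ∀ i, AnalyticAt ℂ (h i) z)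
    (hW : wronskian₃ h z ≠ 0) : AnalyticAt ℂ (coeffTwo h) z := by
  have h1 := analyticAt_thirdLogDeriv ha hW
  have h2 := h1.deriv
  have h3 := (analyticAt_det3_jet ha 0 3 2).div (analyticAt_wronskian₃ ha) hW
  exact ((analyticAt_const.mul h2).sub (analyticAt_const.mul (h1.pow 2))).sub h3

theorem analyticAt_coeffThree {h : Fin 3 → ℂ → ℂ} {z : ℂ} (ha : ∀ i, AnalyticAt ℂ (h i) z)
    (hW : wronskian₃ h z ≠ 0) : AnalyticAt ℂ (coeffThree h) z := by
  have h1 := analyticAt_thirdLogDeriv ha hW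
  have h2 := h1.deriv.deriv
  have h3 := (analyticAt_det3_jet ha 0 3 2).div (analyticAt_wronskian₃ ha) hW
  have h4 := (analyticAt_det3_jet ha 3 1 2).div (analyticAt_wronskian₃ ha) hW
  exact ((h2.sub (analyticAt_const.mul (h1.pow 3))).sub (h3.mul h1)).sub h4

/-- The operator `y ↦ y' - s y`, which is conjugate to `d/dz` by a function `v` with `v' = -s v`. -/
noncomputable def twistedDeriv (s y : ℂ → ℂ) (z : ℂ) : ℂ := deriv y z - s z * y z

theorem analyticAt_twistedDeriv {s y : ℂ → ℂ} {z : ℂ} (hs : AnalyticAt ℂ s z)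
    (hy : AnalyticAt ℂ y z) : AnalyticAt ℂ (twistedDeriv s y) z :=
  hy.deriv.sub (hs.mul hy)

theorem deriv_mul_eventuallyEq_twistedDeriv {s y v : ℂ → ℂ} {z : ℂ}
    (hy : AnalyticAt ℂ y z) (hv : AnalyticAt ℂ v z)
    (hvs : deriv v =ᶠ[𝓝 z] fun ζ => -(s ζ * v ζ)) :
    deriv (fun ζ => y ζ * v ζ) =ᶠ[𝓝 z] fun ζ => twistedDeriv s y ζ * v ζ := by
  filter_upwards [hy.eventually_analyticAt, hv.eventually_analyticAt, hvs] with ζ h1 h2 h3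
  rw [deriv_fun_mul h1.differentiableAt h2.differentiableAt, h3, twistedDeriv]
  ring

theorem iteratedDeriv_two_mul_eventuallyEq_twistedDeriv {s y v : ℂ → ℂ} {z : ℂ}
    (hs : AnalyticAt ℂ s z) (hy : AnalyticAt ℂ y z) (hv : AnalyticAt ℂ v z)
    (hvs : deriv v =ᶠ[𝓝 z] fun ζ => -(s ζ * v ζ)) :
    iteratedDeriv 2 (fun ζ => y ζ * v ζ) =ᶠ[𝓝 z]
      fun ζ => twistedDeriv s (twistedDeriv s y) ζ * v ζ := by
  have h1 := (deriv_mul_eventuallyEq_twistedDeriv hy hv hvs).deriv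
  have h2 := deriv_mul_eventuallyEq_twistedDeriv (analyticAt_twistedDeriv hs hy) hv hvs
  rw [show iteratedDeriv 2 (fun ζ => y ζ * v ζ) = deriv (deriv fun ζ => y ζ * v ζ) by
    rw [iteratedDeriv_succ, iteratedDeriv_one]]
  exact h1.trans h2

theorem iteratedDeriv_three_mul_eventuallyEq_twistedDeriv {s y v : ℂ → ℂ} {z : ℂ}
    (hs : AnalyticAt ℂ s z) (hy : AnalyticAt ℂ y z) (hv : AnalyticAt ℂ v z)
    (hvs : deriv v =ᶠ[𝓝 z] fun ζ => -(s ζ * v ζ)) :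
    iteratedDeriv 3 (fun ζ => y ζ * v ζ) =ᶠ[𝓝 z]
      fun ζ => twistedDeriv s (twistedDeriv s (twistedDeriv s y)) ζ * v ζ := by
  have h1 := (iteratedDeriv_two_mul_eventuallyEq_twistedDeriv hs hy hv hvs).deriv
  have h2 := deriv_mul_eventuallyEq_twistedDeriv
    (analyticAt_twistedDeriv hs (analyticAt_twistedDeriv hs hy)) hv hvs
  rw [iteratedDeriv_succ]
  exact h1.trans h2

theorem deriv_twistedDeriv {s y : ℂ → ℂ} {z : ℂ} (hs : AnalyticAt ℂ s z)
    (hy : AnalyticAt ℂ y z) :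
    deriv (twistedDeriv s y) z = deriv (deriv y) z - deriv s z * y z - s z * deriv y z := by
  have h1 := hs.differentiableAt.hasDerivAt
  have h2 := hy.differentiableAt.hasDerivAt
  have h3 := hy.deriv.differentiableAt.hasDerivAt
  rw [show twistedDeriv s y = fun ζ => deriv y ζ - s ζ * y ζ from rfl,
    (h3.fun_sub (h1.fun_mul h2)).deriv]
  ring

theorem deriv_deriv_twistedDeriv {s y : ℂ → ℂ} {z : ℂ} (hs : AnalyticAt ℂ s z)
    (hy : AnalyticAt ℂ y z) :
    deriv (deriv (twistedDeriv s y)) z = deriv (deriv (deriv y)) z - deriv (deriv s) z * y z -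
      2 * deriv s z * deriv y z - s z * deriv (deriv y) z := by
  have e : deriv (twistedDeriv s y) =ᶠ[𝓝 z]
      fun ζ => deriv (deriv y) ζ - deriv s ζ * y ζ - s ζ * deriv y ζ := by
    filter_upwards [hs.eventually_analyticAt, hy.eventually_analyticAt] with ζ h1 h2
    exact deriv_twistedDeriv h1 h2
  rw [e.deriv_eq]
  have h0 := hs.differentiableAt.hasDerivAt
  have h1 := hs.deriv.differentiableAt.hasDerivAt
  have h2 := hy.differentiableAt.hasDerivAt
  have h3 := hy.deriv.differentiableAt.hasDerivAt
  have h4 := hy.deriv.deriv.differentiableAt.hasDerivAt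
  rw [((h4.fun_sub (h1.fun_mul h2)).fun_sub (h0.fun_mul h3)).deriv]
  ring

/-- The cube of the twisted derivative, expanded. -/
theorem twistedDeriv_cube {s y : ℂ → ℂ} {z : ℂ} (hs : AnalyticAt ℂ s z) (hy : AnalyticAt ℂ y z) :
    twistedDeriv s (twistedDeriv s (twistedDeriv s y)) z =
      iteratedDeriv 3 y z - 3 * s z * iteratedDeriv 2 y z +
        3 * (s z ^ 2 - deriv s z) * deriv y z +
        (3 * s z * deriv s z - s z ^ 3 - deriv (deriv s) z) * y z := by
  have h1 := analyticAt_twistedDeriv hs hy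
  rw [twistedDeriv, deriv_twistedDeriv hs h1, deriv_deriv_twistedDeriv hs hy]
  rw [show twistedDeriv s (twistedDeriv s y) z =
    deriv (twistedDeriv s y) z - s z * twistedDeriv s y z from rfl, deriv_twistedDeriv hs hy]
  simp only [twistedDeriv, iteratedDeriv_succ, iteratedDeriv_zero]
  ring

/-- The linear combination `∑ cᵢ hᵢ`. -/
def linComb (c : Fin 3 → ℂ) (h : Fin 3 → ℂ → ℂ) (z : ℂ) : ℂ := ∑ i, c i * h i z

theorem analyticAt_linComb {h : Fin 3 → ℂ → ℂ} {z : ℂ} (ha : ∀ i, AnalyticAt ℂ (h i) z)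
    (c : Fin 3 → ℂ) : AnalyticAt ℂ (linComb c h) z := by
  unfold linComb
  fun_prop

theorem linComb_single (h : Fin 3 → ℂ → ℂ) (i : Fin 3) : linComb (Pi.single i 1) h = h i := by
  ext z
  simp [linComb, Pi.single_apply]

theorem iteratedDeriv_linComb {h : Fin 3 → ℂ → ℂ} {z : ℂ} (ha : ∀ i, AnalyticAt ℂ (h i) z)
    (c : Fin 3 → ℂ) (n : ℕ) :
    iteratedDeriv n (linComb c h) z = ∑ i, c i * jet h n z i := by
  induction n generalizing z with
  | zero => simp [linComb, jet]
  | succ n ih =>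
    have e : iteratedDeriv n (linComb c h) =ᶠ[𝓝 z] fun ζ => ∑ i, c i * jet h n ζ i := by
      have : ∀ᶠ ζ in 𝓝 z, ∀ i, AnalyticAt ℂ (h i) ζ :=
        Filter.eventually_all.2 fun i => (ha i).eventually_analyticAt
      filter_upwards [this] with ζ hζ
      exact ih hζ
    rw [iteratedDeriv_succ, e.deriv_eq]
    exact (HasDerivAt.fun_sum fun i _ => (hasDerivAt_iteratedDeriv (ha i) n).const_mul (c i)).deriv

/-- The functions in the span of the `hᵢ` satisfy the third-order equation in terms of the twisted
derivative; this is the equation of the `hᵢ / W^{1/3}` before division by the cube root. -/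
theorem twisted_equation {h : Fin 3 → ℂ → ℂ} {z : ℂ} (ha : ∀ i, AnalyticAt ℂ (h i) z)
    (hW : wronskian₃ h z ≠ 0) (c : Fin 3 → ℂ) :
    twistedDeriv (thirdLogDeriv h)
        (twistedDeriv (thirdLogDeriv h) (twistedDeriv (thirdLogDeriv h) (linComb c h))) z +
      coeffTwo h z * twistedDeriv (thirdLogDeriv h) (linComb c h) z +
      coeffThree h z * linComb c h z = 0 := by
  have hs := analyticAt_thirdLogDeriv ha hW
  have hy := analyticAt_linComb ha c
  rw [twistedDeriv_cube hs hy, twistedDeriv, coeffTwo, coeffThree]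
  rw [← iteratedDeriv_one (f := linComb c h), show linComb c h z = iteratedDeriv 0 (linComb c h) z
    by simp]
  simp only [iteratedDeriv_linComb ha]
  have hs' : 3 * thirdLogDeriv h z * wronskian₃ h z =
      det3 (jet h 0 z) (jet h 1 z) (jet h 3 z) := by
    rw [← deriv_wronskian₃ ha, thirdLogDeriv]
    field_simp
  have key : ∀ i, jet h 3 z i = 3 * thirdLogDeriv h z * jet h 2 z i +
      det3 (jet h 0 z) (jet h 3 z) (jet h 2 z) / wronskian₃ h z * jet h 1 z i +
      det3 (jet h 3 z) (jet h 1 z) (jet h 2 z) / wronskian₃ h z * jet h 0 z i := by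
    intro i
    have := det3_cramer (jet h 0 z) (jet h 1 z) (jet h 2 z) (jet h 3 z) i
    rw [← wronskian₃_eq_det3, ← hs'] at this
    field_simp
    linear_combination this
  generalize det3 (jet h 0 z) (jet h 3 z) (jet h 2 z) / wronskian₃ h z = p at *
  generalize det3 (jet h 3 z) (jet h 1 z) (jet h 2 z) / wronskian₃ h z = r at *
  simp only [Fin.sum_univ_three, key]
  ring

/-- `P` and `Q` satisfy the Riccati form of `y''' + P y' + Q y = 0` with the logarithmic
derivative `l = y'/y`. -/
def IsRiccati (P Q l : ℂ → ℂ) (z : ℂ) : Prop :=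
  deriv (deriv l) z + 3 * l z * deriv l z + l z ^ 3 + P z * l z + Q z = 0

/-- The logarithmic derivative of `y / W^{1/3}`. -/
noncomputable def twistedLogDeriv (h : Fin 3 → ℂ → ℂ) (y : ℂ → ℂ) (z : ℂ) : ℂ :=
  deriv y z / y z - thirdLogDeriv h z

theorem analyticAt_twistedLogDeriv {h : Fin 3 → ℂ → ℂ} {y : ℂ → ℂ} {z : ℂ}
    (ha : ∀ i, AnalyticAt ℂ (h i) z) (hW : wronskian₃ h z ≠ 0) (hy : AnalyticAt ℂ y z)
    (hy0 : y z ≠ 0) : AnalyticAt ℂ (twistedLogDeriv h y) z :=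
  (hy.deriv.div hy hy0).sub (analyticAt_thirdLogDeriv ha hW)

theorem isRiccati_twistedLogDeriv {h : Fin 3 → ℂ → ℂ} {z : ℂ} (ha : ∀ i, AnalyticAt ℂ (h i) z)
    (hW : wronskian₃ h z ≠ 0) (c : Fin 3 → ℂ) (hc : linComb c h z ≠ 0) :
    IsRiccati (coeffTwo h) (coeffThree h) (twistedLogDeriv h (linComb c h)) z := by
  have hs := analyticAt_thirdLogDeriv ha hW
  have hy := analyticAt_linComb ha c
  have hl := analyticAt_twistedLogDeriv ha hW hy hc
  have key := twisted_equation ha hW c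
  set s := thirdLogDeriv h
  set y := linComb c h
  set l := twistedLogDeriv h y with hldef
  have step : ∀ {a : ℂ → ℂ}, AnalyticAt ℂ a z → twistedDeriv s (fun ζ => a ζ * y ζ) =ᶠ[𝓝 z]
      fun ζ => (deriv a ζ + l ζ * a ζ) * y ζ := by
    intro a hha
    filter_upwards [hha.eventually_analyticAt, hy.eventually_analyticAt,
      hy.continuousAt.eventually_ne hc] with ζ h1 h2 h3
    rw [twistedDeriv, deriv_fun_mul h1.differentiableAt h2.differentiableAt, hldef,
      twistedLogDeriv]
    field_simp
    ring
  have congr : ∀ {a b : ℂ → ℂ}, a =ᶠ[𝓝 z] b → twistedDeriv s a =ᶠ[𝓝 z] twistedDeriv s b := by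
    intro a b hab
    filter_upwards [hab, hab.deriv] with ζ h1 h2
    rw [twistedDeriv, twistedDeriv, h1, h2]
  have e1 : twistedDeriv s y =ᶠ[𝓝 z] fun ζ => l ζ * y ζ := by
    simpa using step (a := fun _ => 1) analyticAt_const
  have e2 := (congr e1).trans (step hl)
  have e3 := (congr e2).trans (step (hl.deriv.add (hl.mul hl)))
  rw [e3.eq_of_nhds, e1.eq_of_nhds] at key
  have hd : deriv (fun ζ => deriv l ζ + l ζ * l ζ) z = deriv (deriv l) z + 2 * l z * deriv l z := by
    rw [(hl.deriv.differentiableAt.hasDerivAt.fun_add (hl.differentiableAt.hasDerivAt.fun_mul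
      hl.differentiableAt.hasDerivAt)).deriv]
    ring
  rw [hd] at key
  have : y z * (deriv (deriv l) z + 3 * l z * deriv l z + l z ^ 3 + coeffTwo h z * l z
      + coeffThree h z) = 0 := by
    linear_combination key
  exact (mul_eq_zero.1 this).resolve_left hc

/-- A branch `w` of the cube root of `W` satisfies `(1/w)' = -(W'/(3W)) (1/w)`, so division
by `w` turns the twisted derivative into the derivative. -/
theorem deriv_inv_cubeRoot {W w : ℂ → ℂ} {z : ℂ} (hw : AnalyticAt ℂ w z) (hwz : W z ≠ 0)
    (he : ∀ᶠ ζ in 𝓝 z, w ζ ^ 3 = W ζ) :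
    deriv (fun ζ => (w ζ)⁻¹) =ᶠ[𝓝 z] fun ζ => -(deriv W ζ / (3 * W ζ) * (w ζ)⁻¹) := by
  have hw0 : w z ≠ 0 := by
    intro h0
    have := he.self_of_nhds
    simp [h0] at this
    exact hwz this.symm
  have hd : deriv (fun ζ => w ζ ^ 3) =ᶠ[𝓝 z] deriv W := EventuallyEq.deriv he
  filter_upwards [hw.eventually_analyticAt, hw.continuousAt.eventually_ne hw0, he, hd]
    with ζ h1 h2 h3 h4
  have hh := h1.differentiableAt.hasDerivAt
  rw [(hh.fun_inv h2).deriv, ← h4, ← h3, (hh.fun_pow 3).deriv]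
  field_simp
  norm_num
  ring

/-- Every branch of `hᵢ / W^{1/3}` solves the equation. -/
theorem equation_of_cubeRoot {h : Fin 3 → ℂ → ℂ} {z : ℂ} (ha : ∀ i, AnalyticAt ℂ (h i) z)
    (hW : wronskian₃ h z ≠ 0) {w : ℂ → ℂ} (hw : AnalyticAt ℂ w z)
    (he : ∀ᶠ ζ in 𝓝 z, w ζ ^ 3 = wronskian₃ h ζ) (i : Fin 3) :
    iteratedDeriv 3 (fun ζ => h i ζ / w ζ) z + coeffTwo h z * deriv (fun ζ => h i ζ / w ζ) z +
      coeffThree h z * (h i z / w z) = 0 := by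
  have hs := analyticAt_thirdLogDeriv ha hW
  have hw0 : w z ≠ 0 := by
    intro h0
    have := he.self_of_nhds
    simp [h0] at this
    exact hW this.symm
  have hv : AnalyticAt ℂ (fun ζ => (w ζ)⁻¹) z := hw.fun_inv hw0
  have hvs : deriv (fun ζ => (w ζ)⁻¹) =ᶠ[𝓝 z] fun ζ => -(thirdLogDeriv h ζ * (w ζ)⁻¹) :=
    deriv_inv_cubeRoot hw hW he
  have key := twisted_equation ha hW (Pi.single i 1)
  rw [linComb_single] at key
  simp only [div_eq_mul_inv]
  rw [(iteratedDeriv_three_mul_eventuallyEq_twistedDeriv hs (ha i) hv hvs).eq_of_nhds,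
    (deriv_mul_eventuallyEq_twistedDeriv (ha i) hv hvs).eq_of_nhds]
  linear_combination (w z)⁻¹ * key

/-! ### The coefficients `Q₂`, `Q₃` as meromorphic functions -/

theorem cpow_third_cube (x : ℂ) : (x ^ (1 / 3 : ℂ)) ^ 3 = x := by
  rw [← Complex.cpow_nat_mul]
  norm_num

theorem analyticAt_cubeRootNear {W : ℂ → ℂ} {z : ℂ} (hW : AnalyticAt ℂ W z) (hz : W z ≠ 0) :
    AnalyticAt ℂ (cubeRootNear W z) z := by
  refine analyticAt_const.mul ((hW.div analyticAt_const hz).cpow analyticAt_const ?_)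
  simp [hz]

theorem cubeRootNear_cube {W : ℂ → ℂ} {z : ℂ} (hz : W z ≠ 0) (ζ : ℂ) :
    cubeRootNear W z ζ ^ 3 = W ζ := by
  rw [cubeRootNear, mul_pow, cpow_third_cube, cpow_third_cube]
  field_simp

/-- The defining quotients `Q₂`, `Q₃` solve the linear system which expresses that `h₁ / W^{1/3}`
and `h₂ / W^{1/3}` satisfy the equation, so they agree with the rational expressions in the `hᵢ`. -/
theorem coefficients_eq_of_ne {h : Fin 3 → ℂ → ℂ} {z : ℂ} (ha : ∀ i, AnalyticAt ℂ (h i) z)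
    (hW : wronskian₃ h z ≠ 0) (hm : h 0 z * deriv (h 1) z - deriv (h 0) z * h 1 z ≠ 0) :
    Q₂ h z = coeffTwo h z ∧ Q₃ h z = coeffThree h z := by
  have hw := analyticAt_cubeRootNear (analyticAt_wronskian₃ ha) hW
  have he := cubeRootNear_cube hW
  have hw0 : cubeRootNear (wronskian₃ h) z z ≠ 0 := by
    intro h0
    have := he z
    simp [h0] at this
    exact hW this.symm
  have e0 : _ = (0 : ℂ) := equation_of_cubeRoot ha hW hw (.of_forall he) 0
  have e1 : _ = (0 : ℂ) := equation_of_cubeRoot ha hW hw (.of_forall he) 1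
  have hd : ∀ i, deriv (gNear h z i) z = (deriv (h i) z * cubeRootNear (wronskian₃ h) z z -
      h i z * deriv (cubeRootNear (wronskian₃ h) z) z) / cubeRootNear (wronskian₃ h) z z ^ 2 :=
    fun i => deriv_fun_div (ha i).differentiableAt hw.differentiableAt hw0
  have hm' : gNear h z 0 z * deriv (gNear h z 1) z - deriv (gNear h z 0) z * gNear h z 1 z ≠ 0 := by
    rw [hd, hd, gNear, gNear]
    have : h 0 z / cubeRootNear (wronskian₃ h) z z * ((deriv (h 1) z *
        cubeRootNear (wronskian₃ h) z z - h 1 z * deriv (cubeRootNear (wronskian₃ h) z) z) /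
        cubeRootNear (wronskian₃ h) z z ^ 2) - (deriv (h 0) z * cubeRootNear (wronskian₃ h) z z -
        h 0 z * deriv (cubeRootNear (wronskian₃ h) z) z) / cubeRootNear (wronskian₃ h) z z ^ 2 *
        (h 1 z / cubeRootNear (wronskian₃ h) z z) =
        (h 0 z * deriv (h 1) z - deriv (h 0) z * h 1 z) / cubeRootNear (wronskian₃ h) z z ^ 2 := by
      field_simp
      ring
    rw [this]
    exact div_ne_zero hm (pow_ne_zero 2 hw0)
  change iteratedDeriv 3 (gNear h z 0) z + coeffTwo h z * deriv (gNear h z 0) z +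
    coeffThree h z * gNear h z 0 z = 0 at e0
  change iteratedDeriv 3 (gNear h z 1) z + coeffTwo h z * deriv (gNear h z 1) z +
    coeffThree h z * gNear h z 1 z = 0 at e1
  constructor
  · simp only [Q₂]
    rw [div_eq_iff hm']
    linear_combination gNear h z 1 z * e0 - gNear h z 0 z * e1
  · simp only [Q₃]
    rw [div_eq_iff hm']
    linear_combination deriv (gNear h z 0) z * e1 - deriv (gNear h z 1) z * e0

/-- The `hᵢ` are holomorphic at `z`, and their Wronskian does not vanish identically near `z` (it
may vanish at `z`). -/
structure IsIndependentAt (h : Fin 3 → ℂ → ℂ) (z : ℂ) : Prop where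
  analyticAt : ∀ i, AnalyticAt ℂ (h i) z
  wronskian_ne : ∀ᶠ ζ in 𝓝[≠] z, wronskian₃ h ζ ≠ 0

namespace IsIndependentAt

variable {h : Fin 3 → ℂ → ℂ} {z : ℂ}

theorem eventually (hi : IsIndependentAt h z) :
    ∀ᶠ ζ in 𝓝[≠] z, (∀ i, AnalyticAt ℂ (h i) ζ) ∧ wronskian₃ h ζ ≠ 0 :=
  ((Filter.eventually_all.2 fun i => (hi.analyticAt i).eventually_analyticAt).filter_mono
    nhdsWithin_le_nhds).and hi.wronskian_ne

/-- A combination vanishing on an open set would make the Wronskian vanish there. -/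
theorem linComb_eventually_ne (hi : IsIndependentAt h z) {c : Fin 3 → ℂ} (hc : c ≠ 0) :
    ∀ᶠ ζ in 𝓝[≠] z, linComb c h ζ ≠ 0 := by
  refine (analyticAt_linComb hi.analyticAt c).eventually_eq_zero_or_eventually_ne_zero.resolve_left
    fun h0 => ?_
  obtain ⟨ζ, ⟨ha, hW⟩, hz⟩ :=
    (hi.eventually.and (h0.eventually_nhds.filter_mono nhdsWithin_le_nhds)).exists
  have hj : ∀ n, ∑ i, c i * jet h n ζ i = 0 := by
    intro n
    have : linComb c h =ᶠ[𝓝 ζ] fun _ => 0 := hz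
    rw [← iteratedDeriv_linComb ha, this.iteratedDeriv_eq n]
    simp
  have h0 := hj 0
  have h1 := hj 1
  have h2 := hj 2
  simp only [Fin.sum_univ_three] at h0 h1 h2
  rw [wronskian₃_eq_det3] at hW
  refine hc (funext fun i => (mul_eq_zero.1 ?_).resolve_right hW)
  set a := jet h 0 ζ
  set b := jet h 1 ζ
  set d := jet h 2 ζ
  fin_cases i <;> simp only [det3, Fin.zero_eta, Fin.mk_one, Fin.reduceFinMk]
  · linear_combination (b 1 * d 2 - b 2 * d 1) * h0 - (a 1 * d 2 - a 2 * d 1) * h1 +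
      (a 1 * b 2 - a 2 * b 1) * h2
  · linear_combination (b 2 * d 0 - b 0 * d 2) * h0 - (a 2 * d 0 - a 0 * d 2) * h1 +
      (a 2 * b 0 - a 0 * b 2) * h2
  · linear_combination (b 0 * d 1 - b 1 * d 0) * h0 - (a 0 * d 1 - a 1 * d 0) * h1 +
      (a 0 * b 1 - a 1 * b 0) * h2

/-- If a two by two minor vanished on an open set, so would the Wronskian. -/
theorem minor_eventually_ne (hi : IsIndependentAt h z) {i j : Fin 3} (hij : i ≠ j) :
    ∀ᶠ ζ in 𝓝[≠] z, h i ζ * deriv (h j) ζ - deriv (h i) ζ * h j ζ ≠ 0 := by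
  have hm : AnalyticAt ℂ (fun ζ => h i ζ * deriv (h j) ζ - deriv (h i) ζ * h j ζ) z := by
    have := hi.analyticAt
    fun_prop
  refine hm.eventually_eq_zero_or_eventually_ne_zero.resolve_left fun h0 => ?_
  have hn := hi.linComb_eventually_ne (c := Pi.single i 1) (by simp)
  rw [linComb_single] at hn
  obtain ⟨ζ, ⟨⟨ha, hW⟩, hne⟩, hz⟩ :=
    ((hi.eventually.and hn).and (h0.eventually_nhds.filter_mono nhdsWithin_le_nhds)).exists
  have m0 := hz.self_of_nhds
  have m1 : h i ζ * deriv (deriv (h j)) ζ - deriv (deriv (h i)) ζ * h j ζ = 0 := by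
    have e : (fun ζ => h i ζ * deriv (h j) ζ - deriv (h i) ζ * h j ζ) =ᶠ[𝓝 ζ] fun _ => 0 := hz
    have := e.deriv_eq
    have di := (ha i).differentiableAt.hasDerivAt
    have dj := (ha j).differentiableAt.hasDerivAt
    have di' := (ha i).deriv.differentiableAt.hasDerivAt
    have dj' := (ha j).deriv.differentiableAt.hasDerivAt
    rw [((di.fun_mul dj').fun_sub (di'.fun_mul dj)).deriv, deriv_const] at this
    linear_combination this
  refine hW ((mul_eq_zero.1 ?_).resolve_right hne)
  rw [wronskian₃_eq_det3]
  simp only [det3, jet, iteratedDeriv_succ, iteratedDeriv_zero]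
  -- up to sign, `h i` times the Wronskian is a combination of the minor and of its derivative
  fin_cases i <;> fin_cases j <;> first | exact absurd rfl hij | skip
  all_goals simp only [Fin.zero_eta, Fin.mk_one, Fin.reduceFinMk] at m0 m1 ⊢
  · linear_combination (h 2 ζ * deriv (deriv (h 0)) ζ - h 0 ζ * deriv (deriv (h 2)) ζ) * (-m0) +
      (h 2 ζ * deriv (h 0) ζ - h 0 ζ * deriv (h 2) ζ) * m1
  · linear_combination (h 1 ζ * deriv (deriv (h 0)) ζ - h 0 ζ * deriv (deriv (h 1)) ζ) * m0 -
      (h 1 ζ * deriv (h 0) ζ - h 0 ζ * deriv (h 1) ζ) * m1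
  · linear_combination (h 2 ζ * deriv (deriv (h 1)) ζ - h 1 ζ * deriv (deriv (h 2)) ζ) * m0 -
      (h 2 ζ * deriv (h 1) ζ - h 1 ζ * deriv (h 2) ζ) * m1
  · linear_combination (h 0 ζ * deriv (deriv (h 1)) ζ - h 1 ζ * deriv (deriv (h 0)) ζ) * (-m0) +
      (h 0 ζ * deriv (h 1) ζ - h 1 ζ * deriv (h 0) ζ) * m1
  · linear_combination (h 1 ζ * deriv (deriv (h 2)) ζ - h 2 ζ * deriv (deriv (h 1)) ζ) * (-m0) +
      (h 1 ζ * deriv (h 2) ζ - h 2 ζ * deriv (h 1) ζ) * m1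
  · linear_combination (h 0 ζ * deriv (deriv (h 2)) ζ - h 2 ζ * deriv (deriv (h 0)) ζ) * m0 -
      (h 0 ζ * deriv (h 2) ζ - h 2 ζ * deriv (h 0) ζ) * m1

theorem coefficients_eventuallyEq (hi : IsIndependentAt h z) :
    Q₂ h =ᶠ[𝓝[≠] z] coeffTwo h ∧ Q₃ h =ᶠ[𝓝[≠] z] coeffThree h := by
  constructor <;>
  filter_upwards [hi.eventually, hi.minor_eventually_ne (i := 0) (j := 1) (by decide)] with ζ h1 h2
  exacts [(coefficients_eq_of_ne h1.1 h1.2 h2).1, (coefficients_eq_of_ne h1.1 h1.2 h2).2]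

theorem meromorphicAt_thirdLogDeriv (hi : IsIndependentAt h z) :
    MeromorphicAt (thirdLogDeriv h) z :=
  (analyticAt_wronskian₃ hi.analyticAt).deriv.meromorphicAt.div
    ((MeromorphicAt.const 3 z).mul (analyticAt_wronskian₃ hi.analyticAt).meromorphicAt)

theorem meromorphicAt_coeffTwo (hi : IsIndependentAt h z) : MeromorphicAt (coeffTwo h) z := by
  have h1 := hi.meromorphicAt_thirdLogDeriv
  have h3 := (analyticAt_det3_jet hi.analyticAt 0 3 2).meromorphicAt.div
    (analyticAt_wronskian₃ hi.analyticAt).meromorphicAt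
  exact (((MeromorphicAt.const 3 z).mul h1.deriv).sub ((MeromorphicAt.const 3 z).mul
    (h1.pow 2))).sub h3

theorem meromorphicAt_coeffThree (hi : IsIndependentAt h z) : MeromorphicAt (coeffThree h) z := by
  have h1 := hi.meromorphicAt_thirdLogDeriv
  have h3 := (analyticAt_det3_jet hi.analyticAt 0 3 2).meromorphicAt.div
    (analyticAt_wronskian₃ hi.analyticAt).meromorphicAt
  have h4 := (analyticAt_det3_jet hi.analyticAt 3 1 2).meromorphicAt.div
    (analyticAt_wronskian₃ hi.analyticAt).meromorphicAt
  exact ((h1.deriv.deriv.sub ((MeromorphicAt.const 2 z).mul (h1.pow 3))).sub (h3.mul h1)).sub h4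

theorem meromorphicAt_Q₂ (hi : IsIndependentAt h z) : MeromorphicAt (Q₂ h) z :=
  hi.meromorphicAt_coeffTwo.congr hi.coefficients_eventuallyEq.1.symm

theorem meromorphicAt_Q₃ (hi : IsIndependentAt h z) : MeromorphicAt (Q₃ h) z :=
  hi.meromorphicAt_coeffThree.congr hi.coefficients_eventuallyEq.2.symm

/-- Singular points of the equation are zeros of the Wronskian. -/
theorem wronskian_eq_zero_of_isSingularPoint (hi : IsIndependentAt h z)
    (hs : IsSingularPoint (Q₂ h) (Q₃ h) z) : wronskian₃ h z = 0 := by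
  by_contra hW
  rcases hs with hs | hs
  · rw [meromorphicOrderAt_congr hi.coefficients_eventuallyEq.1] at hs
    exact hs.not_ge (analyticAt_coeffTwo hi.analyticAt hW).meromorphicOrderAt_nonneg
  · rw [meromorphicOrderAt_congr hi.coefficients_eventuallyEq.2] at hs
    exact hs.not_ge (analyticAt_coeffThree hi.analyticAt hW).meromorphicOrderAt_nonneg

end IsIndependentAt

/-! ### Logarithmic derivatives -/

/-- The logarithmic derivative of a holomorphic function has at most a simple pole, with residue
the order of vanishing. -/
theorem exists_analyticAt_logDeriv {y : ℂ → ℂ} {z₀ : ℂ} (hy : AnalyticAt ℂ y z₀) {n : ℕ}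
    (hn : analyticOrderAt y z₀ = n) :
    ∃ m : ℂ → ℂ, AnalyticAt ℂ m z₀ ∧ m z₀ = n ∧
      ∀ᶠ z in 𝓝[≠] z₀, y z ≠ 0 ∧ (z - z₀) * deriv y z = m z * y z := by
  obtain ⟨u, hu, hu0, hyu⟩ := (hy.analyticOrderAt_eq_natCast).1 hn
  refine ⟨fun z => n + (z - z₀) * (deriv u z / u z), ?_, by simp, ?_⟩
  · have := hu.deriv.fun_div hu hu0
    fun_prop
  · filter_upwards [self_mem_nhdsWithin, hyu.eventually_nhds.filter_mono nhdsWithin_le_nhds,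
      hu.eventually_analyticAt.filter_mono nhdsWithin_le_nhds,
      (hu.continuousAt.eventually_ne hu0).filter_mono nhdsWithin_le_nhds] with z hz h1 h2 h3
    have hz' : z - z₀ ≠ 0 := sub_ne_zero.2 hz
    have e : y =ᶠ[𝓝 z] fun z => (z - z₀) ^ n * u z := by
      filter_upwards [h1] with ζ hζ
      simpa using hζ
    refine ⟨?_, ?_⟩
    · rw [e.eq_of_nhds]
      exact mul_ne_zero (pow_ne_zero _ hz') h3
    · rw [e.deriv_eq, e.eq_of_nhds,
        ((((hasDerivAt_id' z).sub_const z₀).fun_pow n).fun_mul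
          h2.differentiableAt.hasDerivAt).deriv]
      rcases n with _ | n
      · simp
        field_simp
      · push_cast
        field_simp
        ring

/-! ### Local exponents at points of the upper half plane -/

/-- The expression that the Riccati form of `y'''` becomes, multiplied by `(z - z₀)³`, when the
logarithmic derivative is `M / (z - z₀)`. -/
noncomputable def indicial (M : ℂ → ℂ) (z₀ z : ℂ) : ℂ :=
  (z - z₀) ^ 2 * deriv (deriv M) z - 2 * (z - z₀) * deriv M z + 2 * M z +
    3 * M z * ((z - z₀) * deriv M z - M z) + M z ^ 3

theorem analyticAt_indicial {M : ℂ → ℂ} {z₀ z : ℂ} (hM : AnalyticAt ℂ M z) :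
    AnalyticAt ℂ (indicial M z₀) z := by
  unfold indicial
  fun_prop

theorem indicial_self (M : ℂ → ℂ) (z₀ : ℂ) :
    indicial M z₀ z₀ = M z₀ * (M z₀ - 1) * (M z₀ - 2) := by
  simp only [indicial]
  ring

theorem IsRiccati.indicial_eq {P Q l M : ℂ → ℂ} {z₀ z : ℂ} (hl : IsRiccati P Q l z)
    (hM : AnalyticAt ℂ M z) (hz : z ≠ z₀) (e : l =ᶠ[𝓝 z] fun ζ => M ζ / (ζ - z₀)) :
    indicial M z₀ z + (z - z₀) ^ 2 * P z * M z + (z - z₀) ^ 3 * Q z = 0 := by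
  have hne : ∀ᶠ ζ in 𝓝 z, ζ ≠ z₀ := continuousAt_id.eventually_ne hz
  have d1 : deriv l =ᶠ[𝓝 z] fun ζ => ((ζ - z₀) * deriv M ζ - M ζ) / (ζ - z₀) ^ 2 := by
    filter_upwards [e.deriv, hM.eventually_analyticAt, hne] with ζ h1 h2 h3
    have hx := (hasDerivAt_id' ζ).sub_const z₀
    rw [h1, (h2.differentiableAt.hasDerivAt.fun_div hx (sub_ne_zero.2 h3)).deriv]
    ring
  have d2 : deriv (deriv l) z = ((z - z₀) ^ 2 * deriv (deriv M) z - 2 * (z - z₀) * deriv M z +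
      2 * M z) / (z - z₀) ^ 3 := by
    have hx := (hasDerivAt_id' z).sub_const z₀
    have hd := hM.deriv.differentiableAt.hasDerivAt
    have hd' := hM.differentiableAt.hasDerivAt
    have : z - z₀ ≠ 0 := sub_ne_zero.2 hz
    rw [d1.deriv_eq, (((hx.fun_mul hd).fun_sub hd').fun_div (hx.fun_pow 2)
      (pow_ne_zero 2 this)).deriv]
    field_simp
    push_cast
    ring
  have : z - z₀ ≠ 0 := sub_ne_zero.2 hz
  rw [IsRiccati, d2, d1.eq_of_nhds, e.eq_of_nhds] at hl
  rw [indicial]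
  field_simp at hl
  linear_combination hl

/-- A cubic `t(t-1)(t-2) + At + B` with three distinct known roots. -/
theorem cubic_eq_prod {A B : ℂ} {κ : Fin 3 → ℂ} (hκ : Function.Injective κ)
    (hr : ∀ j, κ j * (κ j - 1) * (κ j - 2) + A * κ j + B = 0) :
    (∀ t, t * (t - 1) * (t - 2) + A * t + B = ∏ j, (t - κ j)) ∧ κ 0 + κ 1 + κ 2 = 3 := by
  have h01 : κ 0 - κ 1 ≠ 0 := sub_ne_zero.2 fun h => absurd (hκ h) (by decide)
  have h02 : κ 0 - κ 2 ≠ 0 := sub_ne_zero.2 fun h => absurd (hκ h) (by decide)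
  have h12 : κ 1 - κ 2 ≠ 0 := sub_ne_zero.2 fun h => absurd (hκ h) (by decide)
  have e1 : κ 0 ^ 2 + κ 0 * κ 1 + κ 1 ^ 2 - 3 * (κ 0 + κ 1) + 2 + A = 0 :=
    (mul_eq_zero.1 (by linear_combination hr 0 - hr 1 :
      (κ 0 - κ 1) * (κ 0 ^ 2 + κ 0 * κ 1 + κ 1 ^ 2 - 3 * (κ 0 + κ 1) + 2 + A) = 0)).resolve_left h01
  have e2 : κ 0 ^ 2 + κ 0 * κ 2 + κ 2 ^ 2 - 3 * (κ 0 + κ 2) + 2 + A = 0 :=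
    (mul_eq_zero.1 (by linear_combination hr 0 - hr 2 :
      (κ 0 - κ 2) * (κ 0 ^ 2 + κ 0 * κ 2 + κ 2 ^ 2 - 3 * (κ 0 + κ 2) + 2 + A) = 0)).resolve_left h02
  have e3 : κ 0 + κ 1 + κ 2 - 3 = 0 :=
    (mul_eq_zero.1 (by linear_combination e1 - e2 :
      (κ 1 - κ 2) * (κ 0 + κ 1 + κ 2 - 3) = 0)).resolve_left h12
  refine ⟨fun t => ?_, by linear_combination e3⟩
  rw [Fin.prod_univ_three]
  have hA : A = -(κ 0 ^ 2 + κ 0 * κ 1 + κ 1 ^ 2 - 3 * (κ 0 + κ 1) + 2) := by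
    linear_combination e1
  have hB : B = -(κ 0 * (κ 0 - 1) * (κ 0 - 2) + A * κ 0) := by linear_combination hr 0
  have h2 : κ 2 = 3 - κ 0 - κ 1 := by linear_combination e3
  rw [hB, hA, h2]
  ring

/-- The principal parts of the coefficients at `z₀`, computed from functions in the span of the `hᵢ`
with three different orders of vanishing `nⱼ`: the logarithmic derivatives of the solutions have
residues `nⱼ - w/3`, and these are the roots of the indicial polynomial.  The sum of the
roots is three, which relates the orders `nⱼ` to the order `w` of the Wronskian. -/
theorem IsIndependentAt.exists_analytic_coefficients {h : Fin 3 → ℂ → ℂ} {z₀ : ℂ}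
    (hi : IsIndependentAt h z₀) {c : Fin 3 → Fin 3 → ℂ} {n : Fin 3 → ℕ}
    (hn : Function.Injective n) (hc : ∀ j, analyticOrderAt (linComb (c j) h) z₀ = n j) {w : ℕ}
    (hw : analyticOrderAt (wronskian₃ h) z₀ = w) :
    ∃ P Q : ℂ → ℂ, AnalyticAt ℂ P z₀ ∧ AnalyticAt ℂ Q z₀ ∧
      (∀ᶠ z in 𝓝[≠] z₀, (z - z₀) ^ 2 * Q₂ h z = P z ∧ (z - z₀) ^ 3 * Q₃ h z = Q z) ∧
      (∀ t, t * (t - 1) * (t - 2) + P z₀ * t + Q z₀ = ∏ j, (t - ((n j : ℂ) - w / 3))) ∧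
      n 0 + n 1 + n 2 = w + 3 := by
  have hy := analyticAt_linComb hi.analyticAt
  choose m hma hm0 hm using fun j => exists_analyticAt_logDeriv (hy (c j)) (hc j)
  obtain ⟨μ, hμa, hμ0, hμ⟩ :=
    exists_analyticAt_logDeriv (analyticAt_wronskian₃ hi.analyticAt) hw
  -- `M j / (z - z₀)` is the logarithmic derivative of the `j`-th solution
  let M : Fin 3 → ℂ → ℂ := fun j z => m j z - μ z / 3
  have hMa : ∀ j, AnalyticAt ℂ (M j) z₀ := fun j => (hma j).sub (hμa.div_const)
  have hM0 : ∀ j, M j z₀ = (n j : ℂ) - w / 3 := fun j => by simp only [M, hm0, hμ0]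
  have hinj : Function.Injective fun j => (n j : ℂ) - w / 3 := fun i j hij => by
    simp only [sub_left_inj, Nat.cast_inj] at hij
    exact hn hij
  have hR : ∀ᶠ z in 𝓝[≠] z₀, ∀ j, indicial (M j) z₀ z + (z - z₀) ^ 2 * coeffTwo h z * M j z +
      (z - z₀) ^ 3 * coeffThree h z = 0 := by
    refine Filter.eventually_all.2 fun j => ?_
    filter_upwards [self_mem_nhdsWithin, eventually_nhdsNE_eventually_nhds_iff.2 (hm j),
      eventually_nhdsNE_eventually_nhds_iff.2 hμ,
      hi.eventually, (hMa j).eventually_analyticAt.filter_mono nhdsWithin_le_nhds]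
      with z hz h1 h2 h3 h4
    refine (isRiccati_twistedLogDeriv h3.1 h3.2 (c j) h1.self_of_nhds.1).indicial_eq h4 hz ?_
    filter_upwards [h1, h2, continuousAt_id.eventually_ne hz] with ζ k1 k2 k3
    have : ζ - z₀ ≠ 0 := sub_ne_zero.2 k3
    have k4 := k1.1
    have k5 := k2.1
    rw [twistedLogDeriv, thirdLogDeriv, div_sub_div _ _ k4 (mul_ne_zero three_ne_zero k5),
      div_eq_div_iff (mul_ne_zero k4 (mul_ne_zero three_ne_zero k5)) this]
    simp only [M]
    linear_combination 3 * wronskian₃ h ζ * k1.2 - linComb (c j) h ζ * k2.2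
  have hd : M 0 z₀ - M 1 z₀ ≠ 0 := by
    rw [hM0, hM0, sub_ne_zero]
    exact fun h => absurd (hinj h) (by decide)
  -- the first two solutions determine the coefficients
  let P : ℂ → ℂ := fun z => -(indicial (M 0) z₀ z - indicial (M 1) z₀ z) / (M 0 z - M 1 z)
  let Q : ℂ → ℂ := fun z => -(indicial (M 0) z₀ z) - P z * M 0 z
  have hI := fun j => analyticAt_indicial (z₀ := z₀) (hMa j)
  have hP : AnalyticAt ℂ P z₀ := ((hI 0).sub (hI 1)).neg.div ((hMa 0).sub (hMa 1)) hd
  have hQ : AnalyticAt ℂ Q z₀ := (hI 0).neg.sub (hP.mul (hMa 0))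
  have hne : ∀ᶠ z in 𝓝[≠] z₀, M 0 z - M 1 z ≠ 0 :=
    (((hMa 0).sub (hMa 1)).continuousAt.eventually_ne hd).filter_mono nhdsWithin_le_nhds
  have hPe : ∀ᶠ z in 𝓝[≠] z₀, (z - z₀) ^ 2 * coeffTwo h z = P z := by
    filter_upwards [hR, hne] with z hz hz'
    rw [eq_div_iff hz']
    linear_combination hz 0 - hz 1
  have hQe : ∀ᶠ z in 𝓝[≠] z₀, (z - z₀) ^ 3 * coeffThree h z = Q z := by
    filter_upwards [hR, hPe] with z hz hz'
    simp only [Q, ← hz']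
    linear_combination hz 0
  have hroots : ∀ j, M j z₀ * (M j z₀ - 1) * (M j z₀ - 2) + P z₀ * M j z₀ + Q z₀ = 0 := by
    intro j
    have e : (fun z => indicial (M j) z₀ z + P z * M j z + Q z) =ᶠ[𝓝[≠] z₀] fun _ => 0 := by
      filter_upwards [hR, hPe, hQe] with z h1 h2 h3
      rw [← h2, ← h3]
      exact h1 j
    have := ((((hI j).add (hP.mul (hMa j))).add hQ).frequently_eq_iff_eventually_eq
      analyticAt_const).1 e.frequently
    simpa [indicial_self] using this.self_of_nhds
  simp only [hM0] at hroots
  obtain ⟨k1, k2⟩ := cubic_eq_prod hinj hroots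
  refine ⟨P, Q, hP, hQ, ?_, k1, ?_⟩
  · filter_upwards [hPe, hQe, hi.coefficients_eventuallyEq.1, hi.coefficients_eventuallyEq.2]
      with z h1 h2 h3 h4
    rw [h3, h4]
    exact ⟨h1, h2⟩
  · have : ((n 0 + n 1 + n 2 : ℕ) : ℂ) = ((w + 3 : ℕ) : ℂ) := by
      push_cast
      linear_combination k2
    exact_mod_cast this

/-- If `f` vanishes to order `n` and `g` to order at least `n`, some `g - a f` vanishes to higher
order. -/
theorem exists_lt_analyticOrderAt_sub {f g : ℂ → ℂ} {z₀ : ℂ} (hf : AnalyticAt ℂ f z₀)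
    (hg : AnalyticAt ℂ g z₀) {n : ℕ} (hn : analyticOrderAt f z₀ = n)
    (hng : n ≤ analyticOrderAt g z₀) :
    ∃ a : ℂ, n < analyticOrderAt (fun z => g z - a * f z) z₀ := by
  obtain ⟨u, hu, hu0, hfu⟩ := (hf.analyticOrderAt_eq_natCast).1 hn
  obtain ⟨v, hv, hgv⟩ := (natCast_le_analyticOrderAt hg).1 hng
  refine ⟨v z₀ / u z₀, ?_⟩
  have hk : AnalyticAt ℂ (fun z => v z - v z₀ / u z₀ * u z) z₀ := by fun_prop
  have e : (fun z => g z - v z₀ / u z₀ * f z) =ᶠ[𝓝 z₀]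
      (fun z => (z - z₀) ^ n) * fun z => v z - v z₀ / u z₀ * u z := by
    filter_upwards [hfu, hgv] with z h1 h2
    simp only [h1, h2, Pi.mul_apply, smul_eq_mul]
    ring
  have h1 : analyticOrderAt (fun z => (z - z₀) ^ n) z₀ = n :=
    analyticOrderAt_centeredMonomial (𝕜 := ℂ)
  have h2 : analyticOrderAt (fun z => v z - v z₀ / u z₀ * u z) z₀ ≠ 0 := by
    rw [hk.analyticOrderAt_ne_zero]
    field_simp
    ring
  rw [analyticOrderAt_congr e, analyticOrderAt_mul (by fun_prop) hk, h1, add_comm]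
  exact ENat.lt_add_left (ENat.natCast_ne_top n) (pos_iff_ne_zero.2 h2)

theorem exists_analyticOrderAt_eq_natCast {f : ℂ → ℂ} {z₀ : ℂ} (hf : ∀ᶠ z in 𝓝[≠] z₀, f z ≠ 0) :
    ∃ n : ℕ, analyticOrderAt f z₀ = n := by
  have : analyticOrderAt f z₀ ≠ ⊤ := fun h0 => by
    rw [analyticOrderAt_eq_top] at h0
    obtain ⟨z, h1, h2⟩ := (hf.and (h0.filter_mono nhdsWithin_le_nhds)).exists
    exact h1 h2
  exact ⟨_, (ENat.natCast_toNat this).symm⟩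

theorem linComb_sub_smul (h : Fin 3 → ℂ → ℂ) (c d : Fin 3 → ℂ) (a : ℂ) :
    linComb (d - a • c) h = fun z => linComb d h z - a * linComb c h z := by
  ext z
  simp only [linComb, Fin.sum_univ_three, Pi.sub_apply, Pi.smul_apply, smul_eq_mul]
  ring

namespace IsIndependentAt

variable {h : Fin 3 → ℂ → ℂ} {z₀ : ℂ}

theorem exists_wronskian_order (hi : IsIndependentAt h z₀) :
    ∃ w : ℕ, analyticOrderAt (wronskian₃ h) z₀ = w :=
  exists_analyticOrderAt_eq_natCast hi.wronskian_ne

theorem exists_order (hi : IsIndependentAt h z₀) {c : Fin 3 → ℂ} (hc : c ≠ 0) :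
    ∃ n : ℕ, analyticOrderAt (linComb c h) z₀ = n :=
  exists_analyticOrderAt_eq_natCast (hi.linComb_eventually_ne hc)

/-- The span of the `hᵢ` has a basis of functions with three different orders of vanishing, the
lowest being the lowest order in the whole span. -/
theorem exists_strictMono_orders (hi : IsIndependentAt h z₀) :
    ∃ (c : Fin 3 → Fin 3 → ℂ) (n : Fin 3 → ℕ), StrictMono n ∧
      (∀ j, analyticOrderAt (linComb (c j) h) z₀ = n j) ∧
      ∀ i, n 0 ≤ analyticOrderAt (h i) z₀ := by
  have hy := analyticAt_linComb hi.analyticAt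
  obtain ⟨i, hmin⟩ := Finite.exists_min fun i => analyticOrderAt (h i) z₀
  obtain ⟨n₀, hn₀⟩ := hi.exists_order (c := Pi.single i 1) (by simp)
  have hn₀' := hn₀
  rw [linComb_single] at hn₀'
  -- after removing multiples of the first function, the lower of the two remaining orders is next
  have key : ∀ (j k : Fin 3) (a b : ℂ), j ≠ i → k ≠ i → j ≠ k →
      let u : Fin 3 → ℂ := Pi.single j 1 - a • Pi.single i 1
      let v : Fin 3 → ℂ := Pi.single k 1 - b • Pi.single i 1
      n₀ < analyticOrderAt (linComb u h) z₀ →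
      analyticOrderAt (linComb u h) z₀ ≤ analyticOrderAt (linComb v h) z₀ →
      ∃ (c : Fin 3 → Fin 3 → ℂ) (n : Fin 3 → ℕ), StrictMono n ∧
        (∀ j, analyticOrderAt (linComb (c j) h) z₀ = n j) ∧
        ∀ i, n 0 ≤ analyticOrderAt (h i) z₀ := by
    intro j k a b hj hk hjk u v h1 h2
    have hu : u ≠ 0 := fun h0 => by simpa [u, hj, Pi.single_apply] using congrFun h0 j
    obtain ⟨n₁, hn₁⟩ := hi.exists_order hu
    rw [hn₁] at h1 h2
    obtain ⟨e, he⟩ := exists_lt_analyticOrderAt_sub (hy u) (hy v) hn₁ h2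
    rw [← linComb_sub_smul] at he
    have hv : v - e • u ≠ 0 := fun h0 => by
      simpa [u, v, hj, hk, hjk, hjk.symm, Pi.single_apply] using congrFun h0 k
    obtain ⟨n₂, hn₂⟩ := hi.exists_order hv
    rw [hn₂] at he
    refine ⟨![Pi.single i 1, u, v - e • u], ![n₀, n₁, n₂], ?_, ?_, ?_⟩
    · rw [Fin.strictMono_iff_lt_succ]
      intro l
      fin_cases l
      · exact_mod_cast h1
      · exact_mod_cast he
    · intro l
      fin_cases l
      exacts [hn₀, hn₁, hn₂]
    · intro l
      simpa [← hn₀'] using hmin l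
  obtain ⟨j, k, hj, hk, hjk⟩ : ∃ j k : Fin 3, j ≠ i ∧ k ≠ i ∧ j ≠ k := by
    clear * -
    decide +revert
  obtain ⟨a, ha⟩ := exists_lt_analyticOrderAt_sub (hy _) (hy (Pi.single j 1)) hn₀
    (by rw [linComb_single, ← hn₀']; exact hmin j)
  obtain ⟨b, hb⟩ := exists_lt_analyticOrderAt_sub (hy _) (hy (Pi.single k 1)) hn₀
    (by rw [linComb_single, ← hn₀']; exact hmin k)
  rw [← linComb_sub_smul] at ha hb
  rcases le_total (analyticOrderAt (linComb (Pi.single j 1 - a • Pi.single i 1) h) z₀)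
    (analyticOrderAt (linComb (Pi.single k 1 - b • Pi.single i 1) h) z₀) with hab | hab
  · exact key j k a b hj hk hjk ha hab
  · exact key k j b a hk hj hjk.symm hb hab

/-- The local exponents are the orders of vanishing of solutions, shifted by a third of the order
of the Wronskian. -/
theorem hasLocalExponents (hi : IsIndependentAt h z₀) {c : Fin 3 → Fin 3 → ℂ} {n : Fin 3 → ℕ}
    (hn : Function.Injective n) (hc : ∀ j, analyticOrderAt (linComb (c j) h) z₀ = n j) {w : ℕ}
    (hw : analyticOrderAt (wronskian₃ h) z₀ = w) :
    HasLocalExponents (Q₂ h) (Q₃ h) z₀ (fun j => (n j : ℂ) - w / 3) ∧ n 0 + n 1 + n 2 = w + 3 := by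
  obtain ⟨P, Q, hP, hQ, he, hk, hs⟩ := hi.exists_analytic_coefficients hn hc hw
  refine ⟨⟨P z₀, Q z₀, ?_, ?_, hk⟩, hs⟩
  · exact (hP.continuousAt.tendsto.mono_left nhdsWithin_le_nhds).congr'
      (he.mono fun z hz => hz.1.symm)
  · exact (hQ.continuousAt.tendsto.mono_left nhdsWithin_le_nhds).congr'
      (he.mono fun z hz => hz.2.symm)

theorem neg_le_meromorphicOrderAt {F P : ℂ → ℂ} {n : ℕ} (hP : AnalyticAt ℂ P z₀)
    (he : ∀ᶠ z in 𝓝[≠] z₀, (z - z₀) ^ n * F z = P z) (hF : MeromorphicAt F z₀) :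
    ((-n : ℤ) : WithTop ℤ) ≤ meromorphicOrderAt F z₀ := by
  have h1 : meromorphicOrderAt (fun z => (z - z₀) ^ n) z₀ = (n : ℤ) :=
    (meromorphicOrderAt_eq_int_iff (by fun_prop)).2 ⟨fun _ => 1, analyticAt_const, by simp⟩
  have h2 : 0 ≤ meromorphicOrderAt ((fun z => (z - z₀) ^ n) * F) z₀ := by
    rw [meromorphicOrderAt_congr (f₁ := (fun z => (z - z₀) ^ n) * F) (f₂ := P) he]
    exact hP.meromorphicOrderAt_nonneg
  rw [meromorphicOrderAt_mul (by fun_prop) hF, h1] at h2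
  cases hm : meromorphicOrderAt F z₀ with
  | top => simp
  | coe m =>
    rw [hm] at h2
    norm_cast at h2 ⊢
    omega

/-- The equation is Fuchsian at every point of the upper half plane. -/
theorem fuchsian (hi : IsIndependentAt h z₀) :
    MeromorphicAt (Q₂ h) z₀ ∧ MeromorphicAt (Q₃ h) z₀ ∧
    ((-2 : ℤ) : WithTop ℤ) ≤ meromorphicOrderAt (Q₂ h) z₀ ∧
    ((-3 : ℤ) : WithTop ℤ) ≤ meromorphicOrderAt (Q₃ h) z₀ := by
  obtain ⟨c, n, hn, hc, -⟩ := hi.exists_strictMono_orders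
  obtain ⟨w, hw⟩ := hi.exists_wronskian_order
  obtain ⟨P, Q, hP, hQ, he, -⟩ := hi.exists_analytic_coefficients hn.injective hc hw
  exact ⟨hi.meromorphicAt_Q₂, hi.meromorphicAt_Q₃,
    neg_le_meromorphicOrderAt hP (he.mono fun z hz => hz.1) hi.meromorphicAt_Q₂,
    neg_le_meromorphicOrderAt hQ (he.mono fun z hz => hz.2) hi.meromorphicAt_Q₃⟩

end IsIndependentAt

/-! ### Absence of logarithms -/

theorem wronskian₃_mul {h : Fin 3 → ℂ → ℂ} {v : ℂ → ℂ} {z : ℂ} (ha : ∀ i, AnalyticAt ℂ (h i) z)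
    (hv : AnalyticAt ℂ v z) :
    wronskian₃ (fun i ζ => h i ζ * v ζ) z = v z ^ 3 * wronskian₃ h z := by
  have d1 : ∀ i, deriv (fun ζ => h i ζ * v ζ) =ᶠ[𝓝 z]
      fun ζ => deriv (h i) ζ * v ζ + h i ζ * deriv v ζ := fun i => by
    filter_upwards [(ha i).eventually_analyticAt, hv.eventually_analyticAt] with ζ h1 h2
    exact deriv_fun_mul h1.differentiableAt h2.differentiableAt
  have d2 : ∀ i, deriv (deriv fun ζ => h i ζ * v ζ) z =
      deriv (deriv (h i)) z * v z + 2 * deriv (h i) z * deriv v z + h i z * deriv (deriv v) z := by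
    intro i
    have h0 := (ha i).differentiableAt.hasDerivAt
    have h1 := (ha i).deriv.differentiableAt.hasDerivAt
    have v0 := hv.differentiableAt.hasDerivAt
    have v1 := hv.deriv.differentiableAt.hasDerivAt
    rw [(d1 i).deriv_eq, ((h1.fun_mul v0).fun_add (h0.fun_mul v1)).deriv]
    ring
  rw [wronskian₃_eq_det3, wronskian₃_eq_det3]
  simp only [jet, iteratedDeriv_succ, iteratedDeriv_zero, det3, d2, (d1 _).eq_of_nhds]
  ring

theorem wronskian₃_comp {h : Fin 3 → ℂ → ℂ} {g : ℂ → ℂ} {z : ℂ}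
    (ha : ∀ i, AnalyticAt ℂ (h i) (g z)) (hg : AnalyticAt ℂ g z) :
    wronskian₃ (fun i ζ => h i (g ζ)) z = deriv g z ^ 3 * wronskian₃ h (g z) := by
  have d1 : ∀ i, deriv (fun ζ => h i (g ζ)) =ᶠ[𝓝 z] fun ζ => deriv (h i) (g ζ) * deriv g ζ := by
    intro i
    filter_upwards [hg.continuousAt.eventually (ha i).eventually_analyticAt,
      hg.eventually_analyticAt] with ζ h1 h2
    exact (h1.differentiableAt.hasDerivAt.comp ζ h2.differentiableAt.hasDerivAt).deriv
  have d2 : ∀ i, deriv (deriv fun ζ => h i (g ζ)) z =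
      deriv (deriv (h i)) (g z) * deriv g z ^ 2 + deriv (h i) (g z) * deriv (deriv g) z := by
    intro i
    have h1 : HasDerivAt (fun ζ => deriv (h i) (g ζ)) (deriv (deriv (h i)) (g z) * deriv g z) z :=
      (ha i).deriv.differentiableAt.hasDerivAt.comp z hg.differentiableAt.hasDerivAt
    have v1 := hg.deriv.differentiableAt.hasDerivAt
    rw [(d1 i).deriv_eq, (h1.fun_mul v1).deriv]
    ring
  rw [wronskian₃_eq_det3, wronskian₃_eq_det3]
  simp only [jet, iteratedDeriv_succ, iteratedDeriv_zero, det3, d2, (d1 _).eq_of_nhds]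
  ring

theorem isOpen_slitDisc (z₀ : ℂ) (r : ℝ) : IsOpen (slitDisc z₀ r) := by
  have h1 : IsOpen {z : ℂ | z - z₀ ∈ Complex.slitPlane} :=
    Complex.isOpen_slitPlane.preimage (continuous_id.sub continuous_const)
  exact h1.inter (isOpen_lt (continuous_id.sub continuous_const).norm continuous_const)

theorem isPreconnected_slitDisc (z₀ : ℂ) {r : ℝ} (hr : 0 < r) :
    IsPreconnected (slitDisc z₀ r) := by
  have h1 : StarConvex ℝ ((r / 2 : ℝ) : ℂ) (Complex.slitPlane ∩ Metric.ball 0 r) := by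
    refine (Complex.starConvex_ofReal_slitPlane (by positivity)).inter
      ((convex_ball 0 r).starConvex ?_)
    rw [mem_ball_zero_iff, Complex.norm_real, Real.norm_of_nonneg (by positivity)]
    linarith
  have h2 : slitDisc z₀ r = (fun z => z + z₀) '' (Complex.slitPlane ∩ Metric.ball 0 r) := by
    ext z
    simp only [slitDisc, Set.mem_ofPred_eq, Set.mem_image, Set.mem_inter_iff, mem_ball_zero_iff]
    exact ⟨fun h => ⟨z - z₀, h, by ring⟩, by rintro ⟨w, hw, rfl⟩; simpa using hw⟩
  rw [h2]
  have hmem : ((r / 2 : ℝ) : ℂ) ∈ Complex.slitPlane ∩ Metric.ball 0 r := by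
    refine ⟨Complex.ofReal_mem_slitPlane.2 (by positivity), ?_⟩
    rw [mem_ball_zero_iff, Complex.norm_real, Real.norm_of_nonneg (by positivity)]
    linarith
  exact (h1.isPathConnected hmem).isConnected.isPreconnected.image _ (by fun_prop)

/-- The expansion of the vanishing determinant with two equal rows. -/
theorem wronskian₃_relation (y : ℂ → ℂ) (g : Fin 3 → ℂ → ℂ) (z : ℂ) :
    y z * wronskian₃ g z = g 0 z * wronskian₃ ![y, g 1, g 2] z -
      g 1 z * wronskian₃ ![y, g 0, g 2] z + g 2 z * wronskian₃ ![y, g 0, g 1] z := by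
  simp only [wronskian₃_eq_det3, det3, jet]
  simp
  ring

/-- Any three solutions of `y''' + P y' + Q y = 0` have a constant Wronskian. -/
theorem deriv_wronskian₃_eq_zero {G : Fin 3 → ℂ → ℂ} {z P Q : ℂ}
    (ha : ∀ i, AnalyticAt ℂ (G i) z)
    (he : ∀ i, iteratedDeriv 3 (G i) z + P * deriv (G i) z + Q * G i z = 0) :
    deriv (wronskian₃ G) z = 0 := by
  rw [deriv_wronskian₃ ha]
  have h3 : ∀ i, jet G 3 z i = -P * jet G 1 z i - Q * jet G 0 z i := fun i => by
    simp only [jet, iteratedDeriv_one, iteratedDeriv_zero]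
    linear_combination he i
  simp only [det3, h3]
  ring

/-- A solution in the sense of `IsSolutionOn` satisfies the equation at every point at which the
Wronskian does not vanish. -/
theorem IsSolutionOn.equation {h : Fin 3 → ℂ → ℂ} {U : Set ℂ} (hU : IsOpen U) {y : ℂ → ℂ}
    (hy : IsSolutionOn (Q₂ h) (Q₃ h) U y) {z : ℂ} (hz : z ∈ U)
    (ha : ∀ i, AnalyticAt ℂ (h i) z) (hW : wronskian₃ h z ≠ 0) :
    iteratedDeriv 3 y z + coeffTwo h z * deriv y z + coeffThree h z * y z = 0 := by
  have hya : AnalyticAt ℂ y z := hy.1.analyticAt (hU.mem_nhds hz)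
  have hi : IsIndependentAt h z := ⟨ha, ((analyticAt_wronskian₃ ha).continuousAt.eventually_ne
    hW).filter_mono nhdsWithin_le_nhds⟩
  have h1 := mem_codiscreteWithin_iff_forall_mem_nhdsNE.1 hy.2 z hz
  have hc : AnalyticAt ℂ (fun z => iteratedDeriv 3 y z + coeffTwo h z * deriv y z +
      coeffThree h z * y z) z := by
    have := analyticAt_coeffTwo ha hW
    have := analyticAt_coeffThree ha hW
    have := analyticAt_iteratedDeriv hya 3
    fun_prop
  have e : (fun z => iteratedDeriv 3 y z + coeffTwo h z * deriv y z +
      coeffThree h z * y z) =ᶠ[𝓝[≠] z] fun _ => 0 := by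
    filter_upwards [h1, hi.coefficients_eventuallyEq.1, hi.coefficients_eventuallyEq.2,
      (hU.eventually_mem hz).filter_mono nhdsWithin_le_nhds] with ζ h1 h2 h3 h4
    rw [← h2, ← h3]
    exact h1.resolve_right fun h => h h4
  exact ((hc.frequently_eq_iff_eventually_eq analyticAt_const).1 e.frequently).self_of_nhds

/-- The converse of `IsSolutionOn.equation`: it is enough to know the equation with the coefficients
`coeffTwo` and `coeffThree`. -/
theorem isSolutionOn_of_equation {h : Fin 3 → ℂ → ℂ} {U : Set ℂ} {y : ℂ → ℂ}
    (hi : ∀ z ∈ U, IsIndependentAt h z) (hd : DifferentiableOn ℂ y U)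
    (he : ∀ z ∈ U, iteratedDeriv 3 y z + coeffTwo h z * deriv y z + coeffThree h z * y z = 0) :
    IsSolutionOn (Q₂ h) (Q₃ h) U y := by
  refine ⟨hd, mem_codiscreteWithin_iff_forall_mem_nhdsNE.2 fun z hz => ?_⟩
  filter_upwards [(hi z hz).coefficients_eventuallyEq.1, (hi z hz).coefficients_eventuallyEq.2]
    with ζ h1 h2
  by_cases hζ : ζ ∈ U
  · left
    change _ + _ * _ + _ * _ = _
    rw [h1, h2]
    exact he ζ hζ
  · exact Or.inr hζ

/-- The branches of `hᵢ / W^{1/3}` are solutions. -/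
theorem isSolutionOn_div_cubeRoot {h : Fin 3 → ℂ → ℂ} {U : Set ℂ} (hU : IsOpen U) {w : ℂ → ℂ}
    (ha : ∀ z ∈ U, ∀ i, AnalyticAt ℂ (h i) z) (hW : ∀ z ∈ U, wronskian₃ h z ≠ 0)
    (hw : DifferentiableOn ℂ w U) (he : ∀ z ∈ U, w z ^ 3 = wronskian₃ h z) (i : Fin 3) :
    IsSolutionOn (Q₂ h) (Q₃ h) U (fun z => h i z / w z) := by
  have hw0 : ∀ z ∈ U, w z ≠ 0 := fun z hz h0 => hW z hz (by rw [← he z hz, h0]; simp)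
  refine isSolutionOn_of_equation (fun z hz => ⟨ha z hz, ?_⟩) (fun z hz => ?_) fun z hz => ?_
  · exact ((analyticAt_wronskian₃ (ha z hz)).continuousAt.eventually_ne (hW z hz)).filter_mono
      nhdsWithin_le_nhds
  · exact ((ha z hz i).differentiableAt.div (hw.differentiableAt (hU.mem_nhds hz))
      (hw0 z hz)).differentiableWithinAt
  · exact equation_of_cubeRoot (ha z hz) (hW z hz) (hw.analyticAt (hU.mem_nhds hz))
      (Filter.mem_of_superset (hU.mem_nhds hz) he) i

/-- On a connected open set on which a branch of `W^{1/3}` exists, every solution is a linear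
combination of the `hᵢ / W^{1/3}`. -/
theorem IsSolutionOn.exists_eq_sum {h : Fin 3 → ℂ → ℂ} {U : Set ℂ} (hU : IsOpen U)
    (hc : IsPreconnected U) {w : ℂ → ℂ} (ha : ∀ z ∈ U, ∀ i, AnalyticAt ℂ (h i) z)
    (hW : ∀ z ∈ U, wronskian₃ h z ≠ 0) (hw : DifferentiableOn ℂ w U)
    (he : ∀ z ∈ U, w z ^ 3 = wronskian₃ h z) {y : ℂ → ℂ}
    (hy : IsSolutionOn (Q₂ h) (Q₃ h) U y) :
    ∃ C : Fin 3 → ℂ, ∀ z ∈ U, y z = ∑ i, C i * (h i z / w z) := by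
  rcases U.eq_empty_or_nonempty with rfl | ⟨p, hp⟩
  · simp
  have hw0 : ∀ z ∈ U, w z ≠ 0 := fun z hz h0 => hW z hz (by rw [← he z hz, h0]; simp)
  let g : Fin 3 → ℂ → ℂ := fun i z => h i z / w z
  have hga : ∀ z ∈ U, ∀ i, AnalyticAt ℂ (g i) z := fun z hz i =>
    (ha z hz i).div (hw.analyticAt (hU.mem_nhds hz)) (hw0 z hz)
  have hya : ∀ z ∈ U, AnalyticAt ℂ y z := fun z hz => hy.1.analyticAt (hU.mem_nhds hz)
  have hg : ∀ i, ∀ z ∈ U, iteratedDeriv 3 (g i) z + coeffTwo h z * deriv (g i) z +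
      coeffThree h z * g i z = 0 := fun i z hz =>
    equation_of_cubeRoot (ha z hz) (hW z hz) (hw.analyticAt (hU.mem_nhds hz))
      (Filter.mem_of_superset (hU.mem_nhds hz) he) i
  have hg1 : ∀ z ∈ U, wronskian₃ g z = 1 := by
    intro z hz
    have := wronskian₃_mul (ha z hz) ((hw.analyticAt (hU.mem_nhds hz)).fun_inv (hw0 z hz))
    simp only [← div_eq_mul_inv] at this
    rw [this, ← he z hz, inv_pow, inv_mul_cancel₀ (pow_ne_zero 3 (hw0 z hz))]
  have hconst : ∀ i j, ∀ z ∈ U, wronskian₃ ![y, g i, g j] z = wronskian₃ ![y, g i, g j] p := by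
    intro i j z hz
    have hGa : ∀ z ∈ U, ∀ l, AnalyticAt ℂ ((![y, g i, g j] : Fin 3 → ℂ → ℂ) l) z := by
      intro z hz l
      fin_cases l
      exacts [hya z hz, hga z hz i, hga z hz j]
    refine hU.is_const_of_deriv_eq_zero hc (fun z hz =>
      (analyticAt_wronskian₃ (hGa z hz)).differentiableAt.differentiableWithinAt)
      (fun z hz => deriv_wronskian₃_eq_zero (P := coeffTwo h z) (Q := coeffThree h z)
        (hGa z hz) fun l => ?_) hz hp
    fin_cases l
    exacts [hy.equation hU hz (ha z hz) (hW z hz), hg i z hz, hg j z hz]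
  refine ⟨![wronskian₃ ![y, g 1, g 2] p, -wronskian₃ ![y, g 0, g 2] p,
    wronskian₃ ![y, g 0, g 1] p], fun z hz => ?_⟩
  have key := wronskian₃_relation y g z
  rw [hg1 z hz, hconst _ _ z hz, hconst _ _ z hz, hconst _ _ z hz] at key
  simp only [Fin.sum_univ_three, Matrix.cons_val]
  linear_combination key

namespace IsIndependentAt

variable {h : Fin 3 → ℂ → ℂ} {z₀ : ℂ}

/-- Near `z₀` every solution is a combination of the `hᵢ / W^{1/3}`, and a fixed power of `z - z₀`
times a holomorphic cube root serves as `W^{1/3}` in a slit disc. -/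
theorem isApparentAt (hi : IsIndependentAt h z₀) : IsApparentAt (Q₂ h) (Q₃ h) z₀ := by
  obtain ⟨c, n, hn, hc, hmin⟩ := hi.exists_strictMono_orders
  obtain ⟨w, hw⟩ := hi.exists_wronskian_order
  have hWa := analyticAt_wronskian₃ hi.analyticAt
  refine ⟨_, (hi.hasLocalExponents hn.injective hc hw).1, ?_⟩
  obtain ⟨V, hVa, hV0, hV⟩ := (hWa.analyticOrderAt_eq_natCast).1 hw
  choose u hua hu using fun i => (natCast_le_analyticOrderAt (hi.analyticAt i)).1 (hmin i)
  have hev : ∀ᶠ z in 𝓝 z₀, (∀ i, AnalyticAt ℂ (h i) z) ∧ (∀ i, AnalyticAt ℂ (u i) z) ∧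
      (∀ i, h i z = (z - z₀) ^ n 0 • u i z) ∧ wronskian₃ h z = (z - z₀) ^ w • V z ∧
      AnalyticAt ℂ (cubeRootNear V z₀) z ∧ V z ≠ 0 :=
    (Filter.eventually_all.2 fun i => (hi.analyticAt i).eventually_analyticAt).and
    ((Filter.eventually_all.2 fun i => (hua i).eventually_analyticAt).and
    ((Filter.eventually_all.2 hu).and (hV.and
    ((analyticAt_cubeRootNear hVa hV0).eventually_analyticAt.and
      (hVa.continuousAt.eventually_ne hV0)))))
  obtain ⟨R, hR, hball⟩ := Metric.eventually_nhds_iff_ball.1 hev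
  filter_upwards [Ioo_mem_nhdsGT hR] with r hr y hy
  have hsub : ∀ z ∈ slitDisc z₀ r, z ∈ Metric.ball z₀ R := fun z hz => by
    rw [mem_ball_iff_norm]
    exact hz.2.trans hr.2
  have hne : ∀ z ∈ slitDisc z₀ r, z - z₀ ≠ 0 := fun z hz => Complex.slitPlane_ne_zero hz.1
  let ω : ℂ → ℂ := fun z => (z - z₀) ^ ((w : ℂ) / 3) * cubeRootNear V z₀ z
  have hω : ∀ z ∈ slitDisc z₀ r, ω z ^ 3 = wronskian₃ h z := by
    intro z hz
    rw [(hball z (hsub z hz)).2.2.2.1, mul_pow, cubeRootNear_cube hV0, ← Complex.cpow_nat_mul]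
    rw [show ((3 : ℕ) : ℂ) * ((w : ℂ) / 3) = (w : ℂ) by push_cast; ring, Complex.cpow_natCast]
    rfl
  have hωd : DifferentiableOn ℂ ω (slitDisc z₀ r) := by
    intro z hz
    refine (DifferentiableAt.mul ?_
      (hball z (hsub z hz)).2.2.2.2.1.differentiableAt).differentiableWithinAt
    exact (differentiableAt_id.sub_const z₀).cpow_const hz.1
  obtain ⟨C, hC⟩ := hy.exists_eq_sum (isOpen_slitDisc z₀ r) (isPreconnected_slitDisc z₀ hr.1)
    (fun z hz => (hball z (hsub z hz)).1)
    (fun z hz => by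
      rw [(hball z (hsub z hz)).2.2.2.1]
      exact mul_ne_zero (pow_ne_zero _ (hne z hz)) (hball z (hsub z hz)).2.2.2.2.2) hωd hω
  have hcn : ∀ z ∈ Metric.ball z₀ R, cubeRootNear V z₀ z ≠ 0 := fun z hz h0 =>
    (hball z hz).2.2.2.2.2 (by rw [← cubeRootNear_cube hV0 z, h0]; simp)
  -- a single power of `z - z₀` suffices, that of the lowest exponent
  refine ⟨![fun z => ∑ i, C i * (u i z / cubeRootNear V z₀ z), 0, 0], fun j => ?_,
    fun z hz => ?_⟩
  · fin_cases j
    · intro z hz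
      have hz' := Metric.ball_subset_ball hr.2.le hz
      refine DifferentiableAt.differentiableWithinAt (f := fun z => ∑ i, C i *
        (u i z / cubeRootNear V z₀ z)) ?_
      exact DifferentiableAt.fun_sum fun i _ => (((hball z hz').2.1 i).differentiableAt.fun_div
        (hball z hz').2.2.2.2.1.differentiableAt (hcn z hz')).const_mul (C i)
    · exact differentiableOn_const 0
    · exact differentiableOn_const 0
  · rw [hC z hz]
    have h1 := (hball z (hsub z hz)).2.2.1
    have hx := hne z hz
    have h2 : (z - z₀) ^ ((w : ℂ) / 3) ≠ 0 := by simp [Complex.cpow_eq_zero_iff, hx]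
    have h3 := hcn z (hsub z hz)
    simp only [Fin.sum_univ_three, Matrix.cons_val, Pi.zero_apply, mul_zero, add_zero, h1,
      smul_eq_mul, Complex.cpow_sub _ _ hx, Complex.cpow_natCast, ω]
    field_simp

/-- The exponents at a point are distinct elements of `⅓ ℤ` with integral differences, the lowest of
which is not positive because the orders of vanishing add up to `ord W + 3`. -/
theorem exists_ordered_exponents (hi : IsIndependentAt h z₀) :
    ∃ κ : Fin 3 → ℝ, HasLocalExponents (Q₂ h) (Q₃ h) z₀ (fun j => (κ j : ℂ)) ∧
      κ 0 < κ 1 ∧ κ 1 < κ 2 ∧ (∃ m : ℤ, m ≤ 0 ∧ κ 0 = m / 3) ∧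
      ∀ j, ∃ n : ℤ, κ j - κ 0 = n := by
  obtain ⟨c, n, hn, hc, -⟩ := hi.exists_strictMono_orders
  obtain ⟨w, hw⟩ := hi.exists_wronskian_order
  obtain ⟨h1, h2⟩ := hi.hasLocalExponents hn.injective hc hw
  have h01 : n 0 < n 1 := hn (by decide)
  have h12 : n 1 < n 2 := hn (by decide)
  refine ⟨fun j => n j - w / 3, by simpa using h1, by simpa using h01, by simpa using h12,
    ⟨3 * n 0 - w, by omega, by push_cast; ring⟩, fun j => ⟨n j - n 0, by push_cast; ring⟩⟩

end IsIndependentAt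

/-! ### Behaviour of the equation under Möbius transformations -/

/-- The Möbius transformation `z ↦ (az + b)/(cz + d)` of `ℂ`. -/
noncomputable def moebius (g : GL (Fin 2) ℝ) (z : ℂ) : ℂ := num g z / denom g z

section Moebius

theorem eventually_im_pos {z : ℂ} (hz : 0 < z.im) : ∀ᶠ ζ in 𝓝 z, 0 < ζ.im :=
  (Complex.continuous_im.tendsto z).eventually (lt_mem_nhds hz)

variable {g : GL (Fin 2) ℝ}

theorem det_eq_one_iff_entries :
    g.det = 1 ↔ (g 0 0 : ℂ) * g 1 1 - (g 0 1 : ℂ) * g 1 0 = 1 := by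
  rw [Units.ext_iff, Matrix.GeneralLinearGroup.val_det_apply, Matrix.det_fin_two]
  norm_cast

theorem hasDerivAt_denom (g : GL (Fin 2) ℝ) (z : ℂ) : HasDerivAt (denom g) (g 1 0 : ℂ) z :=
  (((hasDerivAt_id' z).const_mul (g 1 0 : ℂ)).add_const (g 1 1 : ℂ)).congr_deriv (mul_one _)

theorem analyticAt_denom (g : GL (Fin 2) ℝ) (z : ℂ) : AnalyticAt ℂ (denom g) z := by
  unfold denom
  fun_prop

theorem hasDerivAt_moebius (hg : g.det = 1) {z : ℂ} (hz : denom g z ≠ 0) :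
    HasDerivAt (moebius g) (denom g z ^ 2)⁻¹ z := by
  have h1 : HasDerivAt (num g) (g 0 0 : ℂ) z :=
    (((hasDerivAt_id' z).const_mul (g 0 0 : ℂ)).add_const (g 0 1 : ℂ)).congr_deriv (mul_one _)
  refine (h1.fun_div (hasDerivAt_denom g z) hz).congr_deriv ?_
  rw [div_eq_iff (pow_ne_zero 2 hz), inv_mul_cancel₀ (pow_ne_zero 2 hz), num, denom]
  linear_combination det_eq_one_iff_entries.1 hg

theorem analyticAt_moebius {z : ℂ} (hz : denom g z ≠ 0) : AnalyticAt ℂ (moebius g) z := by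
  refine AnalyticAt.fun_div ?_ (analyticAt_denom g z) hz
  unfold num
  fun_prop

theorem det_val_pos (hg : g.det = 1) : 0 < g.det.val := by
  rw [hg]
  exact one_pos

theorem coe_smul_eq_moebius (hg : g.det = 1) (τ : ℍ) : ((g • τ : ℍ) : ℂ) = moebius g τ :=
  coe_smul_of_det_pos (det_val_pos hg) τ

theorem moebius_im_pos (hg : g.det = 1) {z : ℂ} (hz : 0 < z.im) : 0 < (moebius g z).im := by
  rw [show moebius g z = ((g • (⟨z, hz⟩ : ℍ) : ℍ) : ℂ) from (coe_smul_eq_moebius hg ⟨z, hz⟩).symm]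
  exact (g • (⟨z, hz⟩ : ℍ)).im_pos

theorem denom_ne_zero_of_im_pos (g : GL (Fin 2) ℝ) {z : ℂ} (hz : 0 < z.im) : denom g z ≠ 0 :=
  denom_ne_zero_of_im g hz.ne'

theorem tendsto_moebius_nhdsNE (hg : g.det = 1) {z : ℂ} (hz : 0 < z.im) :
    Tendsto (moebius g) (𝓝[≠] z) (𝓝[≠] moebius g z) :=
  (hasDerivAt_moebius hg (denom_ne_zero_of_im_pos g hz)).tendsto_nhdsNE
    (inv_ne_zero (pow_ne_zero 2 (denom_ne_zero_of_im_pos g hz)))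

/-- The transformation law of the logarithmic derivative under a Möbius transformation with an
automorphy factor. -/
theorem logDeriv_of_eq_denom_zpow_mul (hg : g.det = 1) {F G : ℂ → ℂ} {z : ℂ} (hz : 0 < z.im)
    {p : ℤ} (hG : AnalyticAt ℂ G (moebius g z)) (hG0 : G (moebius g z) ≠ 0)
    (e : F =ᶠ[𝓝 z] fun ζ => denom g ζ ^ p * G (moebius g ζ)) :
    deriv F z / F z = p * g 1 0 / denom g z +
      (denom g z ^ 2)⁻¹ * (deriv G (moebius g z) / G (moebius g z)) := by
  have hD := denom_ne_zero_of_im_pos g hz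
  have h1 : HasDerivAt (fun ζ => denom g ζ ^ p) (p * denom g z ^ (p - 1) * g 1 0) z :=
    (hasDerivAt_zpow p _ (Or.inl hD)).comp z (hasDerivAt_denom g z)
  have h2 : HasDerivAt (fun ζ => G (moebius g ζ))
      (deriv G (moebius g z) * (denom g z ^ 2)⁻¹) z :=
    hG.differentiableAt.hasDerivAt.comp z (hasDerivAt_moebius hg hD)
  have hp : denom g z ^ p ≠ 0 := zpow_ne_zero p hD
  rw [e.deriv_eq, e.eq_of_nhds, (h1.fun_mul h2).deriv, zpow_sub_one₀ hD]
  field_simp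

/-- If `y` solves `y''' + P y' + Q y = 0`, then `(cz+d)² y(gz)` solves the transformed equation:
the Riccati form of this statement. -/
theorem IsRiccati.comp_moebius (hg : g.det = 1) {P Q l lg : ℂ → ℂ} {z : ℂ} (hz : 0 < z.im)
    (hl : IsRiccati P Q l (moebius g z)) (hla : AnalyticAt ℂ l (moebius g z))
    (e : lg =ᶠ[𝓝 z] fun ζ => 2 * g 1 0 / denom g ζ + (denom g ζ ^ 2)⁻¹ * l (moebius g ζ)) :
    IsRiccati (fun ζ => (denom g ζ ^ 4)⁻¹ * P (moebius g ζ))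
      (fun ζ => (denom g ζ ^ 6)⁻¹ * Q (moebius g ζ) -
        2 * g 1 0 * ((denom g ζ ^ 5)⁻¹ * P (moebius g ζ))) lg z := by
  have hD := denom_ne_zero_of_im_pos g hz
  have hz' := eventually_im_pos hz
  have d1 : deriv lg =ᶠ[𝓝 z] fun ζ => -2 * (g 1 0 : ℂ) ^ 2 / denom g ζ ^ 2 -
      2 * g 1 0 / denom g ζ ^ 3 * l (moebius g ζ) +
      (denom g ζ ^ 4)⁻¹ * deriv l (moebius g ζ) := by
    filter_upwards [e.eventuallyEq_nhds, hz', (analyticAt_moebius hD).continuousAt.eventually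
      hla.eventually_analyticAt] with ζ h1 h2 h3
    have hζ := denom_ne_zero_of_im_pos g h2
    have k0 := hasDerivAt_denom g ζ
    have k1 : HasDerivAt (fun ζ => l (moebius g ζ)) _ ζ :=
      h3.differentiableAt.hasDerivAt.comp ζ (hasDerivAt_moebius hg hζ)
    rw [h1.deriv_eq, (((hasDerivAt_const ζ (2 * (g 1 0 : ℂ))).fun_div k0 hζ).fun_add
      (((k0.fun_pow 2).fun_inv (pow_ne_zero 2 hζ)).fun_mul k1)).deriv]
    field_simp
    push_cast
    ring
  have d2 : deriv (deriv lg) z = 4 * (g 1 0 : ℂ) ^ 3 / denom g z ^ 3 +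
      6 * (g 1 0 : ℂ) ^ 2 / denom g z ^ 4 * l (moebius g z) -
      6 * g 1 0 / denom g z ^ 5 * deriv l (moebius g z) +
      (denom g z ^ 6)⁻¹ * deriv (deriv l) (moebius g z) := by
    have k0 := hasDerivAt_denom g z
    have k1 : HasDerivAt (fun ζ => l (moebius g ζ)) _ z :=
      hla.differentiableAt.hasDerivAt.comp z (hasDerivAt_moebius hg hD)
    have k2 : HasDerivAt (fun ζ => deriv l (moebius g ζ)) _ z :=
      hla.deriv.differentiableAt.hasDerivAt.comp z (hasDerivAt_moebius hg hD)
    rw [d1.deriv_eq, ((((hasDerivAt_const z (-2 * (g 1 0 : ℂ) ^ 2)).fun_div (k0.fun_pow 2)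
      (pow_ne_zero 2 hD)).fun_sub (((hasDerivAt_const z (2 * (g 1 0 : ℂ))).fun_div (k0.fun_pow 3)
      (pow_ne_zero 3 hD)).fun_mul k1)).fun_add
      (((k0.fun_pow 4).fun_inv (pow_ne_zero 4 hD)).fun_mul k2)).deriv]
    field_simp
    push_cast
    ring
  rw [IsRiccati] at hl ⊢
  rw [d2, d1.eq_of_nhds, e.eq_of_nhds]
  field_simp
  linear_combination hl

theorem wronskian₃_linComb {h : Fin 3 → ℂ → ℂ} {z : ℂ} (ha : ∀ i, AnalyticAt ℂ (h i) z)
    (S : Matrix (Fin 3) (Fin 3) ℂ) :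
    wronskian₃ (fun i => linComb (S i) h) z = S.det * wronskian₃ h z := by
  rw [wronskian₃_eq_det3, wronskian₃_eq_det3]
  have : ∀ n, jet (fun i => linComb (S i) h) n z = fun i => ∑ j, S i j * jet h n z j := fun n =>
    funext fun i => iteratedDeriv_linComb ha (S i) n
  simp only [this, det3, Fin.sum_univ_three, Matrix.det_fin_three]
  ring

/-- The triples `h` and `hg` are holomorphic on the upper half plane and related there by
`h |_m g = S hg` for an invertible matrix `S`. -/
structure IsMoebiusRelated (g : GL (Fin 2) ℝ) (m : ℤ) (S : Matrix (Fin 3) (Fin 3) ℂ)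
    (h hg : Fin 3 → ℂ → ℂ) : Prop where
  det_eq : g.det = 1
  det_matrix : S.det ≠ 0
  left : ∀ z : ℂ, 0 < z.im → ∀ i, AnalyticAt ℂ (h i) z
  right : ∀ z : ℂ, 0 < z.im → ∀ i, AnalyticAt ℂ (hg i) z
  rel : ∀ z : ℂ, 0 < z.im → ∀ i, h i (moebius g z) = denom g z ^ m * linComb (S i) hg z

namespace IsMoebiusRelated

variable {m : ℤ} {S : Matrix (Fin 3) (Fin 3) ℂ} {h hg : Fin 3 → ℂ → ℂ} {z : ℂ}

theorem linComb_eq (hr : IsMoebiusRelated g m S h hg) (hz : 0 < z.im) (i : Fin 3) :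
    linComb (S i) hg z = denom g z ^ (-m) * h i (moebius g z) := by
  rw [hr.rel z hz, ← mul_assoc, ← zpow_add₀ (denom_ne_zero_of_im_pos g hz)]
  simp

/-- The Wronskian transforms with three times the weight of the triple plus six. -/
theorem wronskian_eq (hr : IsMoebiusRelated g m S h hg) (hz : 0 < z.im) :
    S.det * wronskian₃ hg z = denom g z ^ (-6 - 3 * m) * wronskian₃ h (moebius g z) := by
  have hD := denom_ne_zero_of_im_pos g hz
  have hz' := eventually_im_pos hz
  have hM := analyticAt_moebius hD
  have ha := hr.left _ (moebius_im_pos hr.det_eq hz)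
  have e : ∀ i, linComb (S i) hg =ᶠ[𝓝 z] fun ζ => h i (moebius g ζ) * denom g ζ ^ (-m) := by
    intro i
    filter_upwards [hz'] with ζ hζ
    rw [hr.linComb_eq hζ, mul_comm]
  have h1 : wronskian₃ (fun i => linComb (S i) hg) z =
      wronskian₃ (fun i ζ => h i (moebius g ζ) * denom g ζ ^ (-m)) z := by
    simp only [wronskian₃, (e _).iteratedDeriv_eq]
  rw [wronskian₃_linComb (hr.right z hz),
    wronskian₃_mul (fun i => (ha i).fun_comp hM) ((analyticAt_denom g z).fun_zpow hD),
    wronskian₃_comp ha hM, (hasDerivAt_moebius hr.det_eq hD).deriv] at h1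
  rw [h1, ← mul_assoc]
  congr 1
  rw [inv_pow, ← zpow_natCast, ← zpow_natCast, ← zpow_natCast, ← zpow_mul, ← zpow_mul, ← zpow_neg,
    ← zpow_add₀ hD]
  congr 1
  push_cast
  ring

theorem isIndependentAt (hr : IsMoebiusRelated g m S h hg) (hz : 0 < z.im)
    (hi : IsIndependentAt h (moebius g z)) : IsIndependentAt hg z := by
  refine ⟨hr.right z hz, ?_⟩
  have hz' := eventually_im_pos hz
  filter_upwards [(tendsto_moebius_nhdsNE hr.det_eq hz).eventually hi.wronskian_ne,
    hz'.filter_mono nhdsWithin_le_nhds] with ζ h1 h2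
  refine right_ne_zero_of_mul (a := S.det) ?_
  rw [hr.wronskian_eq h2]
  exact mul_ne_zero (zpow_ne_zero _ (denom_ne_zero_of_im_pos g h2)) h1

/-- The weight `m` cancels: the logarithmic derivatives of `hᵢ / W^{1/3}` transform as those of a
function of weight `-2`. -/
theorem twistedLogDeriv_eq (hr : IsMoebiusRelated g m S h hg) (hz : 0 < z.im) {i : Fin 3}
    (h0 : h i (moebius g z) ≠ 0) (hW : wronskian₃ h (moebius g z) ≠ 0) :
    twistedLogDeriv hg (linComb (S i) hg) z = 2 * g 1 0 / denom g z +
      (denom g z ^ 2)⁻¹ * twistedLogDeriv h (h i) (moebius g z) := by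
  have hD := denom_ne_zero_of_im_pos g hz
  have hz' := eventually_im_pos hz
  have ha := hr.left _ (moebius_im_pos hr.det_eq hz)
  have e1 := logDeriv_of_eq_denom_zpow_mul hr.det_eq hz (ha i) h0
    (Filter.Eventually.mono hz' fun ζ hζ => hr.linComb_eq hζ i)
  have e2 := logDeriv_of_eq_denom_zpow_mul hr.det_eq hz (analyticAt_wronskian₃ ha) hW
    (Filter.Eventually.mono hz' fun ζ hζ => hr.wronskian_eq hζ)
  have e3 : ∀ (k : Fin 3 → ℂ → ℂ) (ζ : ℂ), thirdLogDeriv k ζ =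
      1 / 3 * (deriv (wronskian₃ k) ζ / wronskian₃ k ζ) := by
    intro k ζ
    rw [thirdLogDeriv]
    ring
  rw [deriv_const_mul_field, mul_div_mul_left _ _ hr.det_matrix] at e2
  rw [twistedLogDeriv, twistedLogDeriv, e1, e3, e3, e2]
  push_cast
  ring

/-- The coefficients of the equations attached to related triples. -/
theorem coefficients_eq (hr : IsMoebiusRelated g m S h hg) (hz : 0 < z.im)
    (hi : IsIndependentAt h (moebius g z)) :
    ∀ᶠ ζ in 𝓝[≠] z, Q₂ hg ζ = (denom g ζ ^ 4)⁻¹ * Q₂ h (moebius g ζ) ∧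
      Q₃ hg ζ = (denom g ζ ^ 6)⁻¹ * Q₃ h (moebius g ζ) -
        2 * g 1 0 * ((denom g ζ ^ 5)⁻¹ * Q₂ h (moebius g ζ)) := by
  have hz' := eventually_im_pos hz
  have ht := tendsto_moebius_nhdsNE hr.det_eq hz
  have hig := hr.isIndependentAt hz hi
  have hne : ∀ i, ∀ᶠ ζ in 𝓝[≠] (moebius g z), h i ζ ≠ 0 := fun i => by
    simpa [linComb_single] using hi.linComb_eventually_ne (c := Pi.single i 1) (by simp)
  filter_upwards [hz'.filter_mono nhdsWithin_le_nhds, ht.eventually hi.eventually, hig.eventually,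
    ht.eventually (hi.minor_eventually_ne (i := 0) (j := 1) (by decide)),
    ht.eventually (hne 0), ht.eventually (hne 1), ht.eventually hi.coefficients_eventuallyEq.1,
    ht.eventually hi.coefficients_eventuallyEq.2, hig.coefficients_eventuallyEq.1,
    hig.coefficients_eventuallyEq.2] with ζ k1 k2 k3 k4 k5 k6 k7 k8 k9 k10
  rw [k7, k8, k9, k10]
  have hD := denom_ne_zero_of_im_pos g k1
  have hM := (analyticAt_moebius hD).continuousAt
  have hric : ∀ i, h i (moebius g ζ) ≠ 0 →
      IsRiccati (coeffTwo hg) (coeffThree hg) (twistedLogDeriv hg (linComb (S i) hg)) ζ ∧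
      IsRiccati (fun ζ => (denom g ζ ^ 4)⁻¹ * coeffTwo h (moebius g ζ))
        (fun ζ => (denom g ζ ^ 6)⁻¹ * coeffThree h (moebius g ζ) -
          2 * g 1 0 * ((denom g ζ ^ 5)⁻¹ * coeffTwo h (moebius g ζ)))
        (twistedLogDeriv hg (linComb (S i) hg)) ζ := by
    intro i h0
    have hl : linComb (S i) hg ζ ≠ 0 := by
      rw [hr.linComb_eq k1]
      exact mul_ne_zero (zpow_ne_zero _ hD) h0
    refine ⟨isRiccati_twistedLogDeriv k3.1 k3.2 _ hl, ?_⟩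
    have := isRiccati_twistedLogDeriv k2.1 k2.2 (Pi.single i 1) (by rwa [linComb_single])
    rw [linComb_single] at this
    refine this.comp_moebius hr.det_eq k1
      (analyticAt_twistedLogDeriv k2.1 k2.2 (k2.1 i) h0) ?_
    filter_upwards [eventually_im_pos k1,
      hM.eventually ((k2.1 i).continuousAt.eventually_ne h0),
      hM.eventually ((analyticAt_wronskian₃ k2.1).continuousAt.eventually_ne k2.2)] with ξ j1 j2 j3
    exact hr.twistedLogDeriv_eq j1 j2 j3
  obtain ⟨a1, a2⟩ := hric 0 k5
  obtain ⟨b1, b2⟩ := hric 1 k6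
  have hdiff : twistedLogDeriv hg (linComb (S 0) hg) ζ -
      twistedLogDeriv hg (linComb (S 1) hg) ζ ≠ 0 := by
    rw [hr.twistedLogDeriv_eq k1 k5 k2.2, hr.twistedLogDeriv_eq k1 k6 k2.2, twistedLogDeriv,
      twistedLogDeriv]
    intro h0
    refine k4 ?_
    field_simp at h0
    linear_combination -h0
  rw [IsRiccati] at a1 a2 b1 b2
  have e : coeffTwo hg ζ = (denom g ζ ^ 4)⁻¹ * coeffTwo h (moebius g ζ) := by
    refine mul_left_cancel₀ hdiff ?_
    linear_combination a1 - a2 - b1 + b2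
  refine ⟨e, ?_⟩
  rw [e] at a1
  linear_combination a1 - a2

/-- The weight six combination of the coefficients. -/
theorem weightSix_eq (hr : IsMoebiusRelated g m S h hg) (hz : 0 < z.im)
    (hi : IsIndependentAt h (moebius g z)) :
    ∀ᶠ ζ in 𝓝[≠] z, Q₃ hg ζ - 1 / 2 * deriv (Q₂ hg) ζ =
      (denom g ζ ^ 6)⁻¹ * (Q₃ h (moebius g ζ) - 1 / 2 * deriv (Q₂ h) (moebius g ζ)) := by
  have ht := tendsto_moebius_nhdsNE hr.det_eq hz
  filter_upwards [(eventually_im_pos hz).filter_mono nhdsWithin_le_nhds,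
    ht.eventually hi.meromorphicAt_Q₂.eventually_analyticAt, hr.coefficients_eq hz hi,
    eventually_nhdsNE_eventually_nhds_iff.2 (hr.coefficients_eq hz hi)] with ζ h1 h2 h3 h4
  have hD := denom_ne_zero_of_im_pos g h1
  have e : Q₂ hg =ᶠ[𝓝 ζ] fun ξ => (denom g ξ ^ 4)⁻¹ * Q₂ h (moebius g ξ) :=
    h4.mono fun ξ hξ => hξ.1
  have k1 : HasDerivAt (fun ξ => Q₂ h (moebius g ξ)) _ ζ :=
    h2.differentiableAt.hasDerivAt.comp ζ (hasDerivAt_moebius hr.det_eq hD)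
  rw [h3.2, e.deriv_eq, ((((hasDerivAt_denom g ζ).fun_pow 4).fun_inv (pow_ne_zero 4 hD)).fun_mul
    k1).deriv]
  field_simp
  push_cast
  ring

end IsMoebiusRelated

end Moebius

/-! ### The slash action on the triple `h` -/

theorem analyticAt_comp_ofComplex {f : ℍ → ℂ} (hf : MDiff f) {z : ℂ} (hz : 0 < z.im) :
    AnalyticAt ℂ (fun ζ => f (ofComplex ζ)) z :=
  (UpperHalfPlane.mdifferentiable_iff.1 hf).analyticAt (isOpen_upperHalfPlaneSet.mem_nhds hz)

theorem mdifferentiable_of_analyticAt {f : ℍ → ℂ} {F : ℂ → ℂ}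
    (hF : ∀ z : ℂ, 0 < z.im → AnalyticAt ℂ F z) (h : ∀ τ : ℍ, f τ = F τ) : MDiff f := by
  refine UpperHalfPlane.mdifferentiable_iff.2 (DifferentiableOn.congr (f := F) (fun z hz =>
    (hF z hz).differentiableAt.differentiableWithinAt) fun z hz => ?_)
  rw [Function.comp_apply, ofComplex_apply_of_im_pos hz, h]

theorem analyticAt_hTriple {α : ℂ} {φ f₀ f₁ f₂ : ℍ → ℂ} (hφ : MDiff φ) (h₀ : MDiff f₀)
    (h₁ : MDiff f₁) (h₂ : MDiff f₂) {z : ℂ} (hz : 0 < z.im) (i : Fin 3) :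
    AnalyticAt ℂ (hTriple α φ f₀ f₁ f₂ i) z := by
  have a := analyticAt_comp_ofComplex hφ hz
  have a₀ := analyticAt_comp_ofComplex h₀ hz
  have a₁ := analyticAt_comp_ofComplex h₁ hz
  have a₂ := analyticAt_comp_ofComplex h₂ hz
  have b : AnalyticAt ℂ (fun ζ => (f₀ + f₁ * φ + f₂ * φ ^ 2) (ofComplex ζ)) z :=
    (a₀.add (a₁.mul a)).add (a₂.mul (a.pow 2))
  have b' : AnalyticAt ℂ (fun ζ => (f₁ + 2 * f₂ * φ) (ofComplex ζ)) z :=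
    a₁.add ((analyticAt_const.mul a₂).mul a)
  fin_cases i
  · exact (((analyticAt_id.pow 2).mul b).add ((analyticAt_const.mul analyticAt_id).mul b')).add
      (analyticAt_const.mul a₂)
  · exact ((analyticAt_const.mul analyticAt_id).mul b).add (analyticAt_const.mul b')
  · exact b

theorem slash_apply_of_det_eq_one {g : GL (Fin 2) ℝ} (hg : g.det = 1) (f : ℍ → ℂ) (k : ℤ)
    (τ : ℍ) : (f ∣[k] g) τ = f (g • τ) * denom g τ ^ (-k) := by
  rw [ModularForm.slash_apply, UpperHalfPlane.σ, if_pos (det_val_pos hg), hg]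
  simp

theorem apply_smul_of_det_eq_one {g : GL (Fin 2) ℝ} (hg : g.det = 1) (f : ℍ → ℂ) (k : ℤ)
    (τ : ℍ) : f (g • τ) = denom g τ ^ k * (f ∣[k] g) τ := by
  rw [slash_apply_of_det_eq_one hg, zpow_neg]
  have := zpow_ne_zero k (denom_ne_zero g τ)
  field_simp

/-- The action of `SL(2, ℝ)` on quasimodular forms of weight `2` and depth `1`: the slash action
corrected by the cocycle `α c / (cz + d)`. -/
noncomputable def quasiSlash (α : ℂ) (φ : ℍ → ℂ) (g : GL (Fin 2) ℝ) (τ : ℍ) : ℂ :=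
  (φ ∣[(2 : ℤ)] g) τ - α * (g 1 0 : ℝ) / denom g τ

/-- The correction term is a cocycle, so this is a right action. -/
theorem quasiSlash_mul (g : GL (Fin 2) ℝ) {g' : GL (Fin 2) ℝ} (hg' : g'.det = 1) (α : ℂ)
    (φ : ℍ → ℂ) : quasiSlash α φ (g * g') = quasiSlash α (quasiSlash α φ g) g' := by
  ext τ
  have h1 := denom_ne_zero g' τ
  have h2 := denom_ne_zero g (g' • τ)
  have h3 : denom (g * g') τ = denom g (g' • τ : ℍ) * denom g' τ := by
    rw [coe_smul_eq_moebius hg', denom_cocycle g g' τ.im_ne_zero]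
    rfl
  have h4 : ((g * g') 1 0 : ℂ) = (g 1 0 : ℂ) * g' 0 0 + (g 1 1 : ℂ) * g' 1 0 := by
    simp [Matrix.mul_apply, Fin.sum_univ_two]
  have h5 : denom g (g' • τ : ℍ) * denom g' τ = (g 1 0 : ℂ) * num g' τ + g 1 1 * denom g' τ := by
    rw [denom, coe_smul_eq_moebius hg', moebius]
    field_simp
  rw [quasiSlash, quasiSlash, slash_apply_of_det_eq_one hg', quasiSlash, SlashAction.slash_mul,
    slash_apply_of_det_eq_one hg']
  rw [h3, h4, zpow_neg]
  have h6 := det_eq_one_iff_entries.1 hg'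
  rw [num] at h5
  have h7 : (g 1 0 : ℂ) + g' 1 0 * (denom g (g' • τ : ℍ) * denom g' τ) =
      ((g 1 0 : ℂ) * g' 0 0 + (g 1 1 : ℂ) * g' 1 0) * denom g' τ := by
    rw [h5, denom]
    linear_combination -(g 1 0 : ℂ) * h6
  have h8 : α * ((g 1 0 : ℂ) * g' 0 0 + (g 1 1 : ℂ) * g' 1 0) /
      (denom g (g' • τ : ℍ) * denom g' τ) = α * (g 1 0 : ℝ) / denom g (g' • τ : ℍ) *
      (denom g' τ ^ (2 : ℤ))⁻¹ + α * (g' 1 0 : ℝ) / denom g' τ := by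
    rw [zpow_ofNat]
    field_simp
    linear_combination -α * h7
  rw [h8]
  ring

/-- The symmetric square of a two by two matrix, in the basis belonging to `h₁, h₂, h₃`. -/
def symSq (g : GL (Fin 2) ℝ) : Matrix (Fin 3) (Fin 3) ℂ :=
  !![(g 0 0 : ℂ) ^ 2, (g 0 0 : ℂ) * g 0 1, (g 0 1 : ℂ) ^ 2;
    2 * (g 0 0 : ℂ) * g 1 0, (g 0 0 : ℂ) * g 1 1 + (g 0 1 : ℂ) * g 1 0, 2 * (g 0 1 : ℂ) * g 1 1;
    (g 1 0 : ℂ) ^ 2, (g 1 0 : ℂ) * g 1 1, (g 1 1 : ℂ) ^ 2]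

theorem det_symSq {g : GL (Fin 2) ℝ} (hg : g.det = 1) : (symSq g).det = 1 := by
  have h := det_eq_one_iff_entries.1 hg
  have : (symSq g).det = ((g 0 0 : ℂ) * g 1 1 - (g 0 1 : ℂ) * g 1 0) ^ 3 := by
    simp only [symSq, Matrix.det_fin_three, Matrix.of_apply, Matrix.cons_val]
    ring
  rw [this, h, one_pow]

/-- The triple `h` spans the symmetric square of the standard representation. -/
theorem hTriple_moebius {g : GL (Fin 2) ℝ} (hg : g.det = 1) (α : ℂ) (k : ℤ)
    (φ f₀ f₁ f₂ : ℍ → ℂ) {z : ℂ} (hz : 0 < z.im) (i : Fin 3) :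
    hTriple α φ f₀ f₁ f₂ i (moebius g z) = denom g z ^ (k - 2) * linComb (symSq g i)
      (hTriple α (quasiSlash α φ g) (f₀ ∣[k] g) (f₁ ∣[k - 2] g) (f₂ ∣[k - 4] g)) z := by
  lift z to ℍ using hz
  have hD := denom_ne_zero g z
  have e0 := apply_smul_of_det_eq_one hg f₀ k z
  have e1 := apply_smul_of_det_eq_one hg f₁ (k - 2) z
  have e2 := apply_smul_of_det_eq_one hg f₂ (k - 4) z
  have e3 : φ (g • z) = denom g z ^ 2 * quasiSlash α φ g z + α * (g 1 0 : ℝ) * denom g z := by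
    rw [apply_smul_of_det_eq_one hg φ 2 z, quasiSlash, zpow_ofNat]
    field_simp
    ring
  have p0 : denom g z ^ k = denom g z ^ (k - 4) * denom g z ^ 4 := by
    rw [← zpow_natCast, ← zpow_add₀ hD]
    simp
  have p1 : denom g z ^ (k - 2) = denom g z ^ (k - 4) * denom g z ^ 2 := by
    rw [← zpow_natCast, ← zpow_add₀ hD]
    congr 1
    push_cast
    ring
  have hdet := det_eq_one_iff_entries.1 hg
  have hm : moebius g z * denom g z = num g z := by
    rw [moebius, div_mul_cancel₀ _ hD]
  have hof : ofComplex (moebius g z) = g • z := by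
    rw [← coe_smul_eq_moebius hg, ofComplex_apply]
  simp only [linComb, Fin.sum_univ_three, hTriple]
  fin_cases i <;>
    simp [symSq, hof, e0, e1, e2, e3, p0, p1]
  all_goals
    generalize (f₀ ∣[k] g) z = F₀
    generalize (f₁ ∣[k - 2] g) z = F₁
    generalize (f₂ ∣[k - 4] g) z = F₂
    generalize quasiSlash α φ g z = Φ
    generalize denom g z ^ (k - 4) = E
    have hD' : denom g z = (g 1 0 : ℂ) * z + g 1 1 := rfl
    rw [num, hD'] at hm
    simp only [hD']
    generalize (g 0 0 : ℂ) = a at *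
    generalize (g 0 1 : ℂ) = b at *
    generalize (g 1 0 : ℂ) = c at *
    generalize (g 1 1 : ℂ) = d at *
    generalize moebius g z = m at *
    have hk : a * (c * z + d) = c * (a * z + b) + 1 := by linear_combination hdet
  · linear_combination (E * ((c * z + d) ^ 2 * (F₀ + F₁ * Φ + F₂ * Φ ^ 2) +
        α * c * (c * z + d) * (F₁ + 2 * F₂ * Φ) + α ^ 2 * c ^ 2 * F₂) *
        (m * (c * z + d) + (a * z + b)) +
        α * E * ((c * z + d) * (F₁ + 2 * F₂ * Φ) + 2 * α * c * F₂)) * hm -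
      E * (α * (F₁ + 2 * F₂ * Φ) * (a * z + b) * (c * z + d) +
        α ^ 2 * F₂ * (c * (a * z + b) + 1 + a * (c * z + d))) * hk
  · linear_combination (2 * E * (c * z + d) * ((c * z + d) ^ 2 * (F₀ + F₁ * Φ + F₂ * Φ ^ 2) +
        α * c * (c * z + d) * (F₁ + 2 * F₂ * Φ) + α ^ 2 * c ^ 2 * F₂)) * hm -
      E * (c * z + d) * (α * (c * z + d) * (F₁ + 2 * F₂ * Φ) + 2 * α ^ 2 * c * F₂) * hk
  · ring

theorem mdifferentiable_quasiSlash {φ : ℍ → ℂ} (hφ : MDiff φ) (α : ℂ) (g : GL (Fin 2) ℝ) :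
    MDiff (quasiSlash α φ g) := by
  refine mdifferentiable_of_analyticAt (F := fun z => (φ ∣[(2 : ℤ)] g) (ofComplex z) -
    α * (g 1 0 : ℝ) / denom g z) (fun z hz => ?_) fun τ => ?_
  · exact (analyticAt_comp_ofComplex (hφ.slash 2 g) hz).sub
      (analyticAt_const.div (analyticAt_denom g z) (denom_ne_zero_of_im_pos g hz))
  · rw [ofComplex_apply]
    rfl

/-- The triple attached to the slashed data is related to the original one. -/
theorem isMoebiusRelated_hTriple {g : GL (Fin 2) ℝ} (hg : g.det = 1) (α : ℂ) (k : ℤ)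
    {φ f₀ f₁ f₂ : ℍ → ℂ} (hφ : MDiff φ) (h₀ : MDiff f₀) (h₁ : MDiff f₁) (h₂ : MDiff f₂) :
    IsMoebiusRelated g (k - 2) (symSq g) (hTriple α φ f₀ f₁ f₂)
      (hTriple α (quasiSlash α φ g) (f₀ ∣[k] g) (f₁ ∣[k - 2] g) (f₂ ∣[k - 4] g)) where
  det_eq := hg
  det_matrix := by
    rw [det_symSq hg]
    exact one_ne_zero
  left _ hz := analyticAt_hTriple hφ h₀ h₁ h₂ hz
  right _ hz := analyticAt_hTriple (mdifferentiable_quasiSlash hφ α g) (h₀.slash _ g)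
    (h₁.slash _ g) (h₂.slash _ g) hz
  rel _ hz := hTriple_moebius hg α k φ f₀ f₁ f₂ hz

theorem hTriple_smul (α : ℂ) (φ f₀ f₁ f₂ : ℍ → ℂ) (c : ℂ) (i : Fin 3) (z : ℂ) :
    hTriple α φ (c • f₀) (c • f₁) (c • f₂) i z = c * hTriple α φ f₀ f₁ f₂ i z := by
  fin_cases i <;> simp [hTriple] <;> ring

section Invariance

variable {Γ : Subgroup (GL (Fin 2) ℝ)} {χ : Γ →* ℂˣ} {k : ℤ} {α : ℂ} {φ f₀ f₁ f₂ : ℍ → ℂ}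

theorem quasiSlash_of_mem (hφ : IsQuasimodularWeightTwo Γ α φ) {γ : GL (Fin 2) ℝ} (hγ : γ ∈ Γ) :
    quasiSlash α φ γ = φ := by
  ext τ
  rw [quasiSlash, hφ.slash ⟨γ, hγ⟩]
  ring

/-- Elements of `Γ` relate the triple `h` to itself. -/
theorem isMoebiusRelated_of_mem [Γ.HasDetOne] (hφ : IsQuasimodularWeightTwo Γ α φ)
    (hf₀ : IsModularFormWithCharacter Γ k χ f₀)
    (hf₁ : IsModularFormWithCharacter Γ (k - 2) χ f₁)
    (hf₂ : IsModularFormWithCharacter Γ (k - 4) χ f₂) (γ : Γ) :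
    IsMoebiusRelated γ (k - 2) ((χ γ : ℂ) • symSq γ) (hTriple α φ f₀ f₁ f₂)
      (hTriple α φ f₀ f₁ f₂) where
  det_eq := Subgroup.HasDetOne.det_eq γ.2
  det_matrix := by
    rw [Matrix.det_smul, det_symSq (Subgroup.HasDetOne.det_eq γ.2)]
    simp
  left _ hz := analyticAt_hTriple hφ.holo hf₀.holo hf₁.holo hf₂.holo hz
  right _ hz := analyticAt_hTriple hφ.holo hf₀.holo hf₁.holo hf₂.holo hz
  rel z hz i := by
    rw [hTriple_moebius (Subgroup.HasDetOne.det_eq γ.2) α k φ f₀ f₁ f₂ hz,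
      quasiSlash_of_mem hφ γ.2, hf₀.slash γ, hf₁.slash γ, hf₂.slash γ]
    simp only [linComb, hTriple_smul, Fin.sum_univ_three, Matrix.smul_apply, smul_eq_mul]
    ring

end Invariance

/-! ### The Wronskian does not vanish identically -/

theorem isPreconnected_im_pos : IsPreconnected {z : ℂ | 0 < z.im} :=
  (convex_halfSpace_im_gt 0).isPreconnected

/-- The identity theorem on the upper half plane. -/
theorem eqOn_zero_of_eventually_im_pos {F : ℂ → ℂ} (hF : ∀ z : ℂ, 0 < z.im → AnalyticAt ℂ F z)
    {p : ℂ} (hp : 0 < p.im) (h0 : ∀ᶠ z in 𝓝 p, F z = 0) {z : ℂ} (hz : 0 < z.im) : F z = 0 :=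
  AnalyticOnNhd.eqOn_zero_of_preconnected_of_eventuallyEq_zero (U := {z : ℂ | 0 < z.im}) hF
    isPreconnected_im_pos hp h0 hz

/-- Linearly independent holomorphic functions have a Wronskian that is not identically zero. -/
theorem exists_wronskian₃_ne_zero {h : Fin 3 → ℂ → ℂ}
    (ha : ∀ z : ℂ, 0 < z.im → ∀ i, AnalyticAt ℂ (h i) z)
    (hlin : ∀ c, (∀ z : ℂ, 0 < z.im → linComb c h z = 0) → c = 0) :
    ∃ z : ℂ, 0 < z.im ∧ wronskian₃ h z ≠ 0 := by
  by_contra! hW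
  have hlocal : ∀ c : Fin 3 → ℂ, c ≠ 0 → ∀ p : ℂ, 0 < p.im → ¬ ∀ᶠ z in 𝓝 p, linComb c h z = 0 :=
    fun c hc p hp h0 => hc (hlin c fun z hz => eqOn_zero_of_eventually_im_pos
      (fun z hz => analyticAt_linComb (ha z hz) c) hp h0 hz)
  obtain ⟨p, hp, hp0⟩ : ∃ p : ℂ, 0 < p.im ∧ h 2 p ≠ 0 := by
    by_contra! h0
    have := hlin (Pi.single 2 1) fun z hz => by rw [linComb_single]; exact h0 z hz
    simpa using congrFun this 2
  -- divide by the last function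
  let u : ℂ → ℂ := fun z => h 1 z / h 2 z
  let v : ℂ → ℂ := fun z => h 0 z / h 2 z
  have hev : ∀ᶠ z in 𝓝 p, 0 < z.im ∧ h 2 z ≠ 0 :=
    (eventually_im_pos hp).and ((ha p hp 2).continuousAt.eventually_ne hp0)
  have hua : ∀ z, 0 < z.im ∧ h 2 z ≠ 0 → AnalyticAt ℂ u z := fun z hz =>
    (ha z hz.1 1).div (ha z hz.1 2) hz.2
  have hva : ∀ z, 0 < z.im ∧ h 2 z ≠ 0 → AnalyticAt ℂ v z := fun z hz =>
    (ha z hz.1 0).div (ha z hz.1 2) hz.2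
  have key : ∀ᶠ z in 𝓝 p, deriv (deriv v) z * deriv u z - deriv v z * deriv (deriv u) z = 0 := by
    filter_upwards [hev.eventually_nhds] with z hz
    have hz' := hz.self_of_nhds
    have e : ∀ i, h i =ᶠ[𝓝 z] fun ζ => (![v, u, fun _ => 1] : Fin 3 → ℂ → ℂ) i ζ * h 2 ζ := by
      intro i
      filter_upwards [hz] with ζ hζ
      fin_cases i <;> simp [u, v, hζ.2]
    have h1 : wronskian₃ h z =
        wronskian₃ (fun i ζ => (![v, u, fun _ => 1] : Fin 3 → ℂ → ℂ) i ζ * h 2 ζ) z := by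
      simp only [wronskian₃, (e _).iteratedDeriv_eq]
    rw [hW z hz'.1, wronskian₃_mul (fun i => by
      fin_cases i
      exacts [hva z hz', hua z hz', analyticAt_const]) (ha z hz'.1 2), wronskian₃_eq_det3] at h1
    have h2 := (mul_eq_zero.1 h1.symm).resolve_left (pow_ne_zero 3 hz'.2)
    simp only [det3, jet, iteratedDeriv_succ, iteratedDeriv_zero, Matrix.cons_val, deriv_const',
      deriv_const] at h2
    linear_combination -h2
  obtain ⟨r, hr, hball⟩ := Metric.eventually_nhds_iff_ball.1 (hev.and key)
  by_cases hu : ∀ z ∈ Metric.ball p r, deriv u z = 0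
  · refine hlocal ![0, 1, -u p] (fun h0 => by simpa using congrFun h0 1) p hp ?_
    filter_upwards [Metric.ball_mem_nhds p hr] with z hz
    have : u z = u p := Metric.isOpen_ball.is_const_of_deriv_eq_zero
      (convex_ball p r).isPreconnected
      (fun z hz => (hua z (hball z hz).1).differentiableAt.differentiableWithinAt) hu hz
      (Metric.mem_ball_self hr)
    simp only [u] at this ⊢
    rw [div_eq_iff (hball z hz).1.2] at this
    simp only [linComb, Fin.sum_univ_three, Matrix.cons_val, this]
    ring
  · push Not at hu
    obtain ⟨p', hp', hu'⟩ := hu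
    have hev' : ∀ᶠ z in 𝓝 p', z ∈ Metric.ball p r ∧ deriv u z ≠ 0 :=
      (Metric.isOpen_ball.eventually_mem hp').and
        ((hua p' (hball p' hp').1).deriv.continuousAt.eventually_ne hu')
    obtain ⟨r', hr', hball'⟩ := Metric.eventually_nhds_iff_ball.1 hev'
    have hub : ∀ z ∈ Metric.ball p' r', AnalyticAt ℂ u z := fun z hz =>
      hua z (hball z (hball' z hz).1).1
    have hvb : ∀ z ∈ Metric.ball p' r', AnalyticAt ℂ v z := fun z hz =>
      hva z (hball z (hball' z hz).1).1
    have hmem := Metric.mem_ball_self (x := p') hr'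
    obtain ⟨t, ht⟩ : ∃ t, ∀ z ∈ Metric.ball p' r', deriv v z = t * deriv u z := by
      refine ⟨deriv v p' / deriv u p', fun z hz => ?_⟩
      have : deriv v z / deriv u z = deriv v p' / deriv u p' :=
        Metric.isOpen_ball.is_const_of_deriv_eq_zero (f := fun z => deriv v z / deriv u z)
          (convex_ball p' r').isPreconnected
          (fun z hz => ((hvb z hz).deriv.differentiableAt.fun_div (hub z hz).deriv.differentiableAt
            (hball' z hz).2).differentiableWithinAt)
          (fun z hz => by
            rw [deriv_fun_div (hvb z hz).deriv.differentiableAt (hub z hz).deriv.differentiableAt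
              (hball' z hz).2, (hball z (hball' z hz).1).2, zero_div, Pi.zero_apply]) hz hmem
      rw [← this, div_mul_cancel₀ _ (hball' z hz).2]
    refine hlocal ![1, -t, -(v p' - t * u p')] (fun h0 => by simpa using congrFun h0 0) p'
      (hball p' hp').1.1 ?_
    filter_upwards [Metric.ball_mem_nhds p' hr'] with z hz
    have : v z - t * u z = v p' - t * u p' :=
      Metric.isOpen_ball.is_const_of_deriv_eq_zero (f := fun z => v z - t * u z)
        (convex_ball p' r').isPreconnected
        (fun z hz => ((hvb z hz).differentiableAt.fun_sub
          ((hub z hz).differentiableAt.const_mul t)).differentiableWithinAt)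
        (fun z hz => by
          rw [deriv_fun_sub (hvb z hz).differentiableAt ((hub z hz).differentiableAt.const_mul t),
            deriv_const_mul_field, ht z hz, sub_self, Pi.zero_apply]) hz hmem
    simp only [linComb, Fin.sum_univ_three, Matrix.cons_val, ← this, u, v]
    have := (hball z (hball' z hz).1).1.2
    field_simp
    ring

/-- The data `φ, f₀, f₁, f₂` are periodic up to a common factor of the `fⱼ`. -/
structure IsQuasiPeriodic (N : ℝ) (ε : ℂ) (φ f₀ f₁ f₂ : ℍ → ℂ) : Prop where
  phi : ∀ z : ℂ, 0 < z.im → φ (ofComplex (z + N)) = φ (ofComplex z)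
  zero : ∀ z : ℂ, 0 < z.im → f₀ (ofComplex (z + N)) = ε * f₀ (ofComplex z)
  one : ∀ z : ℂ, 0 < z.im → f₁ (ofComplex (z + N)) = ε * f₁ (ofComplex z)
  two : ∀ z : ℂ, 0 < z.im → f₂ (ofComplex (z + N)) = ε * f₂ (ofComplex z)

theorem ofComplex_add_eq_smul {g : GL (Fin 2) ℝ} (hg : g.det = 1) {s N : ℝ} (hs : s ^ 2 = 1)
    (h00 : g 0 0 = s) (h01 : g 0 1 = s * N) (h10 : g 1 0 = 0) (h11 : g 1 1 = s) (z : ℍ) :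
    ofComplex (z + N) = g • z := by
  have hs0 : (s : ℂ) ≠ 0 := by
    intro h0
    norm_cast at h0
    simp [h0] at hs
  have : (z : ℂ) + N = ((g • z : ℍ) : ℂ) := by
    rw [coe_smul_eq_moebius hg, moebius, num, denom, h00, h01, h10, h11]
    push_cast
    rw [zero_mul, zero_add, ← mul_add, mul_div_cancel_left₀ _ hs0]
  rw [this, ofComplex_apply]

/-- Data that are invariant, up to a constant, under `±(1 N; 0 1)` are quasi-periodic with period
`N`.  Here `s = ±1` is the sign; as the weights have the same parity, it enters them all alike. -/
theorem isQuasiPeriodic_of_slash {g : GL (Fin 2) ℝ} (hg : g.det = 1) {s N : ℝ} (hs : s ^ 2 = 1)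
    (h00 : g 0 0 = s) (h01 : g 0 1 = s * N) (h10 : g 1 0 = 0) (h11 : g 1 1 = s) {α : ℂ} {k : ℤ}
    {c : ℂ} {φ f₀ f₁ f₂ : ℍ → ℂ} (hφ : quasiSlash α φ g = φ) (h₀ : f₀ ∣[k] g = c • f₀)
    (h₁ : f₁ ∣[k - 2] g = c • f₁) (h₂ : f₂ ∣[k - 4] g = c • f₂) :
    IsQuasiPeriodic N ((s : ℂ) ^ k * c) φ f₀ f₁ f₂ := by
  have hden : ∀ z : ℍ, denom g z = s := fun z => by
    rw [denom, h10, h11]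
    simp
  have hs' : (s : ℂ) ^ 2 = 1 := mod_cast hs
  have hs0 : (s : ℂ) ≠ 0 := by
    intro h0
    simp [h0] at hs'
  have e : ∀ (f : ℍ → ℂ) (m : ℤ), f ∣[m] g = c • f → ∀ z : ℂ, 0 < z.im →
      f (ofComplex (z + N)) = (s : ℂ) ^ m * c * f (ofComplex z) := by
    intro f m hf z hz
    lift z to ℍ using hz
    rw [ofComplex_add_eq_smul hg hs h00 h01 h10 h11, apply_smul_of_det_eq_one hg f m, hf, hden,
      ofComplex_apply, Pi.smul_apply, smul_eq_mul, mul_assoc]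
  refine ⟨fun z hz => ?_, e f₀ k h₀, ?_, ?_⟩
  · lift z to ℍ using hz
    have h2 := congrFun hφ z
    rw [quasiSlash, h10] at h2
    rw [ofComplex_add_eq_smul hg hs h00 h01 h10 h11, apply_smul_of_det_eq_one hg φ 2, hden,
      ofComplex_apply, zpow_ofNat, hs', one_mul, ← h2]
    simp
  · rw [show (s : ℂ) ^ k = (s : ℂ) ^ (k - 2) by rw [zpow_sub₀ hs0, zpow_ofNat, hs', div_one]]
    exact e f₁ _ h₁
  · rw [show (s : ℂ) ^ k = (s : ℂ) ^ (k - 4) by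
      rw [zpow_sub₀ hs0, zpow_ofNat, show (4 : ℕ) = 2 * 2 from rfl, pow_mul, hs', one_pow, div_one]]
    exact e f₂ _ h₂

/-- A quadratic polynomial with three different zeros is zero. -/
theorem quadratic_coefficients_eq_zero {A B C z N : ℂ} (hN : N ≠ 0)
    (h0 : z ^ 2 * A + z * B + C = 0) (h1 : (z + N) ^ 2 * A + (z + N) * B + C = 0)
    (h2 : (z + N + N) ^ 2 * A + (z + N + N) * B + C = 0) : A = 0 ∧ B = 0 ∧ C = 0 := by
  have hA : A = 0 := by
    refine (mul_eq_zero.1 (?_ : 2 * N ^ 2 * A = 0)).resolve_left (by simp [hN])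
    linear_combination h0 - 2 * h1 + h2
  subst hA
  have hB : B = 0 := by
    refine (mul_eq_zero.1 (?_ : N * B = 0)).resolve_left hN
    linear_combination h1 - h0
  subst hB
  exact ⟨rfl, rfl, by linear_combination h0⟩

/-- A linear relation between the `hᵢ` is a polynomial relation in `z` with quasi-periodic
coefficients, which therefore vanish separately. -/
theorem IsQuasiPeriodic.coefficients_eq_zero {N : ℝ} {ε α : ℂ} {φ f₀ f₁ f₂ : ℍ → ℂ}
    (hp : IsQuasiPeriodic N ε φ f₀ f₁ f₂) (hN : N ≠ 0) (hε : ε ≠ 0) {c : Fin 3 → ℂ}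
    (hc : ∀ z : ℂ, 0 < z.im → linComb c (hTriple α φ f₀ f₁ f₂) z = 0) (τ : ℍ) :
    c 0 * (f₀ + f₁ * φ + f₂ * φ ^ 2) τ = 0 ∧
    c 0 * α * (f₁ + 2 * f₂ * φ) τ + 2 * c 1 * (f₀ + f₁ * φ + f₂ * φ ^ 2) τ = 0 ∧
    c 0 * α ^ 2 * f₂ τ + c 1 * α * (f₁ + 2 * f₂ * φ) τ +
      c 2 * (f₀ + f₁ * φ + f₂ * φ ^ 2) τ = 0 := by
  have i0 : 0 < (τ : ℂ).im := τ.im_pos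
  have i1 : 0 < ((τ : ℂ) + N).im := by simpa using i0
  have i2 : 0 < ((τ : ℂ) + N + N).im := by simpa using i0
  have e0 := hc _ i0
  have e1 := hc _ i1
  have e2 := hc _ i2
  simp only [linComb, Fin.sum_univ_three, hTriple, Matrix.cons_val, Pi.add_apply, Pi.mul_apply,
    Pi.pow_apply, hp.phi _ i1, hp.zero _ i1, hp.one _ i1, hp.two _ i1, hp.phi _ i0, hp.zero _ i0,
    hp.one _ i0, hp.two _ i0, ofComplex_apply, Pi.ofNat_apply] at e0 e1 e2 ⊢
  refine quadratic_coefficients_eq_zero (z := τ) (N := N) (mod_cast hN) ?_ ?_ ?_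
  · linear_combination e0
  · refine mul_left_cancel₀ hε ?_
    linear_combination e1
  · refine mul_left_cancel₀ (pow_ne_zero 2 hε) ?_
    linear_combination e2

/-- A power of `(1 0; 1 1)` lies in `Γ`. -/
theorem exists_mem_lower_left_ne_zero (Γ : Subgroup (GL (Fin 2) ℝ)) [Γ.IsArithmetic] :
    ∃ γ ∈ Γ, γ 1 0 ≠ 0 := by
  let L : SL(2, ℤ) := ⟨!![1, 0; 1, 1], by simp⟩
  obtain ⟨n, hn, -, hmem⟩ := Subgroup.exists_pow_mem_of_relIndex_ne_zero
    (Subgroup.IsArithmetic.is_commensurable (𝒢 := Γ)).1 (⟨L, rfl⟩ : mapGL ℝ L ∈ 𝒮ℒ)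
  refine ⟨_, hmem.1, ?_⟩
  have hL : ∀ n : ℕ, ((L ^ n : SL(2, ℤ)) : Matrix (Fin 2) (Fin 2) ℤ) = !![1, 0; (n : ℤ), 1] := by
    intro n
    induction n with
    | zero => simp [Matrix.one_fin_two]
    | succ n ih =>
      rw [pow_succ, Matrix.SpecialLinearGroup.coe_mul, ih]
      simp [L]
  have h10 : (mapGL ℝ (L ^ n)) 1 0 = (((L ^ n : SL(2, ℤ)) 1 0 : ℤ) : ℝ) := rfl
  rw [← map_pow, h10, hL]
  simpa using hn.ne'

section Nonvanishing

variable {Γ : Subgroup (GL (Fin 2) ℝ)} [Γ.IsArithmetic] [Γ.HasDetOne] {χ : Γ →* ℂˣ} {k : ℤ}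
  {α : ℂ} {φ f₀ f₁ f₂ : ℍ → ℂ}

/-- The functions `h₁, h₂, h₃` are linearly independent.  The coefficients of the powers of `z` in a
relation are triangular in `c` with diagonal entries multiples of `f`, so it remains to exclude
`f = 0`. -/
theorem linearIndependent_hTriple (hα : α ≠ 0) (hφ : IsQuasimodularWeightTwo Γ α φ)
    (hf₀ : IsModularFormWithCharacter Γ k χ f₀)
    (hf₁ : IsModularFormWithCharacter Γ (k - 2) χ f₁)
    (hf₂ : IsModularFormWithCharacter Γ (k - 4) χ f₂) (hf₂_ne : f₂ ≠ 0) (c : Fin 3 → ℂ)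
    (hc : ∀ z : ℂ, 0 < z.im → linComb c (hTriple α φ f₀ f₁ f₂) z = 0) : c = 0 := by
  let N := Γ.strictWidthInfty
  have hN : N ≠ 0 := Γ.strictWidthInfty_pos.ne'
  have hT : Matrix.GeneralLinearGroup.upperRightHom N ∈ Γ :=
    Subgroup.mem_strictPeriods_iff.1 Γ.strictWidthInfty_mem_strictPeriods
  have hp := isQuasiPeriodic_of_slash (s := 1) (N := N) (c := (χ ⟨_, hT⟩ : ℂ))
    (Subgroup.HasDetOne.det_eq hT) (by norm_num) (by simp) (by simp) (by simp) (by simp)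
    (quasiSlash_of_mem hφ hT) (hf₀.slash ⟨_, hT⟩) (hf₁.slash ⟨_, hT⟩) (hf₂.slash ⟨_, hT⟩)
  have hε : ((1 : ℝ) : ℂ) ^ k * (χ ⟨_, hT⟩ : ℂ) ≠ 0 := by simp
  have key := fun c hc => hp.coefficients_eq_zero (α := α) hN hε (c := c) hc
  have hf : ∃ τ, (f₀ + f₁ * φ + f₂ * φ ^ 2) τ ≠ 0 := by
    by_contra! hf
    obtain ⟨γ, hγ, hγ0⟩ := exists_mem_lower_left_ne_zero Γ
    have hr := isMoebiusRelated_of_mem hφ hf₀ hf₁ hf₂ ⟨γ, hγ⟩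
    have hd := (hr.det_eq : γ.det = 1)
    -- if `f` vanishes, its transform under `γ` gives a linear relation between `h₁` and `h₂`
    have h1 : ∀ z : ℂ, 0 < z.im →
        linComb ![(γ 1 0 : ℂ), (γ 1 1 : ℂ), 0] (hTriple α φ f₀ f₁ f₂) z = 0 := by
      intro z hz
      have h2 := hr.linComb_eq hz 2
      have h3 : ∀ z, hTriple α φ f₀ f₁ f₂ 2 z = 0 := fun z => hf _
      have hχ : (χ ⟨γ, hγ⟩ : ℂ) ≠ 0 := (χ ⟨γ, hγ⟩).ne_zero
      have hγ1 : (γ 1 0 : ℂ) ≠ 0 := mod_cast hγ0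
      simp only [linComb, Fin.sum_univ_three, Matrix.smul_apply, h3, mul_zero, symSq,
        Matrix.of_apply, Matrix.cons_val, smul_eq_mul, add_zero] at h2 ⊢
      refine (mul_eq_zero.1 (?_ : (χ ⟨γ, hγ⟩ : ℂ) * (γ 1 0 : ℂ) * _ = 0)).resolve_left
        (mul_ne_zero hχ hγ1)
      linear_combination h2
    refine hf₂_ne (funext fun τ => ?_)
    obtain ⟨-, h2, h3⟩ := key _ h1 τ
    have hγ1 : (γ 1 0 : ℂ) ≠ 0 := mod_cast hγ0
    rw [hf τ] at h2 h3
    simp only [Matrix.cons_val, mul_zero, add_zero, mul_eq_zero, hγ1, hα, false_or] at h2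
    rw [h2] at h3
    simpa [hγ1, hα] using h3
  obtain ⟨τ, hτ⟩ := hf
  obtain ⟨h0, h1, h2⟩ := key c hc τ
  have c0 : c 0 = 0 := (mul_eq_zero.1 h0).resolve_right hτ
  rw [c0, zero_mul, zero_mul, zero_add] at h1
  have c1 : c 1 = 0 := by simpa using (mul_eq_zero.1 h1).resolve_right hτ
  rw [c0, c1, zero_mul, zero_mul, zero_mul, zero_mul, zero_add, zero_add] at h2
  have c2 : c 2 = 0 := (mul_eq_zero.1 h2).resolve_right hτ
  funext i
  fin_cases i <;> assumption

/-- The Wronskian of the triple vanishes on a discrete set only. -/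
theorem isIndependentAt_hTriple (hα : α ≠ 0) (hφ : IsQuasimodularWeightTwo Γ α φ)
    (hf₀ : IsModularFormWithCharacter Γ k χ f₀)
    (hf₁ : IsModularFormWithCharacter Γ (k - 2) χ f₁)
    (hf₂ : IsModularFormWithCharacter Γ (k - 4) χ f₂) (hf₂_ne : f₂ ≠ 0) {z : ℂ}
    (hz : 0 < z.im) : IsIndependentAt (hTriple α φ f₀ f₁ f₂) z := by
  have ha : ∀ z : ℂ, 0 < z.im → ∀ i, AnalyticAt ℂ (hTriple α φ f₀ f₁ f₂ i) z := fun z hz =>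
    analyticAt_hTriple hφ.holo hf₀.holo hf₁.holo hf₂.holo hz
  obtain ⟨p, hp, hp0⟩ := exists_wronskian₃_ne_zero ha
    (linearIndependent_hTriple hα hφ hf₀ hf₁ hf₂ hf₂_ne)
  refine ⟨ha z hz,
    (analyticAt_wronskian₃ (ha z hz)).eventually_eq_zero_or_eventually_ne_zero.resolve_left
      fun h0 => hp0 ?_⟩
  exact eqOn_zero_of_eventually_im_pos (fun z hz => analyticAt_wronskian₃ (ha z hz)) hz h0 hp

end Nonvanishing

/-! ### Expansions at a cusp -/

section CuspExpansion

open Function.Periodic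

/-- The filter of neighbourhoods of `i∞` in `ℂ`. -/
def imAtTop : Filter ℂ := comap Complex.im atTop

theorem eventually_imAtTop_iff {p : ℂ → Prop} :
    (∀ᶠ z in imAtTop, p z) ↔ ∃ B > 0, ∀ z : ℂ, B < z.im → p z := by
  rw [imAtTop, eventually_comap]
  constructor
  · intro h
    obtain ⟨b, hb⟩ := eventually_atTop.1 h
    exact ⟨max b 1, by positivity, fun z hz => hb z.im ((le_max_left _ _).trans hz.le) z rfl⟩
  · rintro ⟨B, -, hB⟩
    filter_upwards [eventually_gt_atTop B] with b hb z hz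
    exact hB z (hz ▸ hb)

theorem eventually_imAtTop_im_pos : ∀ᶠ z in imAtTop, 0 < z.im :=
  eventually_imAtTop_iff.2 ⟨1, one_pos, fun _ hz => one_pos.trans hz⟩

theorem eventually_imAtTop_nhds {p : ℂ → Prop} (h : ∀ᶠ z in imAtTop, p z) :
    ∀ᶠ z in imAtTop, ∀ᶠ ζ in 𝓝 z, p ζ := by
  obtain ⟨B, hB, h⟩ := eventually_imAtTop_iff.1 h
  exact eventually_imAtTop_iff.2 ⟨B, hB, fun z hz =>
    Filter.mem_of_superset ((isOpen_lt continuous_const Complex.continuous_im).mem_nhds hz) h⟩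

instance : NeBot imAtTop :=
  comap_neBot fun _ ht => by
    obtain ⟨b, hb⟩ := (mem_atTop_sets).1 ht
    exact ⟨⟨0, b⟩, hb b le_rfl⟩

variable {N : ℝ}

theorem eventually_qParam (hN : 0 < N) {p : ℂ → Prop} (h : ∀ᶠ q in 𝓝[≠] 0, p q) :
    ∀ᶠ z in imAtTop, p (qParam N z) :=
  (qParam_tendsto hN).eventually h

/-- The derivation `d/dz` in terms of `q = exp (2πiz/N)`. -/
noncomputable def cuspDeriv (N : ℝ) (T : ℂ → ℂ) (q : ℂ) : ℂ :=
  2 * Real.pi * Complex.I / N * (q * deriv T q)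

@[simp]
theorem cuspDeriv_zero (T : ℂ → ℂ) : cuspDeriv N T 0 = 0 := by
  simp [cuspDeriv]

theorem analyticAt_cuspDeriv {T : ℂ → ℂ} {q : ℂ} (hT : AnalyticAt ℂ T q) :
    AnalyticAt ℂ (cuspDeriv N T) q :=
  analyticAt_const.mul (analyticAt_id.mul hT.deriv)

theorem hasDerivAt_comp_qParam {T : ℂ → ℂ} {z : ℂ} (hT : DifferentiableAt ℂ T (qParam N z)) :
    HasDerivAt (fun ζ => T (qParam N ζ)) (cuspDeriv N T (qParam N z)) z := by
  have h1 : HasDerivAt (qParam N) (qParam N z * (2 * Real.pi * Complex.I / N)) z := by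
    have := (((hasDerivAt_id z).const_mul (2 * Real.pi * Complex.I : ℂ)).div_const (N : ℂ)).cexp
    simpa [qParam, Function.comp_def] using! this
  have h2 := hT.hasDerivAt.comp z h1
  have e : cuspDeriv N T (qParam N z) =
      deriv T (qParam N z) * (qParam N z * (2 * Real.pi * Complex.I / N)) := by
    rw [cuspDeriv]
    ring
  rw [e]
  exact h2

theorem eventually_analyticAt_qParam (hN : 0 < N) {T : ℂ → ℂ} (hT : AnalyticAt ℂ T 0) :
    ∀ᶠ z in imAtTop, AnalyticAt ℂ T (qParam N z) :=
  eventually_qParam hN (hT.eventually_analyticAt.filter_mono nhdsWithin_le_nhds)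

theorem analyticAt_comp_qParam {T : ℂ → ℂ} {z : ℂ} (hT : AnalyticAt ℂ T (qParam N z)) :
    AnalyticAt ℂ (fun ζ => T (qParam N ζ)) z :=
  hT.comp (differentiable_qParam.analyticAt z)

/-- Differentiating an expansion in `q` term by term. -/
theorem eventually_deriv_eq (hN : 0 < N) {T f : ℂ → ℂ} (hT : AnalyticAt ℂ T 0)
    (hf : ∀ᶠ z in imAtTop, f z = T (qParam N z)) :
    ∀ᶠ z in imAtTop, deriv f z = cuspDeriv N T (qParam N z) := by
  filter_upwards [eventually_imAtTop_nhds hf, eventually_analyticAt_qParam hN hT] with z h1 h2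
  rw [EventuallyEq.deriv_eq h1, (hasDerivAt_comp_qParam h2.differentiableAt).deriv]

/-- The exponential `q^p`, as a function of `z`. -/
noncomputable def qPow (N : ℝ) (p z : ℂ) : ℂ := Complex.exp (2 * Real.pi * Complex.I * p * z / N)

theorem qPow_ne_zero (p z : ℂ) : qPow N p z ≠ 0 := Complex.exp_ne_zero _

theorem qPow_natCast (n : ℕ) (z : ℂ) : qPow N n z = qParam N z ^ n := by
  rw [qPow, qParam, ← Complex.exp_nat_mul]
  congr 1
  ring

theorem qPow_add (p p' z : ℂ) : qPow N (p + p') z = qPow N p z * qPow N p' z := by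
  rw [qPow, qPow, qPow, ← Complex.exp_add]
  congr 1
  ring

theorem qPow_nat_mul (n : ℕ) (p z : ℂ) : qPow N (n * p) z = qPow N p z ^ n := by
  rw [qPow, qPow, ← Complex.exp_nat_mul]
  congr 1
  ring

theorem hasDerivAt_qPow (p z : ℂ) :
    HasDerivAt (qPow N p) (2 * Real.pi * Complex.I / N * p * qPow N p z) z := by
  have := (((hasDerivAt_id z).const_mul (2 * Real.pi * Complex.I * p : ℂ)).div_const (N : ℂ)).cexp
  refine this.congr_deriv ?_
  simp only [id, qPow]
  ring

theorem analyticAt_qPow (p z : ℂ) : AnalyticAt ℂ (qPow N p) z :=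
  Differentiable.analyticAt (fun z => (hasDerivAt_qPow p z).differentiableAt) z

/-- The logarithmic derivative of `q^p T(q)` is `2πi/N (p + m(q))` with `m` holomorphic at the cusp
and `m(0)` the order of vanishing of `T`. -/
theorem exists_logDeriv_expansion (hN : 0 < N) {T f : ℂ → ℂ} {p : ℂ} (hT : AnalyticAt ℂ T 0)
    (hf : ∀ z : ℂ, 0 < z.im → ∀ᶠ ζ in 𝓝[≠] z, f ζ ≠ 0)
    (hfe : ∀ᶠ z in imAtTop, f z = qPow N p z * T (qParam N z)) :
    ∃ n : ℕ, analyticOrderAt T 0 = n ∧ ∃ m : ℂ → ℂ, AnalyticAt ℂ m 0 ∧ m 0 = n ∧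
      ∀ᶠ z in imAtTop, f z ≠ 0 ∧
        deriv f z / f z = 2 * Real.pi * Complex.I / N * (p + m (qParam N z)) := by
  have hT0 : ∀ᶠ q in 𝓝[≠] 0, T q ≠ 0 := by
    refine hT.eventually_eq_zero_or_eventually_ne_zero.resolve_left fun h0 => ?_
    have h1 := eventually_qParam hN (h0.filter_mono nhdsWithin_le_nhds)
    obtain ⟨z, hz, hpos⟩ := ((eventually_imAtTop_nhds (hfe.and h1)).and
      eventually_imAtTop_im_pos).exists
    obtain ⟨ζ, h2, h3, h4⟩ := ((hf z hpos).and (hz.filter_mono nhdsWithin_le_nhds)).exists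
    exact h2 (by rw [h3, h4, mul_zero])
  obtain ⟨n, hn⟩ := exists_analyticOrderAt_eq_natCast hT0
  obtain ⟨m, hm, hm0, hme⟩ := exists_analyticAt_logDeriv hT hn
  refine ⟨n, hn, m, hm, hm0, ?_⟩
  filter_upwards [eventually_imAtTop_nhds hfe, eventually_qParam hN hme,
    eventually_analyticAt_qParam hN hT] with z h1 h2 h3
  have e : deriv f z = 2 * Real.pi * Complex.I / N * (p + m (qParam N z)) * f z := by
    rw [EventuallyEq.deriv_eq h1, ((hasDerivAt_qPow p z).fun_mul
      (hasDerivAt_comp_qParam h3.differentiableAt)).deriv, h1.self_of_nhds, cuspDeriv]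
    have := h2.2
    rw [sub_zero] at this
    rw [this]
    ring
  have hne : f z ≠ 0 := by
    rw [h1.self_of_nhds]
    exact mul_ne_zero (qPow_ne_zero _ _) h2.1
  exact ⟨hne, by rw [e, mul_div_cancel_right₀ _ hne]⟩

/-- If `l` is the logarithmic derivative of `h₃ / W^{1/3}` and `μ` that of `(h₂ / h₃)'`, then the
coefficients of the equation are differential polynomials in `l` and `μ`. -/
theorem coefficients_eq_of_logDeriv {h : Fin 3 → ℂ → ℂ} {z : ℂ} {l μ : ℂ → ℂ}
    (ha : ∀ i, AnalyticAt ℂ (h i) z) (hW : wronskian₃ h z ≠ 0) (h2 : h 2 z ≠ 0)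
    (hm : h 2 z * deriv (h 1) z - deriv (h 2) z * h 1 z ≠ 0)
    (hl : ∀ᶠ ζ in 𝓝 z, twistedLogDeriv h (h 2) ζ = l ζ)
    (hμ : ∀ᶠ ζ in 𝓝 z, deriv (fun ζ => h 2 ζ * deriv (h 1) ζ - deriv (h 2) ζ * h 1 ζ) ζ /
      (h 2 ζ * deriv (h 1) ζ - deriv (h 2) ζ * h 1 ζ) - 2 * (deriv (h 2) ζ / h 2 ζ) = μ ζ) :
    coeffTwo h z = -(deriv μ z + μ z ^ 2 + 3 * l z * μ z + 3 * (deriv l z + l z ^ 2)) ∧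
    coeffThree h z = -(deriv (deriv l) z + 3 * l z * deriv l z + l z ^ 3 + coeffTwo h z * l z) := by
  let m : ℂ → ℂ := fun ζ => h 2 ζ * deriv (h 1) ζ - deriv (h 2) ζ * h 1 ζ
  have hma : AnalyticAt ℂ m z := ((ha 2).mul (ha 1).deriv).sub ((ha 2).deriv.mul (ha 1))
  have hla : AnalyticAt ℂ l z := (analyticAt_twistedLogDeriv ha hW (ha 2) h2).congr hl
  have hμa : AnalyticAt ℂ μ z := ((hma.deriv.div hma hm).sub
    (analyticAt_const.mul ((ha 2).deriv.div (ha 2) h2))).congr hμ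
  -- a combination of `h₂` and `h₃` that does not vanish at `z`
  let t : ℂ := 1 - h 1 z / h 2 z
  let y : ℂ → ℂ := linComb ![0, 1, t] h
  have hy : ∀ ζ, y ζ = h 1 ζ + t * h 2 ζ := fun ζ => by
    simp [y, linComb, Fin.sum_univ_three]
  have hyz : y z ≠ 0 := by
    have : y z = h 2 z := by
      rw [hy]
      simp only [t]
      field_simp
      ring
    rwa [this]
  have hya : AnalyticAt ℂ y z := analyticAt_linComb ha _
  let u : ℂ → ℂ := fun ζ => m ζ / (y ζ * h 2 ζ)
  have hua : AnalyticAt ℂ u z := hma.div (hya.mul (ha 2)) (mul_ne_zero hyz h2)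
  have hev : ∀ᶠ ζ in 𝓝 z, (∀ i, AnalyticAt ℂ (h i) ζ) ∧ h 2 ζ ≠ 0 ∧ y ζ ≠ 0 ∧ m ζ ≠ 0 ∧
      AnalyticAt ℂ m ζ ∧ AnalyticAt ℂ y ζ :=
    (Filter.eventually_all.2 fun i => (ha i).eventually_analyticAt).and
      (((ha 2).continuousAt.eventually_ne h2).and ((hya.continuousAt.eventually_ne hyz).and
        ((hma.continuousAt.eventually_ne hm).and
          (hma.eventually_analyticAt.and hya.eventually_analyticAt))))
  have hdy : ∀ ζ, (∀ i, AnalyticAt ℂ (h i) ζ) → deriv y ζ = deriv (h 1) ζ + t * deriv (h 2) ζ := by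
    intro ζ hζ
    rw [show y = fun ζ => h 1 ζ + t * h 2 ζ from funext hy]
    exact ((hζ 1).differentiableAt.hasDerivAt.add
      ((hζ 2).differentiableAt.hasDerivAt.const_mul t)).deriv
  have e1 : twistedLogDeriv h y =ᶠ[𝓝 z] fun ζ => l ζ + u ζ := by
    filter_upwards [hev, hl] with ζ hζ h1
    rw [← h1, twistedLogDeriv, twistedLogDeriv, hdy ζ hζ.1]
    have k1 := hζ.2.1
    have k2 := hζ.2.2.1
    simp only [u, m]
    field_simp
    rw [hy]
    ring
  have e2 : deriv u =ᶠ[𝓝 z] fun ζ => u ζ * (μ ζ - u ζ) := by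
    filter_upwards [hev, hμ] with ζ hζ h1
    have k1 := hζ.2.1
    have k2 := hζ.2.2.1
    have k3 := hζ.2.2.2.1
    change deriv m ζ / m ζ - _ = _ at h1
    have d1 := hζ.2.2.2.2.2.differentiableAt.hasDerivAt.fun_mul
      (hζ.1 2).differentiableAt.hasDerivAt
    rw [← h1, (hζ.2.2.2.2.1.differentiableAt.hasDerivAt.fun_div d1 (mul_ne_zero k2 k1)).deriv]
    have key : m ζ = h 2 ζ * deriv y ζ - deriv (h 2) ζ * y ζ := by
      rw [hdy ζ hζ.1, hy]
      simp only [m]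
      ring
    simp only [u]
    field_simp
    linear_combination m ζ * key
  have e3 : deriv (deriv u) z = deriv u z * (μ z - u z) + u z * (deriv μ z - deriv u z) := by
    rw [e2.deriv_eq]
    exact (hua.differentiableAt.hasDerivAt.fun_mul
      (hμa.differentiableAt.hasDerivAt.fun_sub hua.differentiableAt.hasDerivAt)).deriv
  have r1 := isRiccati_twistedLogDeriv ha hW (Pi.single 2 1) (by rwa [linComb_single])
  rw [linComb_single] at r1
  have r2 := isRiccati_twistedLogDeriv ha hW ![0, 1, t] hyz
  have hl' : twistedLogDeriv h (h 2) =ᶠ[𝓝 z] l := hl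
  have e1' : deriv (twistedLogDeriv h y) =ᶠ[𝓝 z] fun ζ => deriv l ζ + deriv u ζ := by
    filter_upwards [e1.deriv, hla.eventually_analyticAt, hua.eventually_analyticAt] with ζ h1 h2 h3
    rw [h1, deriv_fun_add h2.differentiableAt h3.differentiableAt]
  have e1'' : deriv (deriv (twistedLogDeriv h y)) z = deriv (deriv l) z + deriv (deriv u) z := by
    rw [e1'.deriv_eq, deriv_fun_add hla.deriv.differentiableAt hua.deriv.differentiableAt]
  rw [IsRiccati, hl'.deriv.deriv_eq, hl'.deriv_eq, hl'.eq_of_nhds] at r1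
  rw [IsRiccati] at r2
  change deriv (deriv (twistedLogDeriv h y)) z + 3 * twistedLogDeriv h y z *
    deriv (twistedLogDeriv h y) z + _ + _ * twistedLogDeriv h y z + _ = 0 at r2
  rw [e1'', e1'.eq_of_nhds, e1.eq_of_nhds, e3, e2.eq_of_nhds] at r2
  have hu0 : u z ≠ 0 := div_ne_zero hm (mul_ne_zero hyz h2)
  constructor
  · refine mul_left_cancel₀ hu0 ?_
    linear_combination r2 - r1
  · linear_combination r1

/-- The Wronskian of `z² a + z b + c, 2z a + b, a` involves `z` only via `a, b, c`: the triple is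
`exp (zN)` applied to `(c, b, a)` for a constant nilpotent matrix `N`, and its `n`-th derivative is
`exp (zN)` applied to `(d/dz + N)ⁿ (c, b, a)`. -/
theorem wronskian₃_quadratic {a b c : ℂ → ℂ} {z : ℂ} (ha : AnalyticAt ℂ a z)
    (hb : AnalyticAt ℂ b z) (hc : AnalyticAt ℂ c z) :
    wronskian₃ ![fun ζ => ζ ^ 2 * a ζ + ζ * b ζ + c ζ, fun ζ => 2 * ζ * a ζ + b ζ, a] z =
      det3 ![c z, b z, a z] ![b z + deriv c z, 2 * a z + deriv b z, deriv a z]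
        ![2 * a z + 2 * deriv b z + deriv (deriv c) z, 4 * deriv a z + deriv (deriv b) z,
          deriv (deriv a) z] := by
  have d : ∀ {f : ℂ → ℂ} {ζ : ℂ}, AnalyticAt ℂ f ζ → HasDerivAt f (deriv f ζ) ζ :=
    fun hf => hf.differentiableAt.hasDerivAt
  have hev := ha.eventually_analyticAt.and (hb.eventually_analyticAt.and hc.eventually_analyticAt)
  have e0 : deriv (fun ζ => ζ ^ 2 * a ζ + ζ * b ζ + c ζ) =ᶠ[𝓝 z] fun ζ =>
      2 * ζ * a ζ + ζ ^ 2 * deriv a ζ + b ζ + ζ * deriv b ζ + deriv c ζ := by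
    filter_upwards [hev] with ζ ⟨h1, h2, h3⟩
    rw [(((((hasDerivAt_id' ζ).fun_pow 2).fun_mul (d h1)).fun_add
      ((hasDerivAt_id' ζ).fun_mul (d h2))).fun_add (d h3)).deriv]
    simp
    ring
  have e1 : deriv (fun ζ => 2 * ζ * a ζ + b ζ) =ᶠ[𝓝 z] fun ζ =>
      2 * a ζ + 2 * ζ * deriv a ζ + deriv b ζ := by
    filter_upwards [hev] with ζ ⟨h1, h2, h3⟩
    rw [((((hasDerivAt_id' ζ).const_mul 2).fun_mul (d h1)).fun_add (d h2)).deriv]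
    ring
  have f0 : deriv (deriv fun ζ => ζ ^ 2 * a ζ + ζ * b ζ + c ζ) z = 2 * a z + 4 * z * deriv a z +
      z ^ 2 * deriv (deriv a) z + 2 * deriv b z + z * deriv (deriv b) z + deriv (deriv c) z := by
    rw [e0.deriv_eq, ((((((((hasDerivAt_id' z).const_mul 2).fun_mul (d ha)).fun_add
      (((hasDerivAt_id' z).fun_pow 2).fun_mul (d ha.deriv)))).fun_add (d hb)).fun_add
      ((hasDerivAt_id' z).fun_mul (d hb.deriv))).fun_add (d hc.deriv)).deriv]
    simp
    ring
  have f1 : deriv (deriv fun ζ => 2 * ζ * a ζ + b ζ) z =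
      4 * deriv a z + 2 * z * deriv (deriv a) z + deriv (deriv b) z := by
    rw [e1.deriv_eq, ((((d ha).const_mul 2).fun_add
      (((hasDerivAt_id' z).const_mul 2).fun_mul (d ha.deriv))).fun_add (d hb.deriv)).deriv]
    ring
  rw [wronskian₃_eq_det3]
  simp only [det3, jet, iteratedDeriv_succ, iteratedDeriv_zero, Matrix.cons_val, f0, f1,
    e0.eq_of_nhds, e1.eq_of_nhds]
  ring

end CuspExpansion

/-! ### The equation at a cusp -/

section CuspEquation

open Function.Periodic

/-- Near `i∞` the triple `h` has the expansions `h₃ = q^p A(q)`, `h₂ = q^p (2z A(q) + B(q))` and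
`h₁ = q^p (z² A(q) + z B(q) + C(q))` with `A`, `B`, `C` holomorphic at `q = 0`. -/
structure HasCuspExpansion (N : ℝ) (p : ℂ) (h : Fin 3 → ℂ → ℂ) (A B C : ℂ → ℂ) : Prop where
  pos : 0 < N
  independent : ∀ z : ℂ, 0 < z.im → IsIndependentAt h z
  analyticAt_two : AnalyticAt ℂ A 0
  analyticAt_one : AnalyticAt ℂ B 0
  analyticAt_zero : AnalyticAt ℂ C 0
  eq_zero : ∀ᶠ z in imAtTop, h 0 z = qPow N p z *
    (z ^ 2 * A (qParam N z) + z * B (qParam N z) + C (qParam N z))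
  eq_one : ∀ᶠ z in imAtTop, h 1 z = qPow N p z * (2 * z * A (qParam N z) + B (qParam N z))
  eq_two : ∀ᶠ z in imAtTop, h 2 z = qPow N p z * A (qParam N z)

namespace HasCuspExpansion

variable {N : ℝ} {p : ℂ} {h : Fin 3 → ℂ → ℂ} {A B C : ℂ → ℂ}

/-- The powers of `z` cancel in the Wronskian: up to an exponential factor it is a holomorphic
function of `q`. -/
theorem exists_wronskian_expansion (he : HasCuspExpansion N p h A B C) :
    ∃ V : ℂ → ℂ, AnalyticAt ℂ V 0 ∧
      ∀ᶠ z in imAtTop, wronskian₃ h z = qPow N (3 * p) z * V (qParam N z) := by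
  have a0 := he.analyticAt_two
  have b0 := he.analyticAt_one
  have c0 := he.analyticAt_zero
  have a1 := analyticAt_cuspDeriv (N := N) a0
  have b1 := analyticAt_cuspDeriv (N := N) b0
  have c1 := analyticAt_cuspDeriv (N := N) c0
  have a2 := analyticAt_cuspDeriv (N := N) a1
  have b2 := analyticAt_cuspDeriv (N := N) b1
  have c2 := analyticAt_cuspDeriv (N := N) c1
  refine ⟨fun q => det3 ![C q, B q, A q]
    ![B q + cuspDeriv N C q, 2 * A q + cuspDeriv N B q, cuspDeriv N A q]
    ![2 * A q + 2 * cuspDeriv N B q + cuspDeriv N (cuspDeriv N C) q,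
      4 * cuspDeriv N A q + cuspDeriv N (cuspDeriv N B) q, cuspDeriv N (cuspDeriv N A) q], ?_, ?_⟩
  · simp only [det3, Matrix.cons_val]
    fun_prop
  · have dA := eventually_deriv_eq (f := fun z => A (qParam N z)) he.pos a0
      (.of_forall fun _ => rfl)
    have dB := eventually_deriv_eq (f := fun z => B (qParam N z)) he.pos b0
      (.of_forall fun _ => rfl)
    have dC := eventually_deriv_eq (f := fun z => C (qParam N z)) he.pos c0
      (.of_forall fun _ => rfl)
    filter_upwards [eventually_imAtTop_nhds (he.eq_zero.and (he.eq_one.and he.eq_two)), dA, dB, dC,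
      eventually_deriv_eq he.pos a1 dA, eventually_deriv_eq he.pos b1 dB,
      eventually_deriv_eq he.pos c1 dC, eventually_analyticAt_qParam he.pos a0,
      eventually_analyticAt_qParam he.pos b0, eventually_analyticAt_qParam he.pos c0]
      with z h1 eA eB eC eA' eB' eC' hA hB hC
    let a : ℂ → ℂ := fun z => A (qParam N z)
    let b : ℂ → ℂ := fun z => B (qParam N z)
    let c : ℂ → ℂ := fun z => C (qParam N z)
    have ha : AnalyticAt ℂ a z := analyticAt_comp_qParam hA
    have hb : AnalyticAt ℂ b z := analyticAt_comp_qParam hB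
    have hc : AnalyticAt ℂ c z := analyticAt_comp_qParam hC
    let k : Fin 3 → ℂ → ℂ :=
      ![fun ζ => ζ ^ 2 * a ζ + ζ * b ζ + c ζ, fun ζ => 2 * ζ * a ζ + b ζ, a]
    have hk : ∀ i, h i =ᶠ[𝓝 z] fun ζ => k i ζ * qPow N p ζ := by
      intro i
      filter_upwards [h1] with ζ hζ
      rw [mul_comm]
      fin_cases i
      exacts [hζ.1, hζ.2.1, hζ.2.2]
    have hka : ∀ i, AnalyticAt ℂ (k i) z := by
      intro i
      fin_cases i
      · change AnalyticAt ℂ (fun ζ => ζ ^ 2 * a ζ + ζ * b ζ + c ζ) z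
        fun_prop
      · change AnalyticAt ℂ (fun ζ => 2 * ζ * a ζ + b ζ) z
        fun_prop
      · exact ha
    have e1 : wronskian₃ h z = wronskian₃ (fun i ζ => k i ζ * qPow N p ζ) z := by
      simp only [wronskian₃, (hk _).iteratedDeriv_eq]
    rw [e1, wronskian₃_mul hka (analyticAt_qPow p z), wronskian₃_quadratic ha hb hc, ← eA', ← eB',
      ← eC', ← eA, ← eB, ← eC, ← qPow_nat_mul]
    rfl

/-- The minor of `h₃` and `h₂`, up to an exponential factor, is a holomorphic function of `q`. -/
theorem exists_minor_expansion (he : HasCuspExpansion N p h A B C) :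
    ∃ E : ℂ → ℂ, AnalyticAt ℂ E 0 ∧ ∀ᶠ z in imAtTop,
      h 2 z * deriv (h 1) z - deriv (h 2) z * h 1 z = qPow N (2 * p) z * E (qParam N z) := by
  have a0 := he.analyticAt_two
  have b0 := he.analyticAt_one
  have a1 := analyticAt_cuspDeriv (N := N) a0
  have b1 := analyticAt_cuspDeriv (N := N) b0
  refine ⟨fun q => 2 * A q ^ 2 + A q * cuspDeriv N B q - B q * cuspDeriv N A q, by fun_prop, ?_⟩
  filter_upwards [eventually_imAtTop_nhds (he.eq_one.and he.eq_two),
    eventually_analyticAt_qParam he.pos a0, eventually_analyticAt_qParam he.pos b0]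
    with z h1 hA hB
  have e1 : h 1 =ᶠ[𝓝 z] fun z => qPow N p z * (2 * z * A (qParam N z) + B (qParam N z)) :=
    h1.mono fun _ h => h.1
  have e2 : h 2 =ᶠ[𝓝 z] fun z => qPow N p z * A (qParam N z) := h1.mono fun _ h => h.2
  have dA := hasDerivAt_comp_qParam hA.differentiableAt
  have dB := hasDerivAt_comp_qParam hB.differentiableAt
  have d1 := (hasDerivAt_qPow (N := N) p z).fun_mul
    ((((hasDerivAt_id' z).const_mul 2).fun_mul dA).fun_add dB)
  have d2 := (hasDerivAt_qPow (N := N) p z).fun_mul dA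
  rw [e1.deriv_eq, e2.deriv_eq, e1.eq_of_nhds, e2.eq_of_nhds, d1.deriv, d2.deriv,
    show (2 : ℂ) * p = (2 : ℕ) * p by norm_num, qPow_nat_mul]
  ring

/-- Near a cusp the coefficients of the equation are holomorphic functions of `q`.  With
`e = a / 3` the order of `h₃ / W^{1/3}` and `m` that of `(h₂ / h₃)'`, the values at the cusp are
such that the exponents are `e`, `e + m` and `-(2e + m)`. -/
theorem exists_coefficients (he : HasCuspExpansion N p h A B C) :
    ∃ (Φ₂ Φ₃ : ℂ → ℂ) (a m : ℤ), AnalyticAt ℂ Φ₂ 0 ∧ AnalyticAt ℂ Φ₃ 0 ∧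
      (∀ᶠ z in imAtTop, wronskian₃ h z ≠ 0 ∧ coeffTwo h z = Φ₂ (qParam N z) ∧
        coeffThree h z = Φ₃ (qParam N z)) ∧
      ∀ t : ℂ, t ^ 3 + ((N : ℂ) / (2 * Real.pi * Complex.I)) ^ 2 * Φ₂ 0 * t +
        ((N : ℂ) / (2 * Real.pi * Complex.I)) ^ 3 * Φ₃ 0 =
          (t - a / 3) * (t - (a / 3 + m)) * (t + (2 * (a / 3) + m)) := by
  obtain ⟨V, hV, hVe⟩ := he.exists_wronskian_expansion
  obtain ⟨E, hE, hEe⟩ := he.exists_minor_expansion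
  obtain ⟨nA, -, mA, hmA, hmA0, hA⟩ := exists_logDeriv_expansion he.pos he.analyticAt_two
    (fun z hz => by
      simpa [linComb_single] using
        (he.independent z hz).linComb_eventually_ne (c := Pi.single 2 1) (by simp)) he.eq_two
  obtain ⟨nV, -, mV, hmV, hmV0, hV'⟩ := exists_logDeriv_expansion he.pos hV
    (fun z hz => (he.independent z hz).wronskian_ne) hVe
  obtain ⟨nE, -, mE, hmE, hmE0, hE'⟩ := exists_logDeriv_expansion he.pos hE
    (fun z hz => (he.independent z hz).minor_eventually_ne (i := 2) (j := 1) (by decide)) hEe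
  set ω : ℂ := 2 * Real.pi * Complex.I / N with hω
  have hω0 : ω ≠ 0 := div_ne_zero Complex.two_pi_I_ne_zero (mod_cast he.pos.ne')
  let L : ℂ → ℂ := fun q => ω * (mA q - mV q / 3)
  let M : ℂ → ℂ := fun q => ω * (mE q - 2 * mA q)
  have hL : AnalyticAt ℂ L 0 := analyticAt_const.mul (hmA.sub (hmV.div_const))
  have hM : AnalyticAt ℂ M 0 := analyticAt_const.mul (hmE.sub (analyticAt_const.mul hmA))
  have hL1 := analyticAt_cuspDeriv (N := N) hL
  have hL2 := analyticAt_cuspDeriv (N := N) hL1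
  have hM1 := analyticAt_cuspDeriv (N := N) hM
  let Φ₂ : ℂ → ℂ := fun q => -(cuspDeriv N M q + M q ^ 2 + 3 * L q * M q +
    3 * (cuspDeriv N L q + L q ^ 2))
  have hΦ₂ : AnalyticAt ℂ Φ₂ 0 := by
    simp only [Φ₂]
    fun_prop
  let Φ₃ : ℂ → ℂ := fun q => -(cuspDeriv N (cuspDeriv N L) q + 3 * L q * cuspDeriv N L q +
    L q ^ 3 + Φ₂ q * L q)
  have hΦ₃ : AnalyticAt ℂ Φ₃ 0 := by
    simp only [Φ₃]
    fun_prop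
  refine ⟨Φ₂, Φ₃, 3 * nA - nV, nE - 2 * nA, hΦ₂, hΦ₃, ?_, fun t => ?_⟩
  · have hl : ∀ᶠ z in imAtTop, twistedLogDeriv h (h 2) z = L (qParam N z) := by
      filter_upwards [hA, hV'] with z h1 h2
      have := h2.2
      rw [div_eq_iff h2.1] at this
      rw [twistedLogDeriv, h1.2, thirdLogDeriv, this, mul_div_mul_right _ _ h2.1]
      simp only [L]
      ring
    have hμ : ∀ᶠ z in imAtTop, deriv (fun ζ => h 2 ζ * deriv (h 1) ζ - deriv (h 2) ζ * h 1 ζ) z /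
        (h 2 z * deriv (h 1) z - deriv (h 2) z * h 1 z) - 2 * (deriv (h 2) z / h 2 z) =
          M (qParam N z) := by
      filter_upwards [hA, hE'] with z h1 h2
      rw [h1.2, h2.2]
      simp only [M]
      ring
    have dL := eventually_deriv_eq (f := fun z => L (qParam N z)) he.pos hL
      (.of_forall fun _ => rfl)
    have dM := eventually_deriv_eq (f := fun z => M (qParam N z)) he.pos hM
      (.of_forall fun _ => rfl)
    filter_upwards [eventually_imAtTop_im_pos, hA, hV', hE', eventually_imAtTop_nhds hl,
      eventually_imAtTop_nhds hμ, dL, dM, eventually_deriv_eq he.pos hL1 dL]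
      with z hz h1 h2 h3 h4 h5 eL eM eL'
    obtain ⟨k1, k2⟩ := coefficients_eq_of_logDeriv (he.independent z hz).analyticAt h2.1 h1.1 h3.1
      h4 h5
    have k3 : coeffTwo h z = Φ₂ (qParam N z) := by
      rw [k1, eL, eM]
    refine ⟨h2.1, k3, ?_⟩
    rw [k2, k3, eL, eL']
  · have e1 : (N : ℂ) / (2 * Real.pi * Complex.I) = ω⁻¹ := by
      rw [hω, inv_div]
    rw [e1]
    simp only [Φ₂, Φ₃, L, M, cuspDeriv_zero, hmA0, hmV0, hmE0]
    push_cast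
    field_simp
    ring

/-- The function `h₁ / W^{1/3}` has an expansion with a non-zero `z²`-term. -/
theorem exists_unipotent_solution (he : HasCuspExpansion N p h A B C) :
    ∃ R > 0, ∃ w : ℂ → ℂ, DifferentiableOn ℂ w {z : ℂ | R < z.im} ∧
      (∀ z : ℂ, R < z.im → wronskian₃ h z ≠ 0 ∧ w z ^ 3 = wronskian₃ h z) ∧
      ∃ (κ : ℂ) (a b c : ℂ → ℂ), AnalyticAt ℂ a 0 ∧ AnalyticAt ℂ b 0 ∧ AnalyticAt ℂ c 0 ∧
        ¬ (a =ᶠ[𝓝 0] 0) ∧ ∀ z : ℂ, R < z.im → h 0 z / w z = qPow N κ z *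
          (z ^ 2 * a (qParam N z) + z * b (qParam N z) + c (qParam N z)) := by
  obtain ⟨V, hV, hVe⟩ := he.exists_wronskian_expansion
  obtain ⟨nA, hnA, -⟩ := exists_logDeriv_expansion he.pos he.analyticAt_two
    (fun z hz => by
      simpa [linComb_single] using
        (he.independent z hz).linComb_eventually_ne (c := Pi.single 2 1) (by simp)) he.eq_two
  obtain ⟨v, hv, _, -, -, hW⟩ := exists_logDeriv_expansion he.pos hV
    (fun z hz => (he.independent z hz).wronskian_ne) hVe
  obtain ⟨u, hu, hu0, hVu⟩ := hV.analyticOrderAt_eq_natCast.1 hv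
  let r := cubeRootNear u 0
  have hr : AnalyticAt ℂ r 0 := analyticAt_cubeRootNear hu hu0
  have hr3 : ∀ q, r q ^ 3 = u q := cubeRootNear_cube hu0
  have hr0 : r 0 ≠ 0 := fun h0 => hu0 (by rw [← hr3, h0]; simp)
  have hri := hr.fun_inv hr0
  obtain ⟨R, hR, hev⟩ := eventually_imAtTop_iff.1 ((hW.and hVe).and
    ((eventually_analyticAt_qParam he.pos hr).and
    ((eventually_qParam he.pos (hVu.filter_mono nhdsWithin_le_nhds)).and he.eq_zero)))
  refine ⟨R, hR, fun z => qPow N (p + v / 3) z * r (qParam N z), fun z hz => ?_, fun z hz => ?_,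
    -(v / 3), fun q => A q * (r q)⁻¹, fun q => B q * (r q)⁻¹, fun q => C q * (r q)⁻¹,
    he.analyticAt_two.mul hri, he.analyticAt_one.mul hri, he.analyticAt_zero.mul hri, ?_,
    fun z hz => ?_⟩
  · exact ((hasDerivAt_qPow _ z).differentiableAt.mul
      (analyticAt_comp_qParam (hev z hz).2.1).differentiableAt).differentiableWithinAt
  · obtain ⟨⟨h1, h2⟩, h3, h4, h5⟩ := hev z hz
    refine ⟨h1.1, ?_⟩
    rw [mul_pow, hr3, ← qPow_nat_mul, h2, h4, sub_zero, smul_eq_mul, ← qPow_natCast, ← mul_assoc,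
      ← qPow_add]
    congr 2
    push_cast
    ring
  · intro h0
    have h1 : A =ᶠ[𝓝 0] 0 := by
      filter_upwards [h0, hr.continuousAt.eventually_ne hr0] with q h2 h3
      exact (mul_eq_zero.1 h2).resolve_right (inv_ne_zero h3)
    rw [analyticOrderAt_eq_top.2 h1] at hnA
    exact ENat.top_ne_natCast _ hnA
  · obtain ⟨-, -, -, h5⟩ := hev z hz
    rw [h5, show qPow N p z = qPow N (-(v / 3)) z * qPow N (p + v / 3) z by
      rw [← qPow_add]; congr 1; ring]
    have := qPow_ne_zero (N := N) (p + v / 3) z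
    rw [mul_assoc, mul_left_comm, mul_div_mul_left _ _ this]
    ring

end HasCuspExpansion

end CuspEquation

/-! ### Expansions of modular forms at the cusps -/

section CuspData

open Function.Periodic

/-- A bounded holomorphic function with multiplier `exp (2πip)` under `z ↦ z + N` is `q^p` times a
holomorphic function of `q`.  Here `p ≤ 0` makes `q^{-p}` bounded at `i∞`. -/
theorem exists_qExpansion_of_bounded {N : ℝ} (hN : 0 < N) {p : ℝ} (hp : p ≤ 0) {f : ℍ → ℂ}
    (hf : MDiff f) (hb : IsBoundedAtImInfty f)
    (hper : ∀ z : ℂ, 0 < z.im → f (ofComplex (z + N)) =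
      Complex.exp (2 * Real.pi * Complex.I * p) * f (ofComplex z)) :
    ∃ T : ℂ → ℂ, AnalyticAt ℂ T 0 ∧
      ∀ z : ℂ, 0 < z.im → f (ofComplex z) = qPow N p z * T (qParam N z) := by
  have hN0 : (N : ℂ) ≠ 0 := mod_cast hN.ne'
  let g : ℍ → ℂ := fun τ => (qPow N p τ)⁻¹ * f τ
  have hg : MDiff g := mdifferentiable_of_analyticAt
    (F := fun z => (qPow N p z)⁻¹ * f (ofComplex z))
    (fun z hz => ((analyticAt_qPow _ z).inv (qPow_ne_zero _ _)).mul
      (analyticAt_comp_ofComplex hf hz)) fun τ => by simp only [g, ofComplex_apply]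
  have hgb : IsBoundedAtImInfty g := by
    obtain ⟨M, R, hM⟩ := isBoundedAtImInfty_iff.1 hb
    refine isBoundedAtImInfty_iff.2 ⟨M, R, fun τ hτ => ?_⟩
    have h1 : 1 ≤ ‖qPow N p τ‖ := by
      rw [qPow, Complex.norm_exp]
      refine Real.one_le_exp ?_
      have : (2 * Real.pi * Complex.I * p * (τ : ℂ) / N).re = -p * (2 * Real.pi * τ.im / N) := by
        rw [show (2 * Real.pi * Complex.I * p * (τ : ℂ) / N) =
          ((2 * Real.pi * p / N : ℝ) : ℂ) * (Complex.I * τ) by push_cast; ring,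
          Complex.re_ofReal_mul]
        simp
        ring
      rw [this]
      have := τ.im_pos
      have := Real.pi_pos
      exact mul_nonneg (by linarith) (by positivity)
    rw [norm_mul, norm_inv]
    calc ‖qPow N p τ‖⁻¹ * ‖f τ‖ ≤ 1 * ‖f τ‖ := by
          gcongr
          exact inv_le_one_of_one_le₀ h1
      _ ≤ M := by
          rw [one_mul]
          exact hM τ hτ
  have hgper : Function.Periodic (g ∘ ofComplex) N := by
    intro z
    by_cases! hz : 0 < z.im
    · have hz' : 0 < (z + N).im := by simpa using hz
      have e : qPow N p (z + N) = Complex.exp (2 * Real.pi * Complex.I * p) * qPow N p z := by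
        rw [qPow, qPow, ← Complex.exp_add]
        congr 1
        field_simp
        ring
      simp only [Function.comp_apply, g]
      rw [hper z hz, ofComplex_apply_of_im_pos hz, ofComplex_apply_of_im_pos hz',
        UpperHalfPlane.coe_mk, UpperHalfPlane.coe_mk, e, mul_inv]
      have := Complex.exp_ne_zero (2 * Real.pi * Complex.I * p)
      field_simp
    · have hz' : (z + N).im ≤ 0 := by simpa using hz
      simp [ofComplex_apply_of_im_nonpos hz', ofComplex_apply_of_im_nonpos hz]
  refine ⟨UpperHalfPlane.cuspFunction N g, analyticAt_cuspFunction_zero hN hgper hg hgb,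
    fun z hz => ?_⟩
  have := UpperHalfPlane.eq_cuspFunction ⟨z, hz⟩ hN.ne' hgper
  rw [UpperHalfPlane.coe_mk] at this
  rw [this, ofComplex_apply_of_im_pos hz]
  simp only [g]
  rw [mul_inv_cancel_left₀ (qPow_ne_zero _ _)]

theorem qPow_zero (N : ℝ) (z : ℂ) : qPow N 0 z = 1 := by
  simp [qPow]

/-- Quasi-periodic data that are bounded at `i∞` give rise to a triple with a cusp expansion.  The
multiplier has to be of absolute value one for the exponent to be real. -/
theorem IsQuasiPeriodic.exists_hasCuspExpansion {N : ℝ} (hN : 0 < N) {ε α : ℂ} (hε : ‖ε‖ = 1)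
    {φ f₀ f₁ f₂ : ℍ → ℂ} (hp : IsQuasiPeriodic N ε φ f₀ f₁ f₂)
    (hφ : MDiff φ) (h₀ : MDiff f₀) (h₁ : MDiff f₁) (h₂ : MDiff f₂)
    (bφ : IsBoundedAtImInfty φ) (b₀ : IsBoundedAtImInfty f₀) (b₁ : IsBoundedAtImInfty f₁)
    (b₂ : IsBoundedAtImInfty f₂)
    (hi : ∀ z : ℂ, 0 < z.im → IsIndependentAt (hTriple α φ f₀ f₁ f₂) z) :
    ∃ (p : ℂ) (A B C : ℂ → ℂ), HasCuspExpansion N p (hTriple α φ f₀ f₁ f₂) A B C := by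
  -- the exponent is normalised to be negative, so that `q^{-p}` is bounded at the cusp
  obtain ⟨p, hp0, hpε⟩ : ∃ p : ℝ, p ≤ 0 ∧ ε = Complex.exp (2 * Real.pi * Complex.I * p) := by
    have hπ := Real.pi_pos
    refine ⟨ε.arg / (2 * Real.pi) - 1, ?_, ?_⟩
    · rw [sub_nonpos, div_le_one (by positivity)]
      linarith [Complex.arg_le_pi ε]
    · have h1 : (2 * Real.pi * Complex.I * ((ε.arg / (2 * Real.pi) - 1 : ℝ) : ℂ)) =
          ε.arg * Complex.I - 2 * Real.pi * Complex.I := by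
        have : (Real.pi : ℂ) ≠ 0 := mod_cast hπ.ne'
        push_cast
        field_simp
      rw [h1, Complex.exp_sub, Complex.exp_two_pi_mul_I, div_one]
      have := Complex.norm_mul_exp_arg_mul_I ε
      rw [hε] at this
      simpa using this.symm
  subst hpε
  obtain ⟨Tφ, aφ, eφ⟩ := exists_qExpansion_of_bounded hN le_rfl hφ bφ (fun z hz => by
    rw [hp.phi z hz]
    simp)
  obtain ⟨T₀, a₀, e₀⟩ := exists_qExpansion_of_bounded hN hp0 h₀ b₀ hp.zero
  obtain ⟨T₁, a₁, e₁⟩ := exists_qExpansion_of_bounded hN hp0 h₁ b₁ hp.one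
  obtain ⟨T₂, a₂, e₂⟩ := exists_qExpansion_of_bounded hN hp0 h₂ b₂ hp.two
  have e : ∀ z : ℂ, 0 < z.im → φ (ofComplex z) = Tφ (qParam N z) := fun z hz => by
    rw [eφ z hz, Complex.ofReal_zero, qPow_zero, one_mul]
  refine ⟨p, fun q => T₀ q + T₁ q * Tφ q + T₂ q * Tφ q ^ 2,
    fun q => α * (T₁ q + 2 * T₂ q * Tφ q), fun q => α ^ 2 * T₂ q, hN, hi, by fun_prop, by fun_prop,
    by fun_prop, ?_, ?_, ?_⟩
  all_goals
    filter_upwards [eventually_imAtTop_im_pos] with z hz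
    simp only [hTriple, Matrix.cons_val, Pi.add_apply, Pi.mul_apply, Pi.pow_apply,
      Pi.ofNat_apply, e z hz, e₀ z hz, e₁ z hz, e₂ z hz]
    ring

/-- The correction `α c / (cz + d)` is bounded where `Im z ≥ 1`. -/
theorem isBoundedAtImInfty_quasiSlash {α : ℂ} {φ : ℍ → ℂ} {g : GL (Fin 2) ℝ}
    (hb : IsBoundedAtImInfty (φ ∣[(2 : ℤ)] g)) : IsBoundedAtImInfty (quasiSlash α φ g) := by
  obtain ⟨M, R, hM⟩ := isBoundedAtImInfty_iff.1 hb
  refine isBoundedAtImInfty_iff.2 ⟨M + ‖α‖, max R 1, fun τ hτ => ?_⟩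
  have h1 : |g 1 0| ≤ ‖denom g τ‖ := by
    have h2 : (denom g τ).im = g 1 0 * τ.im := by simp [denom]
    calc |g 1 0| ≤ |g 1 0| * τ.im :=
          le_mul_of_one_le_right (abs_nonneg _) ((le_max_right _ _).trans hτ)
      _ = |(denom g τ).im| := by rw [h2, abs_mul, abs_of_pos τ.im_pos]
      _ ≤ _ := Complex.abs_im_le_norm _
  have h3 : ‖α * (g 1 0 : ℝ) / denom g τ‖ ≤ ‖α‖ := by
    rw [mul_div_assoc, norm_mul, norm_div, Complex.norm_real, Real.norm_eq_abs]
    exact mul_le_of_le_one_right (norm_nonneg _) (div_le_one_of_le₀ h1 (norm_nonneg _))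
  rw [quasiSlash]
  exact (norm_sub_le _ _).trans (add_le_add (hM τ ((le_max_left _ _).trans hτ)) h3)

theorem cuspWidth_pos {Γ : Subgroup (GL (Fin 2) ℝ)} [Γ.IsArithmetic] (σ : SL(2, ℤ)) :
    0 < cuspWidth Γ σ := by
  have : (ConjAct.toConjAct (mapGL ℝ σ)⁻¹ • Γ).IsArithmetic := by
    simpa [(show Rat.castHom ℝ = algebraMap ℚ ℝ by rfl), map_inv, map_mapGL]
      using! Subgroup.IsArithmetic.conj Γ (mapGL ℚ σ)⁻¹
  exact Subgroup.widthInfty_pos _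

/-- The stabiliser of the cusp `σ∞` contains a conjugate of `±(1 N; 0 1)`, with `N` the width. -/
theorem exists_mem_conj_cuspWidth (Γ : Subgroup (GL (Fin 2) ℝ)) (σ : SL(2, ℤ)) :
    ∃ (s : ℝ) (g : GL (Fin 2) ℝ), s ^ 2 = 1 ∧ g.det = 1 ∧ g 0 0 = s ∧ g 0 1 = s * cuspWidth Γ σ ∧
      g 1 0 = 0 ∧ g 1 1 = s ∧ mapGL ℝ σ * g * (mapGL ℝ σ)⁻¹ ∈ Γ := by
  have key : ∀ g, g ∈ ConjAct.toConjAct (mapGL ℝ σ)⁻¹ • Γ →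
      mapGL ℝ σ * g * (mapGL ℝ σ)⁻¹ ∈ Γ := fun g hg => by
    rw [map_inv, Γ.mem_inv_pointwise_smul_iff, ConjAct.toConjAct_smul] at hg
    exact hg
  have h1 : Matrix.GeneralLinearGroup.upperRightHom (cuspWidth Γ σ) ∈
      (ConjAct.toConjAct (mapGL ℝ σ)⁻¹ • Γ).adjoinNegOne :=
    Subgroup.mem_strictPeriods_iff.1 (Subgroup.widthInfty_mem_periods _)
  rcases Subgroup.mem_adjoinNegOne_iff.1 h1 with h2 | h2
  · refine ⟨1, _, by norm_num, ?_, ?_, ?_, ?_, ?_, key _ h2⟩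
    · ext
      simp [Matrix.det_fin_two]
    all_goals simp
  · refine ⟨-1, _, by norm_num, ?_, ?_, ?_, ?_, ?_, key _ h2⟩
    · ext
      simp [Matrix.det_fin_two]
    all_goals simp

variable {Γ : Subgroup (GL (Fin 2) ℝ)} [Γ.IsArithmetic] [Γ.HasDetOne] {χ : Γ →* ℂˣ} {k : ℤ}
  {α : ℂ} {φ f₀ f₁ f₂ : ℍ → ℂ}

theorem det_mapGL_eq_one (σ : SL(2, ℤ)) : (mapGL ℝ σ).det = 1 := by
  simp

/-- The triple attached to the data slashed to the cusp `σ∞`. -/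
noncomputable def slashedTriple (k : ℤ) (α : ℂ) (φ f₀ f₁ f₂ : ℍ → ℂ) (σ : SL(2, ℤ)) :
    Fin 3 → ℂ → ℂ :=
  hTriple α (quasiSlash α φ (mapGL ℝ σ)) (f₀ ∣[k] mapGL ℝ σ) (f₁ ∣[k - 2] mapGL ℝ σ)
    (f₂ ∣[k - 4] mapGL ℝ σ)

theorem isMoebiusRelated_slashedTriple (hφ : MDiff φ) (h₀ : MDiff f₀) (h₁ : MDiff f₁)
    (h₂ : MDiff f₂) (σ : SL(2, ℤ)) :
    IsMoebiusRelated (mapGL ℝ σ) (k - 2) (symSq (mapGL ℝ σ)) (hTriple α φ f₀ f₁ f₂)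
      (slashedTriple k α φ f₀ f₁ f₂ σ) :=
  isMoebiusRelated_hTriple (det_mapGL_eq_one σ) α k hφ h₀ h₁ h₂

/-- The finite order of `χ` makes its values have absolute value one. -/
theorem exists_hasCuspExpansion_slashedTriple (hχ : IsOfFinOrder χ) (hα : α ≠ 0)
    (hφ : IsQuasimodularWeightTwo Γ α φ)
    (hf₀ : IsModularFormWithCharacter Γ k χ f₀)
    (hf₁ : IsModularFormWithCharacter Γ (k - 2) χ f₁)
    (hf₂ : IsModularFormWithCharacter Γ (k - 4) χ f₂) (hf₂_ne : f₂ ≠ 0) {σ : SL(2, ℤ)}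
    (hσ : IsCusp (mapGL ℝ σ • ∞) Γ) :
    ∃ (p : ℂ) (A B C : ℂ → ℂ),
      HasCuspExpansion (cuspWidth Γ σ) p (slashedTriple k α φ f₀ f₁ f₂ σ) A B C := by
  have hdet := det_mapGL_eq_one σ
  obtain ⟨s, g, hs, hg, g00, g01, g10, g11, hmem⟩ := exists_mem_conj_cuspWidth Γ σ
  set δ : Γ := ⟨_, hmem⟩ with hδ
  have hδσ : (δ : GL (Fin 2) ℝ) * mapGL ℝ σ = mapGL ℝ σ * g := by
    simp [hδ]
  have hslash : ∀ (m : ℤ) (f : ℍ → ℂ), f ∣[m] (δ : GL (Fin 2) ℝ) = (χ δ : ℂ) • f →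
      (f ∣[m] mapGL ℝ σ) ∣[m] g = (χ δ : ℂ) • (f ∣[m] mapGL ℝ σ) := by
    intro m f hf
    rw [← SlashAction.slash_mul, ← hδσ, SlashAction.slash_mul, hf, ModularForm.smul_slash,
      UpperHalfPlane.σ, if_pos (det_val_pos hdet)]
    rfl
  have hquasi : quasiSlash α (quasiSlash α φ (mapGL ℝ σ)) g = quasiSlash α φ (mapGL ℝ σ) := by
    rw [← quasiSlash_mul _ hg, ← hδσ, quasiSlash_mul _ hdet, quasiSlash_of_mem hφ δ.2]
  have hper := isQuasiPeriodic_of_slash hg hs g00 g01 g10 g11 hquasi (hslash k f₀ (hf₀.slash δ))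
    (hslash _ f₁ (hf₁.slash δ)) (hslash _ f₂ (hf₂.slash δ))
  have hs1 : ‖(s : ℂ)‖ = 1 := by
    rw [Complex.norm_real, Real.norm_eq_abs, abs_eq (zero_le_one' ℝ)]
    simpa using hs
  have hχ1 : ‖(χ δ : ℂ)‖ = 1 := by
    obtain ⟨n, hn, hn'⟩ := isOfFinOrder_iff_pow_eq_one.1 hχ
    have : (χ δ : ℂ) ^ n = 1 := by
      have := DFunLike.congr_fun hn' δ
      rw [MonoidHom.pow_apply, MonoidHom.one_apply] at this
      simpa using congrArg Units.val this
    exact Complex.norm_eq_one_of_pow_eq_one this hn.ne'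
  refine hper.exists_hasCuspExpansion (cuspWidth_pos σ)
    (by rw [norm_mul, norm_zpow, hs1, hχ1]; simp)
    (mdifferentiable_quasiSlash hφ.holo _ _) (hf₀.holo.slash _ _) (hf₁.holo.slash _ _)
    (hf₂.holo.slash _ _)
    (isBoundedAtImInfty_quasiSlash (hφ.bdd_at_cusps _ hσ _ rfl))
    (hf₀.bdd_at_cusps _ hσ _ rfl) (hf₁.bdd_at_cusps _ hσ _ rfl) (hf₂.bdd_at_cusps _ hσ _ rfl)
    fun z hz => ?_
  exact (isMoebiusRelated_slashedTriple hφ.holo hf₀.holo hf₁.holo hf₂.holo σ).isIndependentAt hz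
    (isIndependentAt_hTriple hα hφ hf₀ hf₁ hf₂ hf₂_ne (moebius_im_pos hdet hz))

end CuspData

/-! ### Behaviour of the equation at the cusps -/

section AtCusps

open Function.Periodic

theorem eventually_codiscreteWithin_of_nhdsNE {U : Set ℂ} {p : ℂ → Prop}
    (h : ∀ z ∈ U, ∀ᶠ ζ in 𝓝[≠] z, p ζ) : ∀ᶠ z in codiscreteWithin U, p z :=
  mem_codiscreteWithin_iff_forall_mem_nhdsNE.2 fun z hz =>
    Filter.mem_of_superset (h z hz) fun _ hζ => Or.inl hζ

theorem hasQExpansion_of_eventually {N : ℝ} {F G Φ : ℂ → ℂ}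
    (hFG : ∀ z : ℂ, 0 < z.im → F =ᶠ[𝓝[≠] z] G)
    (hG : ∀ᶠ z in imAtTop, G z = Φ (qParam N z)) : HasQExpansion N F Φ := by
  obtain ⟨B, hB, h⟩ := eventually_imAtTop_iff.1 hG
  refine ⟨B, hB, eventually_codiscreteWithin_of_nhdsNE fun z hz => ?_⟩
  have hz' : ∀ᶠ ζ in 𝓝[≠] z, B < ζ.im := nhdsWithin_le_nhds
    ((isOpen_lt continuous_const Complex.continuous_im).mem_nhds hz)
  filter_upwards [hFG z (hB.trans hz), hz'] with ζ h1 h2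
  rw [h1, h ζ h2]

/-- Real numbers of sum zero that lie in `⅓ ℤ` and have integral differences can be put in
increasing order, and then the first one is not positive. -/
theorem exists_sorted_exponents (κ : Fin 3 → ℝ) (hsum : ∑ j, κ j = 0)
    (hint : ∀ j, ∃ m : ℤ, κ j = m / 3) (hdiff : ∀ i j, ∃ n : ℤ, κ j - κ i = n) :
    ∃ e : Equiv.Perm (Fin 3), κ (e 0) ≤ κ (e 1) ∧ κ (e 1) ≤ κ (e 2) ∧
      (∃ m : ℤ, m ≤ 0 ∧ κ (e 0) = m / 3) ∧ ∀ j, ∃ n : ℤ, κ (e j) - κ (e 0) = n := by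
  have hmono := Tuple.monotone_sort κ
  set e := Tuple.sort κ
  have h01 : κ (e 0) ≤ κ (e 1) := hmono (by decide)
  have h12 : κ (e 1) ≤ κ (e 2) := hmono (by decide)
  refine ⟨e, h01, h12, ?_, fun j => hdiff _ _⟩
  obtain ⟨m, hm⟩ := hint (e 0)
  refine ⟨m, ?_, hm⟩
  have hs : κ (e 0) + κ (e 1) + κ (e 2) = 0 := by
    rw [← hsum, ← Equiv.sum_comp e κ, Fin.sum_univ_three]
  have : (m : ℝ) ≤ 0 := by linarith
  exact_mod_cast this

variable {Γ : Subgroup (GL (Fin 2) ℝ)} {σ : SL(2, ℤ)} {h hσ : Fin 3 → ℂ → ℂ} {m : ℤ}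
  {S : Matrix (Fin 3) (Fin 3) ℂ}

/-- The transformed equation at a cusp is the equation of the transformed triple. -/
theorem IsMoebiusRelated.trans_eventuallyEq (hr : IsMoebiusRelated (mapGL ℝ σ) m S h hσ)
    (hi : ∀ z : ℂ, 0 < z.im → IsIndependentAt h z) {z : ℂ} (hz : 0 < z.im) :
    transP σ (Q₂ h) =ᶠ[𝓝[≠] z] Q₂ hσ ∧ transQ σ (Q₂ h) (Q₃ h) =ᶠ[𝓝[≠] z] Q₃ hσ := by
  have key := hr.coefficients_eq hz (hi _ (moebius_im_pos hr.det_eq hz))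
  have h10 : (((mapGL ℝ σ) 1 0 : ℝ) : ℂ) = ((σ 1 0 : ℤ) : ℂ) := by
    simp
  constructor <;> filter_upwards [key] with ζ hζ
  · rw [hζ.1]
    rfl
  · rw [hζ.2, h10]
    rfl

/-- The weight six combination, transformed to a cusp. -/
theorem IsMoebiusRelated.weightSix_eventuallyEq (hr : IsMoebiusRelated (mapGL ℝ σ) m S h hσ)
    (hi : ∀ z : ℂ, 0 < z.im → IsIndependentAt h z) {z : ℂ} (hz : 0 < z.im) :
    slashC 6 (mapGL ℝ σ) (fun z => Q₃ h z - 1 / 2 * deriv (Q₂ h) z) =ᶠ[𝓝[≠] z]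
      fun z => coeffThree hσ z - 1 / 2 * deriv (coeffTwo hσ) z := by
  have hi' := hr.isIndependentAt hz (hi _ (moebius_im_pos hr.det_eq hz))
  filter_upwards [hr.weightSix_eq hz (hi _ (moebius_im_pos hr.det_eq hz)),
    hi'.coefficients_eventuallyEq.2,
    eventually_nhdsNE_eventually_nhds_iff.2 hi'.coefficients_eventuallyEq.1] with ζ h1 h2 h3
  rw [← h2, ← EventuallyEq.deriv_eq h3, h1]
  rfl

/-- The equation is Fuchsian at the cusp, with exponents in `⅓ ℤ` that have integral differences;
the lowest is not positive because the exponents add up to zero. -/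
theorem HasCuspExpansion.exists_cuspExponents {p : ℂ} {A B C : ℂ → ℂ}
    (he : HasCuspExpansion (cuspWidth Γ σ) p hσ A B C)
    (hr : IsMoebiusRelated (mapGL ℝ σ) m S h hσ)
    (hi : ∀ z : ℂ, 0 < z.im → IsIndependentAt h z) :
    IsFuchsianAtCusp Γ (Q₂ h) (Q₃ h) σ ∧
    ∃ κ : Fin 3 → ℝ, HasCuspExponents Γ (Q₂ h) (Q₃ h) σ (fun j => (κ j : ℂ)) ∧
      κ 0 ≤ κ 1 ∧ κ 1 ≤ κ 2 ∧ (∃ m : ℤ, m ≤ 0 ∧ κ 0 = m / 3) ∧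
      ∀ j, ∃ n : ℤ, κ j - κ 0 = n := by
  obtain ⟨Φ₂, Φ₃, a, b, hΦ₂, hΦ₃, hev, hpoly⟩ := he.exists_coefficients
  have t2 : ∀ z : ℂ, 0 < z.im → transP σ (Q₂ h) =ᶠ[𝓝[≠] z] coeffTwo hσ := fun z hz =>
    (hr.trans_eventuallyEq hi hz).1.trans (he.independent z hz).coefficients_eventuallyEq.1
  have t3 : ∀ z : ℂ, 0 < z.im → transQ σ (Q₂ h) (Q₃ h) =ᶠ[𝓝[≠] z] coeffThree hσ := fun z hz =>
    (hr.trans_eventuallyEq hi hz).2.trans (he.independent z hz).coefficients_eventuallyEq.2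
  have q2 : IsHolomorphicAtInfty (cuspWidth Γ σ) (transP σ (Q₂ h)) (Φ₂ 0) :=
    ⟨Φ₂, hΦ₂, rfl, hasQExpansion_of_eventually t2 (hev.mono fun _ h => h.2.1)⟩
  have q3 : IsHolomorphicAtInfty (cuspWidth Γ σ) (transQ σ (Q₂ h) (Q₃ h)) (Φ₃ 0) :=
    ⟨Φ₃, hΦ₃, rfl, hasQExpansion_of_eventually t3 (hev.mono fun _ h => h.2.2)⟩
  refine ⟨⟨_, _, q2, q3⟩, ?_⟩
  let κ : Fin 3 → ℝ := ![(a : ℝ) / 3, (a : ℝ) / 3 + b, -(2 * ((a : ℝ) / 3) + b)]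
  obtain ⟨e, e01, e12, hm, hd⟩ := exists_sorted_exponents κ
    (by simp only [κ, Fin.sum_univ_three, Matrix.cons_val]; ring)
    (by
      intro j
      fin_cases j
      · exact ⟨a, rfl⟩
      · exact ⟨a + 3 * b, by simp [κ]; ring⟩
      · exact ⟨-(2 * a + 3 * b), by simp [κ]; ring⟩)
    (by
      have h0 : ∀ j, ∃ n : ℤ, κ j - κ 0 = n := by
        intro j
        fin_cases j
        · exact ⟨0, by simp⟩
        · exact ⟨b, by simp [κ]⟩
        · exact ⟨-(a + b), by simp [κ]; ring⟩
      intro i j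
      obtain ⟨n, hn⟩ := h0 i
      obtain ⟨n', hn'⟩ := h0 j
      exact ⟨n' - n, by push_cast; linarith⟩)
  refine ⟨fun j => κ (e j), ⟨_, _, q2, q3, fun t => ?_⟩, e01, e12, hm, hd⟩
  rw [hpoly t, Equiv.prod_comp e (fun j => t - (κ j : ℂ))]
  simp only [κ, Fin.prod_univ_three, Matrix.cons_val]
  push_cast
  ring

/-- The solution with a `z²`-term is `h₁ / W^{1/3}` for the transformed triple. -/
theorem HasCuspExpansion.isMaximallyUnipotentAtCusp {p : ℂ} {A B C : ℂ → ℂ}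
    (he : HasCuspExpansion (cuspWidth Γ σ) p hσ A B C)
    (hr : IsMoebiusRelated (mapGL ℝ σ) m S h hσ)
    (hi : ∀ z : ℂ, 0 < z.im → IsIndependentAt h z) :
    IsMaximallyUnipotentAtCusp Γ (Q₂ h) (Q₃ h) σ := by
  obtain ⟨R, hR, w, hw, hW, κ, a, b, c, ha, hb, hc, hne, hy⟩ := he.exists_unipotent_solution
  obtain ⟨hd, hs⟩ := isSolutionOn_div_cubeRoot
    (isOpen_lt continuous_const Complex.continuous_im : IsOpen {z : ℂ | R < z.im})
    (fun z hz => (he.independent z (hR.trans hz)).analyticAt) (fun z hz => (hW z hz).1) hw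
    (fun z hz => (hW z hz).2) 0
  refine ⟨R, hR, fun z => hσ 0 z / w z, ⟨hd, ?_⟩, κ, a, b, c, ha, hb, hc, hne, hy⟩
  have ht : ∀ᶠ z in codiscreteWithin {z : ℂ | R < z.im}, transP σ (Q₂ h) z = Q₂ hσ z ∧
      transQ σ (Q₂ h) (Q₃ h) z = Q₃ hσ z := eventually_codiscreteWithin_of_nhdsNE fun z hz =>
    (hr.trans_eventuallyEq hi (hR.trans hz)).1.and (hr.trans_eventuallyEq hi (hR.trans hz)).2
  filter_upwards [hs, ht] with z h1 h2
  rw [h2.1, h2.2]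
  exact h1

/-- The equation of a triple that is related to itself by all elements of `Γ` is a modular
differential equation. -/
theorem isMODE_of_isMoebiusRelated (hi : ∀ z : ℂ, 0 < z.im → IsIndependentAt h z)
    (hΓ : ∀ γ ∈ Γ, ∃ (m : ℤ) (S : Matrix (Fin 3) (Fin 3) ℂ), IsMoebiusRelated γ m S h h)
    (hcusp : AtEveryCusp Γ fun σ => ∃ (m : ℤ) (S : Matrix (Fin 3) (Fin 3) ℂ)
      (hσ : Fin 3 → ℂ → ℂ) (p : ℂ) (A B C : ℂ → ℂ), IsMoebiusRelated (mapGL ℝ σ) m S h hσ ∧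
        HasCuspExpansion (cuspWidth Γ σ) p hσ A B C) :
    IsMODE Γ (Q₂ h) (Q₃ h) := by
  refine ⟨⟨fun z hz => (hi z hz).meromorphicAt_Q₂, fun γ hγ => ?_, fun s hs σ hσs => ?_⟩,
    ⟨fun z hz => (hi z hz).meromorphicAt_Q₃.sub
      ((MeromorphicAt.const _ _).mul (hi z hz).meromorphicAt_Q₂.deriv), fun γ hγ => ?_,
      fun s hs σ hσs => ?_⟩⟩
  · obtain ⟨m, S, hr⟩ := hΓ γ hγ
    refine eventually_codiscreteWithin_of_nhdsNE fun z hz => ?_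
    filter_upwards [hr.coefficients_eq hz (hi _ (moebius_im_pos hr.det_eq hz))] with ζ hζ
    exact hζ.1.symm
  · obtain ⟨m, S, hσ, p, A, B, C, hr, he⟩ := hcusp s hs σ hσs
    obtain ⟨Φ₂, Φ₃, -, -, hΦ₂, -, hev, -⟩ := he.exists_coefficients
    exact ⟨Φ₂, hΦ₂.meromorphicAt, hasQExpansion_of_eventually (fun z hz =>
      (hr.trans_eventuallyEq hi hz).1.trans (he.independent z hz).coefficients_eventuallyEq.1)
      (hev.mono fun _ h => h.2.1)⟩
  · obtain ⟨m, S, hr⟩ := hΓ γ hγ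
    refine eventually_codiscreteWithin_of_nhdsNE fun z hz => ?_
    filter_upwards [hr.weightSix_eq hz (hi _ (moebius_im_pos hr.det_eq hz))] with ζ hζ
    exact hζ.symm
  · obtain ⟨m, S, hσ, p, A, B, C, hr, he⟩ := hcusp s hs σ hσs
    obtain ⟨Φ₂, Φ₃, -, -, hΦ₂, hΦ₃, hev, -⟩ := he.exists_coefficients
    refine ⟨fun q => Φ₃ q - 1 / 2 * cuspDeriv (cuspWidth Γ σ) Φ₂ q,
      (hΦ₃.sub (analyticAt_const.mul (analyticAt_cuspDeriv hΦ₂))).meromorphicAt,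
      hasQExpansion_of_eventually (fun z hz => hr.weightSix_eventuallyEq hi hz) ?_⟩
    filter_upwards [hev, eventually_deriv_eq he.pos hΦ₂ (hev.mono fun _ h => h.2.1)] with z h1 h2
    rw [h1.2.2, h2]

end AtCusps

/-! ### Elliptic points -/

section EllipticPoints

variable {g : GL (Fin 2) ℝ} {m : ℤ} {S : Matrix (Fin 3) (Fin 3) ℂ} {h : Fin 3 → ℂ → ℂ} {z₀ : ℂ}

theorem moebius_sub_moebius (hg : g.det = 1) {z w : ℂ} (hz : denom g z ≠ 0) (hw : denom g w ≠ 0) :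
    moebius g z - moebius g w = (z - w) / (denom g z * denom g w) := by
  have := det_eq_one_iff_entries.1 hg
  rw [moebius, moebius]
  field_simp
  rw [num, num, denom, denom]
  linear_combination (z - w) * this

/-- An eigenvector of an elliptic element: comparing leading coefficients at the fixed point
relates the eigenvalue and the order of vanishing. -/
theorem IsMoebiusRelated.denom_pow_eq (hr : IsMoebiusRelated g m S h h) (hz : 0 < z₀.im)
    (hfix : moebius g z₀ = z₀) {c : Fin 3 → ℂ} {l : ℂ} (hc : ∀ j, ∑ i, c i * S i j = l * c j)
    {n : ℕ} (hn : analyticOrderAt (linComb c h) z₀ = n) :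
    (denom g z₀ ^ 2) ^ n * (denom g z₀ ^ m * l) = 1 := by
  have hya : AnalyticAt ℂ (linComb c h) z₀ := analyticAt_linComb (hr.left _ hz) c
  have hD := denom_ne_zero_of_im_pos g hz
  obtain ⟨u, hu, hu0, hyu⟩ := hya.analyticOrderAt_eq_natCast.1 hn
  have hM := (analyticAt_moebius hD).continuousAt
  have hM' : Tendsto (moebius g) (𝓝 z₀) (𝓝 z₀) := by
    have := hM.tendsto
    rwa [hfix] at this
  have hrel : ∀ z : ℂ, 0 < z.im →
      linComb c h (moebius g z) = denom g z ^ m * l * linComb c h z := by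
    intro z hz
    have e : ∀ i, h i (moebius g z) = denom g z ^ m * linComb (S i) h z := hr.rel z hz
    have h0 := hc 0
    have h1 := hc 1
    have h2 := hc 2
    simp only [linComb, Fin.sum_univ_three, e] at h0 h1 h2 ⊢
    linear_combination denom g z ^ m * (h 0 z * h0 + h 1 z * h1 + h 2 z * h2)
  have e : (fun z => u (moebius g z)) =ᶠ[𝓝[≠] z₀] fun z =>
      (denom g z * denom g z₀) ^ n * (denom g z ^ m * l) * u z := by
    filter_upwards [(hM'.eventually hyu).filter_mono nhdsWithin_le_nhds,
      hyu.filter_mono nhdsWithin_le_nhds,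
      (eventually_im_pos hz).filter_mono nhdsWithin_le_nhds, self_mem_nhdsWithin] with z h1 h2 h3 h4
    have hDz := denom_ne_zero_of_im_pos g h3
    have h5 := moebius_sub_moebius hr.det_eq hDz hD
    rw [hfix] at h5
    have hz0 : (z - z₀) ^ n ≠ 0 := pow_ne_zero _ (sub_ne_zero.2 h4)
    rw [hrel z h3, h2, h5, smul_eq_mul, smul_eq_mul, div_pow] at h1
    have hDn : (denom g z * denom g z₀) ^ n ≠ 0 := pow_ne_zero _ (mul_ne_zero hDz hD)
    refine mul_left_cancel₀ hz0 ?_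
    field_simp at h1
    linear_combination -(z - z₀) ^ n * h1
  have c1 : ContinuousAt (fun z => u (moebius g z)) z₀ :=
    ContinuousAt.comp' (by rw [hfix]; exact hu.continuousAt) hM
  have c2 : ContinuousAt (fun z => (denom g z * denom g z₀) ^ n * (denom g z ^ m * l) * u z) z₀ :=
    ((((analyticAt_denom g z₀).continuousAt.mul continuousAt_const).pow n).mul
      (((analyticAt_denom g z₀).continuousAt.zpow₀ m (Or.inl hD)).mul continuousAt_const)).mul
      hu.continuousAt
  have key : u (moebius g z₀) = _ := tendsto_nhds_unique
    (c1.tendsto.mono_left (nhdsWithin_le_nhds (s := {z₀}ᶜ)))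
    ((c2.tendsto.mono_left nhdsWithin_le_nhds).congr' e.symm)
  rw [hfix] at key
  refine mul_right_cancel₀ hu0 ?_
  rw [one_mul, sq]
  exact key.symm

/-- The coefficients of the quadratic polynomial `(z - s)(z - t)` with respect to `z²`, `2z`,
`1`. -/
noncomputable def quadraticVec (s t : ℂ) : Fin 3 → ℂ := ![1, -(s + t) / 2, s * t]

theorem quadraticVec_ne_zero (s t : ℂ) : quadraticVec s t ≠ 0 := fun h0 => by
  simpa [quadraticVec] using congrFun h0 0

/-- Polynomials whose zeros are fixed points of `g` are eigenvectors of the symmetric square. -/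
theorem quadraticVec_symSq {s t : ℂ}
    (hs : (g 0 0 : ℂ) * s + g 0 1 = s * ((g 1 0 : ℂ) * s + g 1 1))
    (ht : (g 0 0 : ℂ) * t + g 0 1 = t * ((g 1 0 : ℂ) * t + g 1 1)) (x : ℂ) (j : Fin 3) :
    ∑ i, quadraticVec s t i * (x • symSq g) i j =
      x * (((g 0 0 : ℂ) - g 1 0 * s) * ((g 0 0 : ℂ) - g 1 0 * t)) * quadraticVec s t j := by
  simp only [Fin.sum_univ_three, quadraticVec, symSq, Matrix.smul_apply, Matrix.of_apply,
    smul_eq_mul]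
  generalize (g 0 0 : ℂ) = a at *
  generalize (g 0 1 : ℂ) = b at *
  generalize (g 1 0 : ℂ) = c at *
  generalize (g 1 1 : ℂ) = d at *
  fin_cases j
  · simp
    ring
  · simp
    linear_combination x / 2 * ((a - c * s) * ht + (a - c * t) * hs)
  · simp
    linear_combination x * (hs * (b - d * t) - s * (a - c * s) * ht)

theorem pow_eq_pow_iff_modEq_of_prime {p : ℕ} [Fact p.Prime] {ζ : ℂ} (h1 : ζ ^ p = 1)
    (h2 : ζ ≠ 1) {a b : ℕ} : ζ ^ a = ζ ^ b ↔ a ≡ b [MOD p] := by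
  rw [IsOfFinOrder.pow_eq_pow_iff_modEq
    (isOfFinOrder_iff_pow_eq_one.2 ⟨p, (Fact.out : p.Prime).pos, h1⟩), orderOf_eq_prime h1 h2]

/-- At `i` the element `(0 -1; 1 0)` has eigenvalues `-1, 1, -1` on the symmetric square, up to a
common factor, so that exactly two of the orders of vanishing have equal parity.  The order `w` of
the Wronskian is the sum of the orders minus three, so it has the parity of these two, and this
determines the numbers `3n - w` modulo two. -/
theorem exists_localExponents_I (hi : IsIndependentAt h Complex.I) {x : ℂ}
    (h00 : g 0 0 = 0) (h01 : g 0 1 = -1) (h10 : g 1 0 = 1) (h11 : g 1 1 = 0)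
    (hr : IsMoebiusRelated g m (x • symSq g) h h) :
    ∃ n : Fin 3 → ℤ, HasLocalExponents (Q₂ h) (Q₃ h) Complex.I (fun j => (n j : ℂ) / 3) ∧
      (Finset.univ.val.map fun j => (n j : ZMod 2)) = {0, 0, 1} := by
  have hD : denom g Complex.I = Complex.I := by
    rw [denom, h10, h11]
    simp
  have hfix : moebius g Complex.I = Complex.I := by
    rw [moebius, hD, num, h00, h01]
    simp
  have hI := Complex.I_mul_I
  have heig : ∀ s t : ℂ, s * s = -1 → t * t = -1 → ∀ j,
      ∑ i, quadraticVec s t i * (x • symSq g) i j = x * (s * t) * quadraticVec s t j := by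
    intro s t hs ht j
    rw [quadraticVec_symSq (by simp [h00, h01, h10, h11, hs]) (by simp [h00, h01, h10, h11, ht]),
      h00, h10]
    push_cast
    ring
  have hpos : 0 < Complex.I.im := by simp
  -- the order of an eigenvector is determined modulo two by its eigenvalue
  have hord : ∀ {c : Fin 3 → ℂ} {l : ℂ} {n : ℕ},
      (∀ j, ∑ i, c i * (x • symSq g) i j = l * c j) →
      analyticOrderAt (linComb c h) Complex.I = n → (-1) ^ n * (Complex.I ^ m * l) = 1 := by
    intro c l n hc hn
    have := hr.denom_pow_eq hpos hfix hc hn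
    rwa [hD, Complex.I_sq] at this
  have hmod : ∀ {a b : ℕ}, (-1 : ℂ) ^ a = (-1) ^ b → a ≡ b [MOD 2] := fun h =>
    (pow_eq_pow_iff_modEq_of_prime (p := 2) (by norm_num) (by norm_num)).1 h
  have e1 := heig Complex.I Complex.I hI hI
  have e2 := heig Complex.I (-Complex.I) hI (by simp)
  have e3 := heig (-Complex.I) (-Complex.I) (by simp) (by simp)
  obtain ⟨n₁, hn₁⟩ := hi.exists_order (quadraticVec_ne_zero Complex.I Complex.I)
  obtain ⟨n₂, hn₂⟩ := hi.exists_order (quadraticVec_ne_zero Complex.I (-Complex.I))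
  obtain ⟨k, hk⟩ := hi.exists_order (quadraticVec_ne_zero (-Complex.I) (-Complex.I))
  -- a vector of the eigenspace of the first vector with another order of vanishing
  obtain ⟨c₃, n₃, e₃, hn₃, hne⟩ : ∃ (c₃ : Fin 3 → ℂ) (n₃ : ℕ),
      (∀ j, ∑ i, c₃ i * (x • symSq g) i j = x * (Complex.I * Complex.I) * c₃ j) ∧
      analyticOrderAt (linComb c₃ h) Complex.I = n₃ ∧ n₁ ≠ n₃ := by
    have e3' : ∀ j, ∑ i, quadraticVec (-Complex.I) (-Complex.I) i * (x • symSq g) i j =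
        x * (Complex.I * Complex.I) * quadraticVec (-Complex.I) (-Complex.I) j := by
      intro j
      rw [e3, neg_mul_neg]
    by_cases hkn : n₁ = k
    · obtain ⟨a, ha⟩ := exists_lt_analyticOrderAt_sub (analyticAt_linComb hi.analyticAt _)
        (analyticAt_linComb hi.analyticAt _) hn₁ (by rw [hk, hkn])
      rw [← linComb_sub_smul] at ha
      have hv : quadraticVec (-Complex.I) (-Complex.I) -
          a • quadraticVec Complex.I Complex.I ≠ 0 := by
        intro h0
        have k0 := congrFun h0 0
        have k1 := congrFun h0 1
        simp only [quadraticVec, Pi.sub_apply, Pi.smul_apply, smul_eq_mul, Matrix.cons_val,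
          Pi.zero_apply] at k0 k1
        have ha1 : a = 1 := by linear_combination -k0
        rw [ha1] at k1
        exact Complex.I_ne_zero (by linear_combination k1 / 2)
      obtain ⟨n₃, hn₃⟩ := hi.exists_order hv
      refine ⟨_, n₃, fun j => ?_, hn₃, ?_⟩
      · have k1 := e1 j
        have k3 := e3' j
        simp only [Fin.sum_univ_three, Pi.sub_apply, Pi.smul_apply, smul_eq_mul] at k1 k3 ⊢
        linear_combination k3 - a * k1
      · rw [hn₃] at ha
        exact_mod_cast ha.ne
    · exact ⟨_, k, e3', hk, hkn⟩
  have o1 := hord e1 hn₁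
  have o2 := hord e2 hn₂
  have o3 := hord e₃ hn₃
  rw [hI] at o1 o3
  rw [mul_neg, hI, neg_neg] at o2
  have hx : Complex.I ^ m * x ≠ 0 := fun h0 => by
    rw [mul_one, h0, mul_zero] at o2
    exact zero_ne_one o2
  have m13 : n₁ ≡ n₃ [MOD 2] := hmod (mul_right_cancel₀ hx (by linear_combination o3 - o1))
  have m12 : n₁ ≡ n₂ + 1 [MOD 2] := hmod (mul_right_cancel₀ hx (by
    rw [pow_succ]
    linear_combination -o1 + o2))
  obtain ⟨w, hw⟩ := hi.exists_wronskian_order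
  have hinj : Function.Injective ![n₁, n₃, n₂] := by
    rw [Nat.ModEq] at m13 m12
    intro a b hab
    fin_cases a <;> fin_cases b <;> simp at hab ⊢ <;> omega
  obtain ⟨k1, k2⟩ := hi.hasLocalExponents (c := ![quadraticVec Complex.I Complex.I, c₃,
    quadraticVec Complex.I (-Complex.I)]) hinj
    (by
      intro j
      fin_cases j
      exacts [hn₁, hn₃, hn₂]) hw
  refine ⟨fun j => 3 * ((![n₁, n₃, n₂] : Fin 3 → ℕ) j : ℤ) - w, ?_, ?_⟩
  · convert k1 using 2
    push_cast
    ring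
  · simp only [Matrix.cons_val] at k2
    rw [Nat.ModEq] at m13 m12
    have r : ∀ {a : ℤ} {b : ℤ}, a % 2 = b % 2 → ((a : ℤ) : ZMod 2) = (b : ZMod 2) := fun h =>
      (ZMod.intCast_eq_intCast_iff _ _ 2).2 h
    have r1 : ((3 * (n₁ : ℤ) - w : ℤ) : ZMod 2) = ((0 : ℤ) : ZMod 2) := r (by omega)
    have r3 : ((3 * (n₃ : ℤ) - w : ℤ) : ZMod 2) = ((0 : ℤ) : ZMod 2) := r (by omega)
    have r2 : ((3 * (n₂ : ℤ) - w : ℤ) : ZMod 2) = ((1 : ℤ) : ZMod 2) := r (by omega)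
    rw [Fin.univ_val_map]
    simp only [List.ofFn_succ, List.ofFn_zero, Fin.succ_zero_eq_one, Fin.succ_one_eq_two,
      Matrix.cons_val, r1, r2, r3]
    simp
    rfl

/-- At `ρ` the element `(0 -1; 1 1)`, of order three in `PSL(2, ℤ)`, has three different eigenvalues
on the symmetric square, so the orders of vanishing are pairwise incongruent modulo three.  Hence
their sum, and with it the order of the Wronskian, is divisible by three. -/
theorem exists_localExponents_rho {ρ : ℂ} (hρ : ρ ^ 2 + ρ + 1 = 0) (hpos : 0 < ρ.im)
    (hi : IsIndependentAt h ρ) {x : ℂ}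
    (h00 : g 0 0 = 0) (h01 : g 0 1 = -1) (h10 : g 1 0 = 1) (h11 : g 1 1 = 1)
    (hr : IsMoebiusRelated g m (x • symSq g) h h) :
    ∃ n : Fin 3 → ℤ, HasLocalExponents (Q₂ h) (Q₃ h) ρ (fun j => (n j : ℂ)) ∧
      (Finset.univ.val.map fun j => (n j : ZMod 3)) = {0, 1, 2} := by
  have hD : denom g ρ = ρ + 1 := by
    rw [denom, h10, h11]
    simp
  have hD2 : denom g ρ ^ 2 = ρ := by
    rw [hD]
    linear_combination hρ
  have hfix : moebius g ρ = ρ := by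
    have h0 : ρ + 1 ≠ 0 := hD ▸ denom_ne_zero_of_im_pos g hpos
    rw [moebius, hD, num, h00, h01, div_eq_iff h0]
    push_cast
    linear_combination -hρ
  have hρ3 : ρ ^ 3 = 1 := by linear_combination (ρ - 1) * hρ
  have hρ1 : ρ ≠ 1 := by
    rintro rfl
    simp at hpos
  -- the second fixed point of the elliptic element is `ρ²`
  have heig : ∀ s t : ℂ, s ^ 2 + s + 1 = 0 → t ^ 2 + t + 1 = 0 → ∀ j,
      ∑ i, quadraticVec s t i * (x • symSq g) i j = x * (s * t) * quadraticVec s t j := by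
    intro s t hs ht j
    rw [quadraticVec_symSq (by rw [h00, h01, h10, h11]; push_cast; linear_combination -hs)
      (by rw [h00, h01, h10, h11]; push_cast; linear_combination -ht), h00, h10]
    push_cast
    ring
  have hρ' : (ρ ^ 2) ^ 2 + ρ ^ 2 + 1 = 0 := by linear_combination (ρ ^ 2 - ρ + 1) * hρ
  obtain ⟨n₁, hn₁⟩ := hi.exists_order (quadraticVec_ne_zero ρ ρ)
  obtain ⟨n₂, hn₂⟩ := hi.exists_order (quadraticVec_ne_zero ρ (ρ ^ 2))
  obtain ⟨n₃, hn₃⟩ := hi.exists_order (quadraticVec_ne_zero (ρ ^ 2) (ρ ^ 2))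
  have o1 := hr.denom_pow_eq hpos hfix (heig ρ ρ hρ hρ) hn₁
  have o2 := hr.denom_pow_eq hpos hfix (heig ρ (ρ ^ 2) hρ hρ') hn₂
  have o3 := hr.denom_pow_eq hpos hfix (heig (ρ ^ 2) (ρ ^ 2) hρ' hρ') hn₃
  rw [hD2] at o1 o2 o3
  have hx : denom g ρ ^ m * x ≠ 0 := fun h0 => by
    rw [← mul_assoc (denom g ρ ^ m), h0, zero_mul, mul_zero] at o2
    exact zero_ne_one o2
  have hmod : ∀ {a b : ℕ}, ρ ^ a = ρ ^ b → a ≡ b [MOD 3] := fun h =>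
    (pow_eq_pow_iff_modEq_of_prime (p := 3) hρ3 hρ1).1 h
  have m1 : n₁ + 2 ≡ n₂ [MOD 3] := hmod (mul_right_cancel₀ hx (by
    rw [pow_add]
    linear_combination o1 - o2 + denom g ρ ^ m * x * ρ ^ n₂ * hρ3))
  have m3 : n₃ + 1 ≡ n₂ [MOD 3] := hmod (mul_right_cancel₀ hx (by
    rw [pow_add]
    linear_combination o3 - o2 + denom g ρ ^ m * x * (ρ ^ n₂ - ρ ^ n₃ * ρ) * hρ3))
  rw [Nat.ModEq] at m1 m3
  obtain ⟨w, hw⟩ := hi.exists_wronskian_order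
  have hinj : Function.Injective ![n₁, n₂, n₃] := by
    intro a b hab
    fin_cases a <;> fin_cases b <;> simp at hab ⊢ <;> omega
  obtain ⟨k1, k2⟩ := hi.hasLocalExponents (c := ![quadraticVec ρ ρ, quadraticVec ρ (ρ ^ 2),
    quadraticVec (ρ ^ 2) (ρ ^ 2)]) hinj
    (by
      intro j
      fin_cases j
      exacts [hn₁, hn₂, hn₃]) hw
  simp only [Matrix.cons_val] at k2
  obtain ⟨v, rfl⟩ : 3 ∣ w := by omega
  refine ⟨fun j => ((![n₁, n₂, n₃] : Fin 3 → ℕ) j : ℤ) - v, ?_, ?_⟩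
  · convert k1 using 2
    push_cast
    ring
  · have r : ∀ {a : ℤ} {b : ℤ}, a % 3 = b % 3 → ((a : ℤ) : ZMod 3) = (b : ZMod 3) := fun h =>
      (ZMod.intCast_eq_intCast_iff _ _ 3).2 h
    have r1 : (((n₁ : ℤ) - v : ℤ) : ZMod 3) = (((n₂ : ℤ) - v + 1 : ℤ) : ZMod 3) := r (by omega)
    have r3 : (((n₃ : ℤ) - v : ℤ) : ZMod 3) = (((n₂ : ℤ) - v - 1 : ℤ) : ZMod 3) := r (by omega)
    rw [Fin.univ_val_map]
    simp only [List.ofFn_succ, List.ofFn_zero, Fin.succ_zero_eq_one, Fin.succ_one_eq_two,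
      Matrix.cons_val, r1, r3]
    rw [Int.cast_add, Int.cast_sub _ 1, Int.cast_one]
    generalize (((n₂ : ℤ) - v : ℤ) : ZMod 3) = y
    revert y
    decide

end EllipticPoints

/-! ### The equation attached to a quasimodular form of depth two -/

theorem theorem1p1 (Γ : Subgroup (GL (Fin 2) ℝ)) [Γ.IsArithmetic] [Γ.HasDetOne]
    (χ : Γ →* ℂˣ) (hχ : IsOfFinOrder χ) (k : ℤ) (α : ℂ) (hα : α ≠ 0)
    (φ f₀ f₁ f₂ : ℍ → ℂ) (hφ : IsQuasimodularWeightTwo Γ α φ)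
    (hf₀ : IsModularFormWithCharacter Γ k χ f₀)
    (hf₁ : IsModularFormWithCharacter Γ (k - 2) χ f₁)
    (hf₂ : IsModularFormWithCharacter Γ (k - 4) χ f₂) (hf₂_ne : f₂ ≠ 0)
    (h : Fin 3 → ℂ → ℂ) (hh : h = hTriple α φ f₀ f₁ f₂) :
    -- the functions `gⱼ = hⱼ / W^{1/3}` make sense and solve the equation
    (∃ z : ℂ, 0 < z.im ∧ wronskian₃ h z ≠ 0) ∧
    (∀ (U : Set ℂ) (w : ℂ → ℂ), IsOpen U → U ⊆ {z : ℂ | 0 < z.im} →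
      (∀ z ∈ U, wronskian₃ h z ≠ 0) → DifferentiableOn ℂ w U →
      (∀ z ∈ U, w z ^ 3 = wronskian₃ h z) →
      ∀ j, IsSolutionOn (Q₂ h) (Q₃ h) U (fun z => h j z / w z)) ∧
    -- the equation is a MODE satisfying (H1), (H2), (H3)
    IsMODE Γ (Q₂ h) (Q₃ h) ∧
    ConditionH1 Γ (Q₂ h) (Q₃ h) ∧ ConditionH2 (Q₂ h) (Q₃ h) ∧ ConditionH3 Γ (Q₂ h) (Q₃ h) ∧
    -- singular points come from zeros of the Wronskian, cusps are maximally unipotent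
    (∀ z₀ : ℂ, 0 < z₀.im → IsSingularPoint (Q₂ h) (Q₃ h) z₀ → wronskian₃ h z₀ = 0) ∧
    AtEveryCusp Γ (IsMaximallyUnipotentAtCusp Γ (Q₂ h) (Q₃ h)) ∧
    -- the exponents at the elliptic points of the full modular group
    (Γ = 𝒮ℒ →
      (∃ n : Fin 3 → ℤ, HasLocalExponents (Q₂ h) (Q₃ h) Complex.I (fun j => (n j : ℂ) / 3) ∧
        (Finset.univ.val.map fun j => (n j : ZMod 2)) = {0, 0, 1}) ∧
      (∃ n : Fin 3 → ℤ,
        HasLocalExponents (Q₂ h) (Q₃ h) ((-1 + Real.sqrt 3 * Complex.I) / 2) (fun j => (n j : ℂ)) ∧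
        (Finset.univ.val.map fun j => (n j : ZMod 3)) = {0, 1, 2})) := by
  subst hh
  have hi : ∀ z : ℂ, 0 < z.im → IsIndependentAt (hTriple α φ f₀ f₁ f₂) z := fun z hz =>
    isIndependentAt_hTriple hα hφ hf₀ hf₁ hf₂ hf₂_ne hz
  have hΓ := isMoebiusRelated_of_mem hφ hf₀ hf₁ hf₂
  have hr := isMoebiusRelated_slashedTriple (k := k) (α := α) hφ.holo hf₀.holo hf₁.holo hf₂.holo
  have hcusp : ∀ (s : OnePoint ℝ), IsCusp s Γ → ∀ σ : SL(2, ℤ), mapGL ℝ σ • ∞ = s →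
      ∃ (p : ℂ) (A B C : ℂ → ℂ),
        HasCuspExpansion (cuspWidth Γ σ) p (slashedTriple k α φ f₀ f₁ f₂ σ) A B C := by
    rintro s hs σ rfl
    exact exists_hasCuspExpansion_slashedTriple hχ hα hφ hf₀ hf₁ hf₂ hf₂_ne hs
  refine ⟨?_, fun U w hU hUpos hW hw he => ?_, isMODE_of_isMoebiusRelated hi
    (fun γ hγ => ⟨_, _, hΓ ⟨γ, hγ⟩⟩) fun s hs σ hσ => ?_,
    ⟨fun z hz => (hi z hz).fuchsian, fun s hs σ hσ => ?_⟩,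
    fun z hz _ => ⟨(hi z hz).exists_ordered_exponents, (hi z hz).isApparentAt⟩,
    fun s hs σ hσ => ?_, fun z hz => (hi z hz).wronskian_eq_zero_of_isSingularPoint,
    fun s hs σ hσ => ?_, ?_⟩
  · have hI : 0 < Complex.I.im := by simp
    obtain ⟨z, hz, hpos⟩ := ((hi _ hI).wronskian_ne.and
      ((eventually_im_pos hI).filter_mono nhdsWithin_le_nhds)).exists
    exact ⟨z, hpos, hz⟩
  · exact isSolutionOn_div_cubeRoot hU (fun z hz => (hi z (hUpos hz)).analyticAt) hW hw he
  · obtain ⟨p, A, B, C, hexp⟩ := hcusp s hs σ hσ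
    exact ⟨_, _, _, p, A, B, C, hr σ, hexp⟩
  · obtain ⟨p, A, B, C, hexp⟩ := hcusp s hs σ hσ
    exact (hexp.exists_cuspExponents (hr σ) hi).1
  · obtain ⟨p, A, B, C, hexp⟩ := hcusp s hs σ hσ
    exact (hexp.exists_cuspExponents (hr σ) hi).2
  · obtain ⟨p, A, B, C, hexp⟩ := hcusp s hs σ hσ
    exact hexp.isMaximallyUnipotentAtCusp (hr σ) hi
  · rintro rfl
    have hent : ∀ (L : SL(2, ℤ)) (i j), (mapGL ℝ L) i j = ((L i j : ℤ) : ℝ) := fun _ _ _ => rfl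
    constructor
    · exact exists_localExponents_I (hi _ (by simp)) (by rw [hent]; simp [ModularGroup.S])
        (by rw [hent]; simp [ModularGroup.S]) (by rw [hent]; simp [ModularGroup.S])
        (by rw [hent]; simp [ModularGroup.S]) (hΓ ⟨mapGL ℝ ModularGroup.S, _, rfl⟩)
    · let L : SL(2, ℤ) := ⟨!![0, -1; 1, 1], by simp⟩
      have hpos : 0 < ((-1 + Real.sqrt 3 * Complex.I) / 2 : ℂ).im := by simp
      refine exists_localExponents_rho ?_ hpos (hi _ hpos) (by rw [hent]; simp [L])
        (by rw [hent]; simp [L])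
        (by rw [hent]; simp [L]) (by rw [hent]; simp [L]) (hΓ ⟨mapGL ℝ L, _, rfl⟩)
      have h3 : ((Real.sqrt 3 : ℝ) : ℂ) ^ 2 = 3 := by
        rw [← Complex.ofReal_pow, Real.sq_sqrt (by norm_num)]
        norm_num
      linear_combination (Complex.I ^ 2 / 4) * h3 + 3 / 4 * Complex.I_sq
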